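/- Let $U,V$ be real Banach spaces, $p\ge 2$, $T\ge 0$, and let $N=[p]$ be the integer part of $p$. **Tensors.** Fix a submultiplicative norm on the truncated algebraic tensor algebra $\bigoplus_{k=0}^{N}V^{\otimes_a k}$ which equals the norm of $V$ on $V$ and for which the projections $\pi_k$ onto the homogeneous components are continuous; let $T^N(V)$ be its completion. Let $\mathfrak g^N(V)$ be the closed Lie subalgebra of $T^N(V)$ generated by $V$, and $\mathcal G^N(V)=\exp(\mathfrak g^N(V))$. A $V$-valued weak geometric Hölder $p$-rough path on $[0,T]$ is a path $\mathbf X:[0,T]\to\mathcal G^N(V)$ such that, with $\mathbf X_{ts}=\mathbf X_s^{-1}\mathbf X_t$, $$|\!|\!|\mathbf X|\!|\!|:=\max_{1\le i\le N}\ \sup_{0\le s<t\le T}\frac{\|\pi_i\mathbf X_{ts}\|}{|t-s|^{i/p}}<\infty ;$$ the distance of two rough paths is $d(\mathbf X,\mathbf Y)=\max_{1\le i\le N}\sup_{0\le s<t\le T}\|\pi_i\mathbf X_{ts}-\pi_i\mathbf Y_{ts}\|\,|t-s|^{-i/p}$. **Vector fields.** For an integer $m\ge 0$ let $\mathcal C^{m+1}(U,U)$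 be the space of $(m+1)$-Lipschitz maps in the sense of Stein: $C^m$ maps that are bounded together with their derivatives up to order $m$, and whose $m$-th derivative is Lipschitz, with the natural norm. Let $\mathrm F:V\to\mathcal C^{N+1}(U,U)$ be linear and continuous. Let $\mathrm F(v)$ act on functions by $\mathrm F(v)g=(Dg)(\mathrm F(v))$, and set $\mathrm F^\otimes(1)=\mathrm{Id}$ and $\mathrm F^\otimes(v_1\otimes\cdots\otimes v_k)=\mathrm F(v_1)\cdots\mathrm F(v_k)$ for $1\le k\le N$, extended linearly to algebraic tensors. Assume that $\mathrm F^\otimes$ extends continuously to completed tensors, in the sense that, for $1\le k\le N$, $e\mapsto\mathrm F^\otimes(e)\mathrm{Id}$ is continuous from $V^{\otimes_a k}$, with the chosen norm, to $\mathcal C^{N+2-k}(U,U)$ (this is automatic if the norm is equivalent to the projective norm on each $V^{\otimes_a k}$). Let $\mathrm F^\otimes(e)\mathrm{Id}$, $e\in T^N(V)$, also denote the continuous extension. **Flows.** A flow is a family $(\varphi_{ts})_{0\le s\le t\le T}$ of maps from $U$ to $U$ with $\varphi_{ss}=\mathrm{Id}$ and $\varphi_{tu}\circ\varphi_{us}=\varphi_{ts}$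 for $s\le u\le t$. For $0\le s\le t\le T$ let $\mu_{ts}=\mu_{ts}^{\mathbf X}$ be the time-one map of the equation $\dot y_u=\big(\mathrm F^\otimes(\log\mathbf X_{ts})\mathrm{Id}\big)(y_u)$, $0\le u\le 1$. A flow $\varphi$ solves $d\varphi=\mathrm F\,\mathbf X(dt)$ with exponent $a>1$ if there are $\delta,c>0$, possibly depending on $\mathbf X$, with $\|\varphi_{ts}-\mu_{ts}\|_\infty\le c|t-s|^a$ whenever $0\le s\le t\le T$ and $t-s\le\delta$. **Theorem.** The ordinary differential equations above have, for every initial point, a unique solution on $[0,1]$. For every $\mathbf X$, the equation $d\varphi=\mathrm F\,\mathbf X(dt)$ has a solution flow $\varphi=\varphi^{\mathbf X}$, with the exponent $a=\frac{[p]+1}{p}>1$, which is independent of $\mathbf X$; it is the only solution flow, whatever the exponent larger than $1$. The map $((s,t),\mathbf X)\mapsto\varphi^{\mathbf X}_{ts}$ is jointly continuous, for the distance $d$ on rough paths and for uniform convergence of maps from $U$ to itself. Moreover, for every $R$ there are constants $c,\delta>0$ such that, for every $\mathbf X$ with $|\!|\!|\mathbf X|\!|\!|\le R$, every $0\le s\le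 t\le T$ and every partition $\pi_{ts}=\{s=s_0<\cdots<s_m=t\}$ of mesh $|\pi_{ts}|\le\delta$, the composition $\mu_{\pi_{ts}}=\mu_{s_ms_{m-1}}\circ\cdots\circ\mu_{s_1s_0}$ satisfies $$\|\varphi^{\mathbf X}_{ts}-\mu_{\pi_{ts}}\|_\infty\le c\,\big(1+|\!|\!|\mathbf X|\!|\!|^{[p]}\big)^2\,T\,|\pi_{ts}|^{\frac{[p]+1}{p}-1}.$$ -/

import Mathlib

open UniformSpace

noncomputable section

namespace RoughFlow

/-! ### Truncated tensor algebra and its completion -/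

section Tensor

variable {V : Type*} [NormedAddCommGroup V] [NormedSpace ℝ V]

/-- The projection of the algebraic tensor algebra `⨁ k, V^{⊗ k}` onto `V^{⊗ k}`. -/
def algProj (k : ℕ) (a : TensorAlgebra ℝ V) : TensorAlgebra ℝ V :=
  GradedRing.proj
    ((LinearMap.range (TensorAlgebra.ι ℝ : V →ₗ[ℝ] TensorAlgebra ℝ V) ^ ·) :
      ℕ → Submodule ℝ (TensorAlgebra ℝ V)) k a

/-- A submultiplicative norm on the algebraic tensor algebra over `V` truncated at degree `n`,
which extends the norm of `V` and for which the projections onto the homogeneous components are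
continuous.  It is represented by its pullback to the whole tensor algebra, i.e. by a seminorm
that vanishes exactly on the elements having no component of degree at most `n`. -/
structure TensorNorm (n : ℕ) (V : Type*) [NormedAddCommGroup V] [NormedSpace ℝ V] extends
    Seminorm ℝ (TensorAlgebra ℝ V) where
  mul_le' : ∀ a b, toFun (a * b) ≤ toFun a * toFun b
  ι_eq' : ∀ v : V, toFun (TensorAlgebra.ι ℝ v) = ‖v‖
  eq_zero_iff' : ∀ a, toFun a = 0 ↔ ∀ k ≤ n, algProj k a = 0
  proj_bounded' : ∀ k, ∃ C : ℝ, ∀ a, toFun (algProj k a) ≤ C * toFun a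

variable {n : ℕ}

/-- The algebraic tensor algebra, as a seminormed algebra for `ν`. -/
def AlgTensor (_ν : TensorNorm n V) : Type _ := TensorAlgebra ℝ V

instance (ν : TensorNorm n V) : Ring (AlgTensor ν) :=
  inferInstanceAs (Ring (TensorAlgebra ℝ V))

instance (ν : TensorNorm n V) : Algebra ℝ (AlgTensor ν) :=
  inferInstanceAs (Algebra ℝ (TensorAlgebra ℝ V))

instance (ν : TensorNorm n V) : SeminormedRing (AlgTensor ν) where
  __ := (inferInstance : Ring (AlgTensor ν))
  __ := AddGroupSeminorm.toSeminormedAddCommGroup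
    (E := TensorAlgebra ℝ V) ν.toSeminorm.toAddGroupSeminorm
  norm_mul_le := ν.mul_le'

instance (ν : TensorNorm n V) : NormedSpace ℝ (AlgTensor ν) where
  __ := (inferInstance : Module ℝ (AlgTensor ν))
  norm_smul_le c a := (ν.smul' c a).le

/-- The space `T^n(V)`: the (Hausdorff) completion of the truncated tensor algebra.  Elements of
degree larger than `n` have seminorm zero, hence vanish here. -/
abbrev TruncTensor (ν : TensorNorm n V) : Type _ := Completion (AlgTensor ν)

/-- The canonical map from the algebraic tensor algebra to `T^n(V)`. -/
def toTrunc (ν : TensorNorm n V) (a : TensorAlgebra ℝ V) : TruncTensor ν :=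
  ((show AlgTensor ν from a : AlgTensor ν) : Completion (AlgTensor ν))

/-- The projection `π_k` of `T^n(V)` onto `V^{⊗ k}`: the continuous extension of `algProj k`. -/
def proj (ν : TensorNorm n V) (k : ℕ) : TruncTensor ν → TruncTensor ν :=
  Completion.map (fun a : AlgTensor ν => (show AlgTensor ν from algProj k a))

/-- The exponential of `T^n(V)` (a polynomial map, on elements without scalar component). -/
def texp (ν : TensorNorm n V) (a : TruncTensor ν) : TruncTensor ν :=
  ∑ k ∈ Finset.range (n + 1), ((k.factorial : ℝ)⁻¹) • a ^ k

/-- The logarithm of `T^n(V)` (a polynomial map, on elements with scalar component `1`). -/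
def tlog (ν : TensorNorm n V) (a : TruncTensor ν) : TruncTensor ν :=
  ∑ k ∈ Finset.Icc 1 n, ((-1 : ℝ) ^ (k + 1) / (k : ℝ)) • (a - 1) ^ k

/-- The closed Lie subalgebra of `T^n(V)` generated by `V`, for the commutator bracket. -/
def lieElements (ν : TensorNorm n V) : Set (TruncTensor ν) :=
  letI : LieRing (TruncTensor ν) := LieRing.ofAssociativeRing
  closure (LieSubalgebra.lieSpan ℝ (TruncTensor ν)
    (Set.range fun v : V => toTrunc ν (TensorAlgebra.ι ℝ v)) : Set (TruncTensor ν))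

/-- The group `G^n(V) = exp (g^n(V))`. -/
def groupElements (ν : TensorNorm n V) : Set (TruncTensor ν) := texp ν '' lieElements ν

end Tensor

/-! ### Weak geometric Hölder rough paths -/

section RoughPaths

variable {V : Type*} [NormedAddCommGroup V] [NormedSpace ℝ V]

/-- The increment `X_s⁻¹ X_t`. -/
def incr {n : ℕ} {ν : TensorNorm n V} (X : ℝ → TruncTensor ν) (t s : ℝ) : TruncTensor ν :=
  Ring.inverse (X s) * X t

/-- A `V`-valued weak geometric Hölder `p`-rough path on `[0, T]`; only the values on `[0, T]`
matter. -/
structure RoughPath (p T : ℝ) (ν : TensorNorm ⌊p⌋₊ V) where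
  path : ℝ → TruncTensor ν
  mem_group : ∀ t ∈ Set.Icc 0 T, path t ∈ groupElements ν
  holder : ∃ C : ℝ, ∀ i ∈ Finset.Icc 1 ⌊p⌋₊, ∀ s t, 0 ≤ s → s < t → t ≤ T →
    ‖proj ν i (incr path t s)‖ / (t - s) ^ ((i : ℝ) / p) ≤ C

variable {p T : ℝ} {ν : TensorNorm ⌊p⌋₊ V}

/-- The norm of a rough path:
`max_{1 ≤ i ≤ [p]} sup_{0 ≤ s < t ≤ T} ‖π_i X_ts‖ / |t - s| ^ (i / p)`. -/
def RoughPath.size (X : RoughPath p T ν) : ℝ :=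
  sSup {r | ∃ i ∈ Finset.Icc 1 ⌊p⌋₊, ∃ s t, 0 ≤ s ∧ s < t ∧ t ≤ T ∧
    r = ‖proj ν i (incr X.path t s)‖ / (t - s) ^ ((i : ℝ) / p)}

/-- The distance of two rough paths:
`max_{1 ≤ i ≤ [p]} sup_{0 ≤ s < t ≤ T} ‖π_i X_ts - π_i Y_ts‖ / |t - s| ^ (i / p)`. -/
def RoughPath.distance (X Y : RoughPath p T ν) : ℝ :=
  sSup {r | ∃ i ∈ Finset.Icc 1 ⌊p⌋₊, ∃ s t, 0 ≤ s ∧ s < t ∧ t ≤ T ∧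
    r = ‖proj ν i (incr X.path t s) - proj ν i (incr Y.path t s)‖ / (t - s) ^ ((i : ℝ) / p)}

end RoughPaths

/-! ### Lipschitz maps in the sense of Stein and differential operators -/

section Operators

variable {U : Type*} [NormedAddCommGroup U] [NormedSpace ℝ U]
  {V : Type*} [NormedAddCommGroup V] [NormedSpace ℝ V]
  {E : Type*} [NormedAddCommGroup E] [NormedSpace ℝ E]

/-- `f` is `(m+1)`-Lipschitz on `U` in the sense of Stein, with norm at most `M`: it is `m` times
continuously differentiable, `f` and its derivatives up to order `m` are bounded by `M`, and the
derivative of order `m` is `M`-Lipschitz. -/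
def SteinLip (m : ℕ) (M : ℝ) (f : U → E) : Prop :=
  ContDiff ℝ m f ∧ (∀ j ≤ m, ∀ x, ‖iteratedFDeriv ℝ j f x‖ ≤ M) ∧
    ∀ x y, ‖iteratedFDeriv ℝ m f x - iteratedFDeriv ℝ m f y‖ ≤ M * ‖x - y‖

/-- Continuous linear maps from `V` to the space of `(N+1)`-Lipschitz maps from `U` to itself. -/
structure FieldMap (N : ℕ) (V U : Type*) [NormedAddCommGroup V] [NormedSpace ℝ V]
    [NormedAddCommGroup U] [NormedSpace ℝ U] extends V →ₗ[ℝ] (U → U) where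
  bounded' : ∃ C : ℝ, ∀ v, SteinLip N (C * ‖v‖) (toFun v)

theorem FieldMap.contDiff {N : ℕ} (F : FieldMap N V U) (v : V) :
    ContDiff ℝ N (F.toLinearMap v) := by
  obtain ⟨C, hC⟩ := F.bounded'
  exact (hC v).1

/-- Sequences `(g_0, g_1, …)` of functions, with `g_k` of class `C^k` for `k ≤ N`. -/
def regular (N : ℕ) (U E : Type*) [NormedAddCommGroup U] [NormedSpace ℝ U]
    [NormedAddCommGroup E] [NormedSpace ℝ E] : Submodule ℝ (ℕ → U → E) where
  carrier := {g | ∀ k ≤ N, ContDiff ℝ k (g k)}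
  zero_mem' _ _ := contDiff_const
  add_mem' hf hg k hk := (hf k hk).add (hg k hk)
  smul_mem' c _ hg k hk := (hg k hk).const_smul c

/-- The first order differential operator `F(v) g = (D g)(F(v))`, which lowers the regularity by
one, acting on sequences: it sends `(g_0, …, g_N)` to `(F(v) g_1, …, F(v) g_N, 0)`. -/
def fieldOp {N : ℕ} (F : FieldMap N V U) (E : Type*) [NormedAddCommGroup E] [NormedSpace ℝ E] :
    V →ₗ[ℝ] Module.End ℝ (regular N U E) where
  toFun v :=
    { toFun := fun g => ⟨fun k x =>
        if k < N then fderiv ℝ (g.1 (k + 1)) x (F.toLinearMap v x) else 0, by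
          intro k hk
          by_cases h : k < N
          · simp only [h, if_true]
            exact ((g.2 (k + 1) h).fderiv_right (m := k) (by norm_cast)).clm_apply
              ((F.contDiff v).of_le (by exact_mod_cast hk))
          · simp only [h, if_false]
            exact contDiff_const⟩
      map_add' := fun f g => by
        ext k x
        by_cases h : k < N
        · have hf : DifferentiableAt ℝ (f.1 (k + 1)) x :=
            (f.2 (k + 1) h).differentiable (by simp) x
          have hg : DifferentiableAt ℝ (g.1 (k + 1)) x :=
            (g.2 (k + 1) h).differentiable (by simp) x
          have := fderiv_add hf hg
          simp [h, this]
        · simp [h]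
      map_smul' := fun c f => by
        ext k x
        by_cases h : k < N
        · have hf : DifferentiableAt ℝ (f.1 (k + 1)) x :=
            (f.2 (k + 1) h).differentiable (by simp) x
          have := fderiv_const_smul hf c
          simp [h, this]
        · simp [h] }
  map_add' v w := by
    ext g k x
    by_cases h : k < N <;> simp [h]
  map_smul' c v := by
    ext g k x
    by_cases h : k < N <;> simp [h]

/-- The differential operator `F^⊗(a)` applied to a function `g` of class `C^N`.  It is linear in
`a`, with `F^⊗(1) g = g` and `F^⊗(v_1 ⊗ ⋯ ⊗ v_k) g = F(v_1) ⋯ F(v_k) g` for `1 ≤ k ≤ N`; tensors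
of degree larger than `N` act as zero. -/
def tensorOp {N : ℕ} (F : FieldMap N V U) (a : TensorAlgebra ℝ V) (g : U → E)
    (hg : ContDiff ℝ N g) : U → E :=
  (TensorAlgebra.lift ℝ (fieldOp F E) a
    ⟨fun _ => g, fun k hk => hg.of_le (by exact_mod_cast hk)⟩).1 0

/-- The map `F^⊗(a) Id` from `U` to itself, for `a` in the algebraic tensor algebra. -/
def algField {N : ℕ} (F : FieldMap N V U) (a : TensorAlgebra ℝ V) : U → U :=
  tensorOp F a id contDiff_id

/-- `F^⊗` extends continuously to the completed tensor products: for `1 ≤ k ≤ N`, the map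
`a ↦ F^⊗(a) Id` is continuous on the `k`-fold algebraic tensor product of `V`, with values in the
space of `(N + 2 - k)`-Lipschitz maps from `U` to itself. -/
def ExtendsContinuously {N : ℕ} (ν : TensorNorm N V) (F : FieldMap N V U) : Prop :=
  ∀ k ∈ Finset.Icc 1 N, ∃ C : ℝ, ∀ a ∈
    LinearMap.range (TensorAlgebra.ι ℝ : V →ₗ[ℝ] TensorAlgebra ℝ V) ^ k,
      SteinLip (N + 1 - k) (C * ν.toSeminorm a) (algField F a)

/-- The map `F^⊗(e) Id` from `U` to itself, for `e` in `T^N(V)`, by continuous extension. -/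
def vectorField {N : ℕ} (ν : TensorNorm N V) (F : FieldMap N V U) [CompleteSpace U]
    (e : TruncTensor ν) (x : U) : U :=
  Completion.extension (fun a : AlgTensor ν => algField F a x) e

end Operators

/-! ### Flows -/

section Flows

variable {U : Type*} [NormedAddCommGroup U] [NormedSpace ℝ U]

/-- `y` solves `dy/du = W(y)` on `[0, 1]` with `y(0) = x`. -/
def SolvesODE (W : U → U) (x : U) (y : ℝ → U) : Prop :=
  y 0 = x ∧ ∀ u ∈ Set.Icc (0 : ℝ) 1, HasDerivWithinAt y (W (y u)) (Set.Icc 0 1) u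

open Classical in
/-- The time one map of the vector field `W` (the identity at points where there is no
solution). -/
def timeOne (W : U → U) (x : U) : U :=
  if h : ∃ y, SolvesODE W x y then h.choose 1 else x

/-- `(φ_ts)_{0 ≤ s ≤ t ≤ T}` is a flow; here `φ_ts` is `φ t s`. -/
def IsFlow (T : ℝ) (φ : ℝ → ℝ → U → U) : Prop :=
  (∀ s, 0 ≤ s → s ≤ T → φ s s = id) ∧
    ∀ s u t, 0 ≤ s → s ≤ u → u ≤ t → t ≤ T → φ t u ∘ φ u s = φ t s

/-- A partition `s = s_0 < s_1 < ⋯ < s_m = t`. -/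
structure Partition (s t : ℝ) where
  m : ℕ
  pt : ℕ → ℝ
  pt_zero : pt 0 = s
  pt_last : pt m = t
  pt_lt : ∀ i < m, pt i < pt (i + 1)

/-- The mesh of a partition (it is `0` for the trivial partition of `[s, s]`). -/
def Partition.mesh {s t : ℝ} (P : Partition s t) : ℝ :=
  ⨆ i : Fin P.m, (P.pt (i + 1) - P.pt i)

/-- The composition `μ_{s_j s_{j-1}} ∘ ⋯ ∘ μ_{s_1 s_0}`. -/
def compUpTo (μ : ℝ → ℝ → U → U) (pt : ℕ → ℝ) : ℕ → U → U
  | 0 => id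
  | j + 1 => μ (pt (j + 1)) (pt j) ∘ compUpTo μ pt j

/-- The composition `μ_π = μ_{s_m s_{m-1}} ∘ ⋯ ∘ μ_{s_1 s_0}` along a partition. -/
def Partition.comp {s t : ℝ} (P : Partition s t) (μ : ℝ → ℝ → U → U) : U → U :=
  compUpTo μ P.pt P.m

variable {V : Type*} [NormedAddCommGroup V] [NormedSpace ℝ V] [CompleteSpace U]
  {p T : ℝ} {ν : TensorNorm ⌊p⌋₊ V}

/-- The vector field `F^⊗(Λ_ts)`, with `Λ_ts = log X_ts`. -/
def logField (F : FieldMap ⌊p⌋₊ V U) (X : RoughPath p T ν) (t s : ℝ) : U → U :=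
  vectorField ν F (tlog ν (incr X.path t s))

/-- The time one map `μ_ts` of the equation `dy/du = F^⊗(Λ_ts)(y)`. -/
def mu (F : FieldMap ⌊p⌋₊ V U) (X : RoughPath p T ν) (t s : ℝ) : U → U :=
  timeOne (logField F X t s)

/-- The flow `φ` solves the rough differential equation `dφ = F X(dt)`, with exponent `a`:
`‖φ_ts - μ_ts‖_∞ ≤ c |t - s|^a` whenever `t - s ≤ δ`, for some positive `δ` and `c`. -/
def SolvesRDE (F : FieldMap ⌊p⌋₊ V U) (X : RoughPath p T ν) (a : ℝ) (φ : ℝ → ℝ → U → U) : Prop :=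
  IsFlow T φ ∧ ∃ δ > 0, ∃ c > 0, ∀ s t, 0 ≤ s → s ≤ t → t ≤ T → t - s ≤ δ →
    ∀ x, ‖φ t s x - mu F X t s x‖ ≤ c * (t - s) ^ a

end Flows

end RoughFlow

end

/-! The proof has an analytic half, valid for any approximate flow, and an algebraic half, which
shows that the time-one maps `μ_ts` are one.

Sewing. Let `μ_ts` be maps close to the identity such that `μ_tu ∘ μ_us` differs from `μ_ts` by
`O(|t-s|^a)` with `a > 1`, both in sup norm and in Lipschitz seminorm (`AlmostFlow`). Then the
composition of the `μ`'s along any finite set of times stays within `O(|t-s|^a)` of `μ_ts` on short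
intervals, with constants independent of the set (`exists_scale`). Cutting an interval near its
midpoint multiplies the accumulated error by about `2 · 2^(-a) < 1`, so a recursion of the form `A ↦
rA + const` closes. Composing on the left preserves Lipschitz closeness only if the outer map has a
Lipschitz derivative; `FourPoint` is the derivative-free form of this and is also stable under
solving an ODE. A telescoping comparison (`norm_sub_along_le`) between a family with the flow
property and such compositions then gives convergence, the flow property, uniqueness and the rate
(`exists_isSewing`, `IsSewing.unique`).

Euler estimate. Write `N = [p]`, `Λ = log X_ts`, and `F(e)` for `F^⊗(e) Id`. If `y` solves the ODE
driven by `F(Λ)`, the function `u ↦ F(exp((1-u)Λ) e)(y_u)` goes from `F(exp(Λ) e)(x)` to `F(e)(μ_ts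
x)`, and its derivative is the defect of the relation `F(Λ)F(e) Id = F(Λe) Id`. That relation is
exact in total degree at most `N`, so the defect has order `|t-s|^((N+1)/p)`. Taking `e = 1` for
each of the maps, and `e = X_tu` along `μ_us`, Chen's relation `X_us X_tu = X_ts` yields the almost
flow property with `a = (N+1)/p` (`exists_almostFlow_mu`).

Where the Lie structure enters. The relation above needs `Λ` to act as a first order operator.
Brackets of vector fields do so by symmetry of second derivatives (`bracket_mem_firstOrder`), and
this passes to the closed Lie algebra by continuity. That the logarithm of an increment is a Lie
element is a Baker–Campbell–Hausdorff statement (`IsLie.mem_of_nexp_eq`). It is proved with the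
derivation `D` multiplying degree `k` by `k`: an element `z` of positive degree is Lie as soon as
`exp(-z) D exp(z)` is, and logarithmic derivatives of products are explicit.

Continuity in `X` holds because all constants are uniform on bounded sets of rough paths: up to a
uniformly small error the flow is a composition of finitely many `μ`'s, and each of these is
continuous in `X`. -/

noncomputable section

namespace RoughFlow

/-! ### Sewing of almost flows -/

section Sewing

open Filter Topology

variable {M : Type*}

/-- The points of `S` in the open interval `(s, t)`. -/
def inner (S : Finset ℝ) (s t : ℝ) : Finset ℝ := S.filter fun x => s < x ∧ x < t

theorem mem_inner {S : Finset ℝ} {s t x : ℝ} : x ∈ inner S s t ↔ x ∈ S ∧ s < x ∧ x < t := by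
  simp [inner]

theorem inner_card_lt {S : Finset ℝ} {s t s' t' u : ℝ} (hs : s ≤ s') (ht : t' ≤ t)
    (hu : u ∈ inner S s t) (hu' : u ∉ inner S s' t') :
    (inner S s' t').card < (inner S s t).card := by
  apply Finset.card_lt_card
  refine ⟨fun x hx => ?_, fun h => hu' (h hu)⟩
  rw [mem_inner] at hx ⊢
  exact ⟨hx.1, hs.trans_lt hx.2.1, hx.2.2.trans_le ht⟩

/-- The composition of the maps `μ` along the points of `S` in `(s, t)`. -/
def along (μ : ℝ → ℝ → M → M) (S : Finset ℝ) (s t : ℝ) : M → M :=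
  if h : (inner S s t).Nonempty then
    μ t ((inner S s t).max' h) ∘ along μ S s ((inner S s t).max' h)
  else μ t s
termination_by (inner S s t).card
decreasing_by
  have h1 := Finset.max'_mem _ h
  exact inner_card_lt le_rfl (mem_inner.1 h1).2.2.le h1 (by simp [mem_inner])

theorem along_of_inner_eq_empty (μ : ℝ → ℝ → M → M) {S : Finset ℝ} {s t : ℝ}
    (h : inner S s t = ∅) : along μ S s t = μ t s := by
  rw [along]; simp [h]

theorem inner_self (S : Finset ℝ) (s : ℝ) : inner S s s = ∅ := by
  ext x; simp only [mem_inner, Finset.notMem_empty, iff_false]; rintro ⟨_, h1, h2⟩; linarith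

/-- The recursion peels off the last point of `S` before `t`. That point is either `u` itself, or
also the last point of `S` in `(u, t)`, so both sides peel off the same map. -/
theorem along_comp_along_of_lt (μ : ℝ → ℝ → M → M) {S : Finset ℝ} {u : ℝ} (hu : u ∈ S) :
    ∀ {s t : ℝ}, s < u → u < t → along μ S u t ∘ along μ S s u = along μ S s t := by
  intro s t
  induction hn : (inner S s t).card using Nat.strong_induction_on generalizing t with
  | _ n ih =>
  intro hsu hut
  have hus : u ∈ inner S s t := mem_inner.2 ⟨hu, hsu, hut⟩
  have hne : (inner S s t).Nonempty := ⟨u, hus⟩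
  obtain ⟨hvS, hsv, hvt⟩ := mem_inner.1 (Finset.max'_mem _ hne)
  have huv := Finset.le_max' _ _ hus
  have hmax : ∀ x ∈ inner S s t, x ≤ (inner S s t).max' hne := fun x hx => Finset.le_max' _ _ hx
  rw [along.eq_1 μ S s t, dif_pos hne]
  generalize hv : (inner S s t).max' hne = v at *
  rcases huv.eq_or_lt with rfl | huv
  · rw [along_of_inner_eq_empty μ (s := u) (t := t)]
    ext x
    simp only [mem_inner, Finset.notMem_empty, iff_false]
    rintro ⟨h1, h2, h3⟩
    exact absurd (hmax x (mem_inner.2 ⟨h1, hsu.trans h2, h3⟩)) (not_le.2 h2)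
  · have hvm : v ∈ inner S u t := mem_inner.2 ⟨hvS, huv, hvt⟩
    have hne' : (inner S u t).Nonempty := ⟨v, hvm⟩
    have hv' : (inner S u t).max' hne' = v := by
      apply le_antisymm
      · apply Finset.max'_le
        intro x hx
        rw [mem_inner] at hx
        exact hmax x (mem_inner.2 ⟨hx.1, hsu.trans hx.2.1, hx.2.2⟩)
      · exact Finset.le_max' _ _ hvm
    rw [along.eq_1 μ S u t, dif_pos hne', hv', Function.comp_assoc, ih _ _ rfl hsu huv]
    rw [← hn]
    exact inner_card_lt le_rfl hvt.le (mem_inner.2 ⟨hvS, hsv, hvt⟩) (by simp [mem_inner])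

/-! ### Calculus of Lipschitz, second order and closeness estimates -/

variable {U : Type*} [NormedAddCommGroup U]

/-- `f` is Lipschitz with constant `K`. -/
def LipBound (K : ℝ) (f : U → U) : Prop := ∀ x y, ‖f x - f y‖ ≤ K * ‖x - y‖

/-- A second order difference estimate, satisfied by maps with a Lipschitz derivative. -/
def FourPoint (K K' : ℝ) (f : U → U) : Prop :=
  ∀ a b c d, ‖f a - f b - f c + f d‖ ≤
    K * ‖a - b - c + d‖ + K' * ‖c - d‖ * (‖a - c‖ + ‖b - d‖)

/-- `f - g` is bounded by `α` and Lipschitz with constant `β`. -/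
def Near (α β : ℝ) (f g : U → U) : Prop :=
  (∀ x, ‖f x - g x‖ ≤ α) ∧ ∀ x y, ‖(f x - g x) - (f y - g y)‖ ≤ β * ‖x - y‖

theorem LipBound.mono {K L : ℝ} {f : U → U} (hf : LipBound K f) (h : K ≤ L) : LipBound L f :=
  fun x y => (hf x y).trans (by gcongr)

theorem LipBound.comp {K L : ℝ} {f g : U → U} (hf : LipBound K f) (hg : LipBound L g)
    (hK : 0 ≤ K) : LipBound (K * L) (f ∘ g) := fun x y =>
  (hf _ _).trans (by rw [mul_assoc]; exact mul_le_mul_of_nonneg_left (hg x y) hK)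

theorem FourPoint.lipBound {K K' : ℝ} {f : U → U} (hf : FourPoint K K' f) : LipBound K f := by
  intro x y
  simpa using hf x y y y

theorem Near.mono {α β α' β' : ℝ} {f g : U → U} (h : Near α β f g) (hα : α ≤ α') (hβ : β ≤ β') :
    Near α' β' f g :=
  ⟨fun x => (h.1 x).trans hα, fun x y => (h.2 x y).trans (by gcongr)⟩

theorem Near.refl {α β : ℝ} (hα : 0 ≤ α) (hβ : 0 ≤ β) (f : U → U) : Near α β f f :=
  ⟨fun x => by simpa using hα, fun x y => by simpa using by positivity⟩

theorem Near.trans {α β α' β' : ℝ} {f g h : U → U} (h₁ : Near α β f g) (h₂ : Near α' β' g h) :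
    Near (α + α') (β + β') f h := by
  refine ⟨fun x => ?_, fun x y => ?_⟩
  · calc ‖f x - h x‖ = ‖(f x - g x) + (g x - h x)‖ := by congr 1; abel
      _ ≤ _ := (norm_add_le _ _).trans (add_le_add (h₁.1 x) (h₂.1 x))
  · calc ‖(f x - h x) - (f y - h y)‖
        = ‖((f x - g x) - (f y - g y)) + ((g x - h x) - (g y - h y))‖ := by congr 1; abel
      _ ≤ _ := (norm_add_le _ _).trans (by rw [add_mul]; exact add_le_add (h₁.2 x y) (h₂.2 x y))

theorem Near.comp_right {α β L : ℝ} {f g h : U → U} (hfg : Near α β f g) (hh : LipBound L h)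
    (hβ : 0 ≤ β) : Near α (β * L) (f ∘ h) (g ∘ h) :=
  ⟨fun x => hfg.1 _, fun x y => (hfg.2 _ _).trans (by
    rw [mul_assoc]; exact mul_le_mul_of_nonneg_left (hh x y) hβ)⟩

/-- Left composition is where a mere Lipschitz bound on `f` would fail: the Lipschitz seminorm of `f
∘ h₁ - f ∘ h₂` is a second order difference of `f`, taken at the values of `h₁`, `h₂` at two points.
-/
theorem FourPoint.comp_left {K K' α β L₁ L₂ : ℝ} {f h₁ h₂ : U → U} (hf : FourPoint K K' f)
    (h : Near α β h₁ h₂) (hL₁ : LipBound L₁ h₁) (hL₂ : LipBound L₂ h₂) (hK : 0 ≤ K)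
    (hK' : 0 ≤ K') : Near (K * α) (K * β + K' * α * (L₁ + L₂)) (f ∘ h₁) (f ∘ h₂) := by
  refine ⟨fun x => (hf.lipBound _ _).trans (mul_le_mul_of_nonneg_left (h.1 x) hK), fun x y => ?_⟩
  have h1 := hf (h₁ x) (h₂ x) (h₁ y) (h₂ y)
  have h2 : ‖h₁ x - h₂ x - h₁ y + h₂ y‖ ≤ β * ‖x - y‖ := by
    rw [sub_add]; exact h.2 x y
  calc ‖(f (h₁ x) - f (h₂ x)) - (f (h₁ y) - f (h₂ y))‖
      = ‖f (h₁ x) - f (h₂ x) - f (h₁ y) + f (h₂ y)‖ := by rw [sub_add]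
    _ ≤ _ := h1
    _ ≤ K * (β * ‖x - y‖) + K' * α * (L₁ * ‖x - y‖ + L₂ * ‖x - y‖) := by
        have := h.1 y
        have := hL₁ x y
        have := hL₂ x y
        have : 0 ≤ α := (norm_nonneg _).trans (h.1 y)
        gcongr
    _ = _ := by ring

theorem Near.lipBound {α β L : ℝ} {f g : U → U} (h : Near α β f g) (hg : LipBound L g) :
    LipBound (L + β) f := fun x y => by
  calc ‖f x - f y‖ = ‖(g x - g y) + ((f x - g x) - (f y - g y))‖ := by congr 1; abel
    _ ≤ _ := (norm_add_le _ _).trans (by rw [add_mul]; exact add_le_add (hg x y) (h.2 x y))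

/-- A family of maps which is a flow up to a small error, with uniform constants. -/
structure AlmostFlow (T C θ a : ℝ) (μ : ℝ → ℝ → U → U) : Prop where
  refl : ∀ s, 0 ≤ s → s ≤ T → μ s s = id
  fourPoint : ∀ s t, 0 ≤ s → s ≤ t → t ≤ T → FourPoint (1 + C * (t - s) ^ θ) C (μ t s)
  near_id : ∀ s t, 0 ≤ s → s ≤ t → t ≤ T → ∀ x, ‖μ t s x - x‖ ≤ C * (t - s) ^ θ
  near : ∀ s u t, 0 ≤ s → s ≤ u → u ≤ t → t ≤ T →
    Near (C * (t - s) ^ a) (C * (t - s) ^ a) (μ t u ∘ μ u s) (μ t s)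

variable {T C θ a : ℝ} {μ : ℝ → ℝ → U → U}

theorem along_self {μ : ℝ → ℝ → M → M} (hμ : ∀ s, 0 ≤ s → s ≤ T → μ s s = id)
    (S : Finset ℝ) {s : ℝ} (hs : 0 ≤ s) (hsT : s ≤ T) : along μ S s s = id := by
  rw [along_of_inner_eq_empty μ (inner_self S s), hμ s hs hsT]

theorem along_comp_along {μ : ℝ → ℝ → M → M} (hμ : ∀ s, 0 ≤ s → s ≤ T → μ s s = id)
    {S : Finset ℝ} {s u t : ℝ} (hu : u ∈ S) (hs : 0 ≤ s) (hsu : s ≤ u) (hut : u ≤ t) (htT : t ≤ T) :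
    along μ S u t ∘ along μ S s u = along μ S s t := by
  rcases hsu.eq_or_lt with rfl | hsu
  · rw [along_self hμ S hs (hut.trans htT), Function.comp_id]
  rcases hut.eq_or_lt with rfl | hut
  · rw [along_self hμ S (hs.trans hsu.le) htT, Function.id_comp]
  exact along_comp_along_of_lt μ hu hsu hut

/-- Splitting an interval at the points of `S` around its midpoint. -/
theorem exists_middle (S : Finset ℝ) {s t : ℝ} (hst : s ≤ t) :
    ∃ u v, s ≤ u ∧ u ≤ v ∧ v ≤ t ∧ u - s ≤ (t - s) / 2 ∧ t - v ≤ (t - s) / 2 ∧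
      inner S u v = ∅ ∧ (u = s ∨ u ∈ inner S s t) ∧ (v = t ∨ v ∈ inner S s t) := by
  set m := (s + t) / 2 with hm
  have h1 : ((insert s (inner S s t)).filter (· ≤ m)).Nonempty :=
    ⟨s, Finset.mem_filter.2 ⟨Finset.mem_insert_self _ _, by linarith⟩⟩
  have hu := Finset.max'_mem _ h1
  have humax : ∀ x ∈ (insert s (inner S s t)).filter (· ≤ m), x ≤ Finset.max' _ h1 :=
    fun x hx => Finset.le_max' _ x hx
  generalize hu' : Finset.max' _ h1 = u at hu humax
  have h2 : ((insert t (inner S s t)).filter (fun x => m ≤ x ∧ u ≤ x)).Nonempty :=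
    ⟨t, Finset.mem_filter.2 ⟨Finset.mem_insert_self _ _, by linarith, by
      have := (Finset.mem_filter.1 hu).2; linarith⟩⟩
  have hv := Finset.min'_mem _ h2
  have hvmin : ∀ x ∈ (insert t (inner S s t)).filter (fun x => m ≤ x ∧ u ≤ x),
      Finset.min' _ h2 ≤ x := fun x hx => Finset.min'_le _ x hx
  generalize hv' : Finset.min' _ h2 = v at hv hvmin
  simp only [Finset.mem_filter, Finset.mem_insert] at hu hv humax hvmin
  have hsu : s ≤ u := humax s ⟨Or.inl rfl, by linarith⟩
  have hvt : v ≤ t := hvmin t ⟨Or.inl rfl, by linarith, by linarith [hu.2]⟩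
  refine ⟨u, v, hsu, hv.2.2, hvt, by linarith [hu.2], by linarith [hv.2.1], ?_, hu.1, hv.1⟩
  ext x
  simp only [mem_inner, Finset.notMem_empty, iff_false]
  rintro ⟨hx, hux, hxv⟩
  have hxi : x ∈ inner S s t := mem_inner.2 ⟨hx, by linarith, by linarith⟩
  rcases le_total x m with hxm | hxm
  · exact absurd (humax x ⟨Or.inr hxi, hxm⟩) (not_le.2 hux)
  · exact absurd (hvmin x ⟨Or.inr hxi, hxm, hux.le⟩) (not_le.2 hxv)

/-- Two halves of an interval contribute `2 (1/2)^a < 1`. The slack leaves room for a Lipschitz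
factor `1 + ε` from each of two maps. -/
theorem exists_contraction_margin (ha : 1 < a) :
    ∃ r, r < 1 ∧ ∃ ε > 0, ε ≤ 1 ∧ 2 * (1 + ε) ^ 2 * (1 / 2 : ℝ) ^ a ≤ r := by
  have h1 : 2 * (1 / 2 : ℝ) ^ a < 1 := by
    have : (1 / 2 : ℝ) ^ a < (1 / 2 : ℝ) ^ (1 : ℝ) :=
      Real.rpow_lt_rpow_of_exponent_gt (by norm_num) (by norm_num) ha
    rw [Real.rpow_one] at this
    linarith
  obtain ⟨r, hr1, hr2⟩ := exists_between h1
  refine ⟨r, hr2, ?_⟩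
  have h2 : Tendsto (fun ε : ℝ => 2 * (1 + ε) ^ 2 * (1 / 2 : ℝ) ^ a) (𝓝[>] 0)
      (𝓝 (2 * (1 + 0) ^ 2 * (1 / 2 : ℝ) ^ a)) := by
    apply Tendsto.mono_left _ nhdsWithin_le_nhds
    apply Continuous.tendsto
    fun_prop
  have h3 : 2 * (1 + 0) ^ 2 * (1 / 2 : ℝ) ^ a < r := by simpa using hr1
  obtain ⟨ε, hε, hε1, hε0⟩ := ((h2.eventually_lt_const h3).and
    ((eventually_mem_of_tendsto_nhdsWithin (tendsto_id (x := 𝓝[>] (0:ℝ)))).and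
      (mem_nhdsWithin_of_mem_nhds (Iic_mem_nhds (zero_lt_one' ℝ))))).exists
  exact ⟨ε, hε1, hε0, hε.le⟩

/-- Induction on the number of intermediate points, carrying closeness in sup norm and in Lipschitz
seminorm together. The scale `δ` and the constants depend on `C`, `θ`, `a` only, hence are uniform
over `μ` and over the finite set. -/
theorem exists_scale (hC : 0 ≤ C) (hθ : 0 < θ) (ha : 1 < a) :
    ∃ A ≥ 0, ∃ δ > 0, ∀ (T : ℝ) (μ : ℝ → ℝ → U → U), AlmostFlow T C θ a μ →
      ∀ (S : Finset ℝ) (s t : ℝ), 0 ≤ s → s ≤ t → t ≤ T → t - s ≤ δ →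
        (∀ x, ‖along μ S s t x - μ t s x‖ ≤ A * (t - s) ^ a) ∧ LipBound 2 (along μ S s t) := by
  obtain ⟨r, hr1, ε, hε0, hε1, hrε⟩ := exists_contraction_margin ha
  set q : ℝ := (1 / 2 : ℝ) ^ a with hq
  have hq0 : 0 < q := by positivity
  have hq1 : q ≤ 1 := Real.rpow_le_one (by norm_num) (by norm_num) (by linarith)
  have hr0 : 0 < 1 - r := by linarith
  -- `A` and `B` are the fixed points of the recursions `A = rA + 3C` and `B = rB + 24AC + 3C + 6C²`
  -- that the induction step produces.
  set A : ℝ := 3 * C / (1 - r) with hA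
  have hA0 : 0 ≤ A := by positivity
  set B : ℝ := (24 * A * C + 3 * C + 6 * C ^ 2) / (1 - r) with hB
  have hB0 : 0 ≤ B := by positivity
  have hAeq : A * r + 3 * C = A := by rw [hA]; field_simp; ring
  have hBeq : B * r + (24 * A * C + 3 * C + 6 * C ^ 2) = B := by rw [hB]; field_simp; ring
  obtain ⟨δ, hδ0, hδ⟩ : ∃ δ > 0, C * δ ^ θ + B * δ ^ a ≤ ε := by
    have h2 : Tendsto (fun δ : ℝ => C * δ ^ θ + B * δ ^ a) (𝓝[>] 0)
        (𝓝 (C * 0 ^ θ + B * 0 ^ a)) := by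
      apply Tendsto.mono_left _ nhdsWithin_le_nhds
      apply Continuous.tendsto
      have := Real.continuous_rpow_const hθ.le
      have := Real.continuous_rpow_const (q := a) (by linarith)
      fun_prop
    have h3 : C * 0 ^ θ + B * (0 : ℝ) ^ a < ε := by
      rw [Real.zero_rpow hθ.ne', Real.zero_rpow (by linarith)]; simpa using hε0
    obtain ⟨δ, hδ, hδ0⟩ := ((h2.eventually_lt_const h3).and
      (eventually_mem_of_tendsto_nhdsWithin (tendsto_id (x := 𝓝[>] (0:ℝ))))).exists
    exact ⟨δ, hδ0, hδ.le⟩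
  refine ⟨A, hA0, δ, hδ0, fun T μ hμ S => ?_⟩
  have key : ∀ s t, 0 ≤ s → s ≤ t → t ≤ T → t - s ≤ δ →
      Near (A * (t - s) ^ a) (B * (t - s) ^ a) (along μ S s t) (μ t s) := by
    intro s t
    induction hn : (inner S s t).card using Nat.strong_induction_on generalizing s t with
    | _ n ih =>
    intro hs hst htT htδ
    have hh0 : 0 ≤ (t - s) ^ a := Real.rpow_nonneg (by linarith) _
    rcases Finset.eq_empty_or_nonempty (inner S s t) with hne | hne
    · rw [along_of_inner_eq_empty μ hne]
      exact Near.refl (by positivity) (by positivity) _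
    obtain ⟨u, v, hsu, huv, hvt, hus, htv, huvS, hu, hv⟩ := exists_middle S hst
    set h := (t - s) ^ a with hh
    have hhalf : ∀ l, 0 ≤ l → l ≤ (t - s) / 2 → l ^ a ≤ q * h := by
      intro l hl0 hl
      rw [hq, hh, ← Real.mul_rpow (by norm_num) (by linarith)]
      exact Real.rpow_le_rpow hl0 (by linarith) (by linarith)
    have hmono : ∀ l, 0 ≤ l → l ≤ t - s → l ^ a ≤ h := fun l hl0 hl =>
      Real.rpow_le_rpow hl0 hl (by linarith)
    have hδa : h ≤ δ ^ a := Real.rpow_le_rpow (by linarith) htδ (by linarith)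
    have hBδ : 0 ≤ B * δ ^ a := by positivity
    have hCδ : 0 ≤ C * δ ^ θ := by positivity
    have hfour : ∀ s' t', 0 ≤ s' → s' ≤ t' → t' ≤ T → t' - s' ≤ δ →
        FourPoint (1 + ε) C (μ t' s') := by
      intro s' t' h1 h2 h3 h4 x y z w
      refine (hμ.fourPoint s' t' h1 h2 h3 x y z w).trans ?_
      have : C * (t' - s') ^ θ ≤ C * δ ^ θ := by
        apply mul_le_mul_of_nonneg_left _ hC
        exact Real.rpow_le_rpow (by linarith) h4 hθ.le
      gcongr
      linarith
    -- the two outer pieces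
    have hleft : Near (A * (q * h)) (B * (q * h)) (along μ S s u) (μ u s) := by
      have : (inner S s u).card < n := by
        rcases hu with rfl | hu
        · rw [inner_self, Finset.card_empty, ← hn]; exact Finset.card_pos.2 hne
        · rw [← hn]; exact inner_card_lt le_rfl (by linarith) hu (by simp [mem_inner])
      refine (ih _ this s u rfl hs hsu (by linarith) (by linarith)).mono ?_ ?_
      · exact mul_le_mul_of_nonneg_left (hhalf _ (by linarith) hus) hA0
      · exact mul_le_mul_of_nonneg_left (hhalf _ (by linarith) hus) hB0
    have hright : Near (A * (q * h)) (B * (q * h)) (along μ S v t) (μ t v) := by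
      have : (inner S v t).card < n := by
        rcases hv with rfl | hv
        · rw [inner_self, Finset.card_empty, ← hn]; exact Finset.card_pos.2 hne
        · rw [← hn]; exact inner_card_lt (by linarith) le_rfl hv (by simp [mem_inner])
      refine (ih _ this v t rfl (by linarith) hvt htT (by linarith)).mono ?_ ?_
      · exact mul_le_mul_of_nonneg_left (hhalf _ (by linarith) htv) hA0
      · exact mul_le_mul_of_nonneg_left (hhalf _ (by linarith) htv) hB0
    have hsplit : along μ S s t = along μ S v t ∘ (μ v u ∘ along μ S s u) := by
      have e1 : along μ S v t ∘ along μ S s v = along μ S s t := by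
        rcases hv with rfl | hv
        · rw [along_self hμ.refl S (by linarith) htT, Function.id_comp]
        · exact along_comp_along hμ.refl (mem_inner.1 hv).1 hs (by linarith) hvt htT
      have e2 : along μ S u v ∘ along μ S s u = along μ S s v := by
        rcases hu with rfl | hu
        · rw [along_self hμ.refl S hs (by linarith), Function.comp_id]
        · exact along_comp_along hμ.refl (mem_inner.1 hu).1 hs hsu huv (by linarith)
      rw [← e1, ← e2, along_of_inner_eq_empty μ huvS]
    have f1 := hfour s u hs hsu (by linarith) (by linarith)
    have f2 := hfour u v (by linarith) huv (by linarith) (by linarith)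
    have f3 := hfour v t (by linarith) hvt htT (by linarith)
    have f4 := hfour s v hs (by linarith) (by linarith) (by linarith)
    have hk0 : (0 : ℝ) ≤ 1 + ε := by linarith
    have hl1 : LipBound (1 + ε) (along μ S s u) := by
      have h1 : LipBound (1 + C * δ ^ θ) (μ u s) := by
        refine (hμ.fourPoint s u hs hsu (by linarith)).lipBound.mono ?_
        gcongr
        linarith
      refine (hleft.lipBound h1).mono ?_
      have : B * (q * h) ≤ B * δ ^ a := by
        apply mul_le_mul_of_nonneg_left _ hB0
        nlinarith
      linarith
    -- One replacement at a time: the right piece by `μ t v`, the left piece by `μ u s`, then `μ v u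
    -- ∘ μ u s` by `μ v s`, then `μ t v ∘ μ v s` by `μ t s`. Only the first two use the induction
    -- hypothesis, and there the length is at most half.
    have n1 := hright.comp_right (f2.lipBound.comp hl1 hk0) (by positivity)
    have n2 := f2.comp_left hleft hl1 f1.lipBound hk0 hC
    have n3 := f3.comp_left n2 (f2.lipBound.comp hl1 hk0) (f2.lipBound.comp f1.lipBound hk0) hk0 hC
    have n4 := f3.comp_left ((hμ.near s u v hs hsu huv (by linarith)).mono
      (mul_le_mul_of_nonneg_left (hmono (v - s) (by linarith) (by linarith)) hC)
      (mul_le_mul_of_nonneg_left (hmono (v - s) (by linarith) (by linarith)) hC))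
      (f2.lipBound.comp f1.lipBound hk0) f4.lipBound hk0 hC
    have n5 := hμ.near s v t hs (by linarith) hvt htT
    rw [hsplit]
    refine (((n1.trans n3).trans n4).trans n5).mono ?_ ?_
    · have e0 : (1 + (1 + ε) ^ 2) * q ≤ (2 * (1 + ε) ^ 2) * q :=
        mul_le_mul_of_nonneg_right (by nlinarith) hq0.le
      have e1 : (1 + (1 + ε) ^ 2) * q ≤ r := e0.trans hrε
      have e2 : A * ((1 + (1 + ε) ^ 2) * q) ≤ A * r := mul_le_mul_of_nonneg_left e1 hA0
      have e3 : (1 + ε) * C + C ≤ 3 * C := by nlinarith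
      have : (A * ((1 + (1 + ε) ^ 2) * q) + ((1 + ε) * C + C)) * h ≤ A * h :=
        mul_le_mul_of_nonneg_right (by linarith) hh0
      linarith
    · have e2 : B * (2 * (1 + ε) ^ 2 * q) ≤ B * r := mul_le_mul_of_nonneg_left hrε hB0
      have hk2 : (1 + ε) ≤ 2 := by linarith
      have e4 : (1 + ε) ^ 2 ≤ 4 := by nlinarith
      have e5 : (1 + ε) ^ 3 ≤ 8 := by
        have : (1 + ε) ^ 3 ≤ 2 ^ 3 := pow_le_pow_left₀ hk0 hk2 3
        linarith
      have e6 : A * C * q * (2 * (1 + ε) ^ 2 + 2 * (1 + ε) ^ 3) ≤ A * C * 1 * (2 * 4 + 2 * 8) := by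
        gcongr
      have e7 : C * (1 + ε) + C ^ 2 * ((1 + ε) ^ 2 + (1 + ε)) + C ≤
          C * 2 + C ^ 2 * (4 + 2) + C := by
        gcongr
      have : (B * (2 * (1 + ε) ^ 2 * q) + A * C * q * (2 * (1 + ε) ^ 2 + 2 * (1 + ε) ^ 3) +
          (C * (1 + ε) + C ^ 2 * ((1 + ε) ^ 2 + (1 + ε)) + C)) * h ≤ B * h :=
        mul_le_mul_of_nonneg_right (by linarith) hh0
      linarith
  intro s t hs hst htT htδ
  have hk := key s t hs hst htT htδ
  refine ⟨hk.1, ?_⟩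
  refine (hk.lipBound (hμ.fourPoint s t hs hst htT).lipBound).mono ?_
  have h1 : C * (t - s) ^ θ ≤ C * δ ^ θ :=
    mul_le_mul_of_nonneg_left (Real.rpow_le_rpow (by linarith) htδ hθ.le) hC
  have h2 : B * (t - s) ^ a ≤ B * δ ^ a :=
    mul_le_mul_of_nonneg_left (Real.rpow_le_rpow (by linarith) htδ (by linarith)) hB0
  linarith

end Sewing
end RoughFlow

namespace RoughFlow

/-! ### Passage to the limit along finite sets of times -/

section SewingLimit

open Filter Topology

/-- Subintervals of `[s, t]` whose interior misses `S` have length at most `d`. -/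
def MeshLE (S : Finset ℝ) (d s t : ℝ) : Prop :=
  ∀ u v, s ≤ u → u < v → v ≤ t → inner S u v = ∅ → v - u ≤ d

theorem MeshLE.mono {S : Finset ℝ} {d s t s' t' : ℝ} (h : MeshLE S d s t) (hs : s ≤ s')
    (ht : t' ≤ t) : MeshLE S d s' t' :=
  fun u v h1 h2 h3 h4 => h u v (hs.trans h1) h2 (h3.trans ht) h4

theorem MeshLE.superset {S S' : Finset ℝ} {d s t : ℝ} (h : MeshLE S d s t) (hS : S ⊆ S') :
    MeshLE S' d s t := by
  intro u v h1 h2 h3 h4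
  refine h u v h1 h2 h3 (Finset.eq_empty_of_forall_notMem fun x hx => ?_)
  rw [mem_inner] at hx
  have : x ∈ inner S' u v := mem_inner.2 ⟨hS hx.1, hx.2⟩
  simp [h4] at this

theorem exists_meshLE {d : ℝ} (hd : 0 < d) (T : ℝ) : ∃ S : Finset ℝ, MeshLE S d 0 T := by
  refine ⟨(Finset.range (⌈T / d⌉₊ + 1)).image fun k : ℕ => (k : ℝ) * d, fun u v hu huv hv h => ?_⟩
  by_contra! hlt
  have hk : (⌊u / d⌋₊ : ℝ) * d ≤ u := by
    rw [← le_div_iff₀ hd]; exact Nat.floor_le (by positivity)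
  have hk' : u < ((⌊u / d⌋₊ + 1 : ℕ) : ℝ) * d := by
    rw [← div_lt_iff₀ hd]; push_cast; exact Nat.lt_floor_add_one _
  have hkv : ((⌊u / d⌋₊ + 1 : ℕ) : ℝ) * d < v := by push_cast; linarith
  have hmem : ((⌊u / d⌋₊ + 1 : ℕ) : ℝ) * d ∈
      inner ((Finset.range (⌈T / d⌉₊ + 1)).image fun k : ℕ => (k : ℝ) * d) u v := by
    refine mem_inner.2 ⟨Finset.mem_image.2 ⟨_, Finset.mem_range.2 ?_, rfl⟩, hk', hkv⟩
    have h1 : ((⌊u / d⌋₊ + 1 : ℕ) : ℝ) < T / d := by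
      rw [lt_div_iff₀ hd]; linarith
    have h2 := h1.trans_le (Nat.le_ceil (T / d))
    have h3 : ⌊u / d⌋₊ + 1 < ⌈T / d⌉₊ := by exact_mod_cast h2
    omega
  simp [h] at hmem

theorem exists_first {S : Finset ℝ} {s t : ℝ} (h : (inner S s t).Nonempty) :
    ∃ v ∈ inner S s t, inner S s v = ∅ := by
  refine ⟨_, Finset.min'_mem _ h, Finset.eq_empty_of_forall_notMem fun x hx => ?_⟩
  have hm := Finset.min'_mem _ h
  rw [mem_inner] at hx hm
  exact absurd (Finset.min'_le _ x (mem_inner.2 ⟨hx.1, hx.2.1, hx.2.2.trans hm.2.2⟩))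
    (not_le.2 hx.2.2)

variable {U : Type*} [NormedAddCommGroup U] {T C θ a δ L : ℝ} {μ : ℝ → ℝ → U → U}

/-- The constant 2 is only available at scale `δ`. Cutting at points of `S`, each cut advancing by
at least `δ / 2`, costs a factor 2 per piece and reaches any bounded length. -/
theorem lipBound_along_of_mesh {S : Finset ℝ} (hδ : 0 < δ)
    (hμ : ∀ s, 0 ≤ s → s ≤ T → μ s s = id)
    (h : ∀ s t, 0 ≤ s → s ≤ t → t ≤ T → t - s ≤ δ → LipBound 2 (along μ S s t)) (n : ℕ) :
    ∀ s t, 0 ≤ s → s ≤ t → t ≤ T → MeshLE S (δ / 3) s t → t - s ≤ (n + 2) * (δ / 2) →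
      LipBound (2 ^ (n + 1)) (along μ S s t) := by
  induction n with
  | zero =>
    intro s t hs hst ht _ hts
    simpa using h s t hs hst ht (by push_cast at hts; linarith)
  | succ n ih =>
    intro s t hs hst ht hm hts
    by_cases hle : t - s ≤ δ
    · refine (h s t hs hst ht hle).mono ?_
      calc (2 : ℝ) = 2 ^ 1 := by norm_num
        _ ≤ _ := pow_le_pow_right₀ (by norm_num) (by omega)
    · push Not at hle
      -- A gap of length `δ / 2` would exceed the mesh `δ / 3`.
      have hne : (inner S (s + δ / 2) (s + δ)).Nonempty := by
        by_contra hemp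
        rw [Finset.not_nonempty_iff_eq_empty] at hemp
        have := hm _ _ (by linarith) (by linarith) (by linarith) hemp
        linarith
      obtain ⟨u, hu⟩ := hne
      rw [mem_inner] at hu
      rw [← along_comp_along hμ hu.1 hs (by linarith) (by linarith) ht, pow_succ]
      refine (ih u t (by linarith) (by linarith) ht (hm.mono (by linarith) le_rfl) ?_).comp
        (h s u hs (by linarith) (by linarith) (by linarith)) (by positivity)
      push_cast at hts
      linarith

theorem rpow_le_mul_rpow_sub_one {h d : ℝ} (ha : 1 < a) (hh : 0 ≤ h) (hd : h ≤ d) :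
    h ^ a ≤ h * d ^ (a - 1) := by
  rcases hh.eq_or_lt with rfl | hh0
  · rw [Real.zero_rpow (by linarith)]; simp
  · calc h ^ a = h ^ (1 + (a - 1)) := by congr 1; ring
      _ = h * h ^ (a - 1) := by rw [Real.rpow_add hh0, Real.rpow_one]
      _ ≤ h * d ^ (a - 1) := by
        gcongr

/-- Comparison of the composition along `S` with a family satisfying the flow property at the
points of `S`. -/
theorem norm_sub_along_le {S : Finset ℝ} {d c : ℝ} {ψ : ℝ → ℝ → U → U} (ha : 1 < a)
    (hμ : ∀ s, 0 ≤ s → s ≤ T → μ s s = id) (hL1 : 1 ≤ L) (hc : 0 ≤ c) (hd : 0 ≤ d)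
    (hψ : ∀ s u t, 0 ≤ s → s ≤ u → u ≤ t → t ≤ T → u ∈ S → ψ t u ∘ ψ u s = ψ t s)
    (hψμ : ∀ s t, 0 ≤ s → s ≤ t → t ≤ T → t - s ≤ d →
      ∀ x, ‖ψ t s x - μ t s x‖ ≤ c * (t - s) ^ a) {t : ℝ} (htT : t ≤ T) :
    ∀ {s : ℝ}, 0 ≤ s → s ≤ t → MeshLE S d s t →
      (∀ s', s ≤ s' → s' ≤ t → LipBound L (along μ S s' t)) →
      ∀ x, ‖ψ t s x - along μ S s t x‖ ≤ L * c * (t - s) * d ^ (a - 1) := by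
  intro s
  have hda : 0 ≤ d ^ (a - 1) := Real.rpow_nonneg hd _
  induction hn : (inner S s t).card using Nat.strong_induction_on generalizing s with
  | _ n ih =>
  intro hs hst hm hL x
  rcases Finset.eq_empty_or_nonempty (inner S s t) with hne | hne
  · rw [along_of_inner_eq_empty μ hne]
    have hts : t - s ≤ d := by
      rcases hst.eq_or_lt with rfl | hlt
      · simpa using hd
      · exact hm s t le_rfl hlt le_rfl hne
    refine (hψμ s t hs hst htT hts x).trans ?_
    have h1 := rpow_le_mul_rpow_sub_one ha (sub_nonneg.2 hst) hts
    have h2 : 0 ≤ c * ((t - s) * d ^ (a - 1)) :=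
      mul_nonneg hc (mul_nonneg (sub_nonneg.2 hst) hda)
    nlinarith
  · obtain ⟨v, hv, hvS⟩ := exists_first hne
    have hv' := mem_inner.1 hv
    have hsv := hv'.2.1.le
    have hvt := hv'.2.2.le
    have hts : v - s ≤ d := hm s v le_rfl hv'.2.1 hvt hvS
    have hcard : (inner S v t).card < n := by
      rw [← hn]; exact inner_card_lt hsv le_rfl hv (by simp [mem_inner])
    rw [← along_comp_along hμ hv'.1 hs hsv hvt htT, ← hψ s v t hs hsv hvt htT hv'.1,
      along_of_inner_eq_empty μ hvS]
    have h1 := ih _ hcard rfl (hs.trans hsv) hvt (hm.mono hsv le_rfl)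
      (fun s' h1 h2 => hL s' (hsv.trans h1) h2) (ψ v s x)
    have h2 := hL v hsv hvt (ψ v s x) (μ v s x)
    have h3 := hψμ s v hs hsv (hvt.trans htT) hts x
    have h4 := rpow_le_mul_rpow_sub_one ha (sub_nonneg.2 hsv) hts
    -- The local error on the first subinterval is amplified by the remaining composition, whose
    -- Lipschitz constant `L` does not grow with the number of points. The errors therefore add up
    -- instead of multiplying.
    calc ‖(ψ t v ∘ ψ v s) x - (along μ S v t ∘ μ v s) x‖
        = ‖(ψ t v (ψ v s x) - along μ S v t (ψ v s x)) +
          (along μ S v t (ψ v s x) - along μ S v t (μ v s x))‖ := by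
            simp only [Function.comp_apply]; congr 1; abel
      _ ≤ L * c * (t - v) * d ^ (a - 1) + L * (c * ((v - s) * d ^ (a - 1))) := by
        refine (norm_add_le _ _).trans (add_le_add h1 (h2.trans ?_))
        have : c * (v - s) ^ a ≤ c * ((v - s) * d ^ (a - 1)) := by gcongr
        have hL0 : 0 ≤ L := by linarith
        gcongr
        linarith
      _ = _ := by ring

/-- The flow obtained from `μ` as the limit of the compositions along finer and finer finite
sets of times. -/
def sewn (μ : ℝ → ℝ → U → U) (t s : ℝ) (x : U) : U :=
  limUnder atTop fun S : Finset ℝ => along μ S s t x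

/-- The quantitative conclusions of the sewing lemma. -/
structure IsSewing (T a A L δ : ℝ) (μ φ : ℝ → ℝ → U → U) : Prop where
  refl : ∀ s, 0 ≤ s → s ≤ T → μ s s = id
  flow : IsFlow T φ
  near : ∀ s t, 0 ≤ s → s ≤ t → t ≤ T → t - s ≤ δ → ∀ x, ‖φ t s x - μ t s x‖ ≤ A * (t - s) ^ a
  lip : ∀ s t, 0 ≤ s → s ≤ t → t ≤ T → LipBound L (φ t s)
  lip_along : ∀ S s t, 0 ≤ s → s ≤ t → t ≤ T → MeshLE S δ s t → LipBound L (along μ S s t)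

theorem IsFlow.comp {M : Type*} [NormedAddCommGroup M] {φ : ℝ → ℝ → M → M} (h : IsFlow T φ)
    {s u t : ℝ} (hs : 0 ≤ s) (hsu : s ≤ u) (hut : u ≤ t) (ht : t ≤ T) (x : M) :
    φ t u (φ u s x) = φ t s x :=
  congrFun (h.2 s u t hs hsu hut ht) x

theorem IsSewing.norm_sub_along_le {A : ℝ} {φ : ℝ → ℝ → U → U} (h : IsSewing T a A L δ μ φ)
    (ha : 1 < a) (hL : 1 ≤ L) (hA : 0 ≤ A) {S : Finset ℝ} {d s t : ℝ} (hd : 0 ≤ d) (hdδ : d ≤ δ)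
    (hs : 0 ≤ s) (hst : s ≤ t) (ht : t ≤ T) (hS : MeshLE S d s t) (x : U) :
    ‖φ t s x - along μ S s t x‖ ≤ L * A * (t - s) * d ^ (a - 1) := by
  have hS' : MeshLE S δ s t := fun u v h1 h2 h3 h4 => (hS u v h1 h2 h3 h4).trans hdδ
  exact RoughFlow.norm_sub_along_le ha h.refl hL hA hd
    (fun s u t h1 h2 h3 h4 _ => h.flow.2 s u t h1 h2 h3 h4)
    (fun s t h1 h2 h3 h4 => h.near s t h1 h2 h3 (h4.trans hdδ)) ht hs hst hS
    (fun s' h1 h2 => h.lip_along S s' t (hs.trans h1) h2 ht (hS'.mono h1 le_rfl)) x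

/-- Both flows are compared with the same compositions of mesh `d → 0`. Only the Lipschitz bound on
these compositions enters, so nothing is asked of the regularity of `ψ`, and the two exponents are
unrelated. -/
theorem IsSewing.unique {A : ℝ} {φ ψ : ℝ → ℝ → U → U} (h : IsSewing T a A L δ μ φ)
    (ha : 1 < a) (hL : 1 ≤ L) (hA : 0 ≤ A) (hδ : 0 < δ) {a' c δ' : ℝ} (ha' : 1 < a') (hc : 0 ≤ c)
    (hδ' : 0 < δ') (hψ : IsFlow T ψ) (hψμ : ∀ s t, 0 ≤ s → s ≤ t → t ≤ T → t - s ≤ δ' →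
      ∀ x, ‖ψ t s x - μ t s x‖ ≤ c * (t - s) ^ a') {s t : ℝ} (hs : 0 ≤ s) (hst : s ≤ t)
    (ht : t ≤ T) : ψ t s = φ t s := by
  ext x
  have key : ∀ᶠ d in 𝓝[>] (0 : ℝ), ‖ψ t s x - φ t s x‖ ≤
      L * c * (t - s) * d ^ (a' - 1) + L * A * (t - s) * d ^ (a - 1) := by
    filter_upwards [self_mem_nhdsWithin, mem_nhdsWithin_of_mem_nhds (Iic_mem_nhds hδ),
      mem_nhdsWithin_of_mem_nhds (Iic_mem_nhds hδ')] with d hd0 hd hd'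
    simp only [Set.mem_Ioi, Set.mem_Iic] at hd0 hd hd'
    obtain ⟨S, hS⟩ := exists_meshLE hd0 T
    have hS := hS.mono hs ht
    have hS' : MeshLE S δ s t := fun u v h1 h2 h3 h4 => (hS u v h1 h2 h3 h4).trans hd
    have h1 := h.norm_sub_along_le ha hL hA hd0.le hd hs hst ht hS x
    have h2 := RoughFlow.norm_sub_along_le ha' h.refl hL hc hd0.le
      (fun s u t h1 h2 h3 h4 _ => hψ.2 s u t h1 h2 h3 h4)
      (fun s t h1 h2 h3 h4 => hψμ s t h1 h2 h3 (h4.trans hd')) ht hs hst hS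
      (fun s' h1 h2 => h.lip_along S s' t (hs.trans h1) h2 ht (hS'.mono h1 le_rfl)) x
    calc ‖ψ t s x - φ t s x‖
        = ‖(ψ t s x - along μ S s t x) - (φ t s x - along μ S s t x)‖ := by congr 1; abel
      _ ≤ _ := (norm_sub_le _ _).trans (add_le_add h2 h1)
  have lim : Tendsto (fun d : ℝ => L * c * (t - s) * d ^ (a' - 1) + L * A * (t - s) * d ^ (a - 1))
      (𝓝[>] 0) (𝓝 (L * c * (t - s) * 0 ^ (a' - 1) + L * A * (t - s) * 0 ^ (a - 1))) := by
    apply Tendsto.mono_left _ nhdsWithin_le_nhds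
    apply Continuous.tendsto
    have := Real.continuous_rpow_const (q := a - 1) (by linarith)
    have := Real.continuous_rpow_const (q := a' - 1) (by linarith)
    fun_prop
  have := ge_of_tendsto lim key
  rw [Real.zero_rpow (by linarith), Real.zero_rpow (by linarith)] at this
  rw [← sub_eq_zero, ← norm_le_zero_iff]
  linarith

/-- Compositions along finite sets, directed by inclusion, form a Cauchy net. The flow property at
`u` holds along every set containing `u`, hence eventually, and survives in the limit thanks to the
uniform Lipschitz bound. -/
theorem exists_isSewing [CompleteSpace U] (T : ℝ) (hC : 0 ≤ C) (hθ : 0 < θ) (ha : 1 < a) :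
    ∃ A ≥ 0, ∃ L ≥ 1, ∃ δ > 0, ∀ μ : ℝ → ℝ → U → U, AlmostFlow T C θ a μ →
      IsSewing T a A L δ μ (sewn μ) := by
  obtain ⟨A, hA, δ, hδ, H⟩ := exists_scale (U := U) hC hθ ha
  set L : ℝ := 2 ^ (⌈T / (δ / 2)⌉₊ + 1) with hL
  have hL1 : 1 ≤ L := one_le_pow₀ (by norm_num)
  refine ⟨A, hA, L, hL1, δ / 3, by positivity, fun μ hμ => ?_⟩
  have hlip : ∀ S s t, 0 ≤ s → s ≤ t → t ≤ T → MeshLE S (δ / 3) s t →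
      LipBound L (along μ S s t) := by
    intro S s t hs hst ht hm
    refine lipBound_along_of_mesh hδ hμ.refl
      (fun s t h1 h2 h3 h4 => (H T μ hμ S s t h1 h2 h3 h4).2) _ s t hs hst ht hm ?_
    have h1 : T ≤ ⌈T / (δ / 2)⌉₊ * (δ / 2) := by
      rw [← div_le_iff₀ (by positivity)]; exact Nat.le_ceil _
    linarith
  have hlim : ∀ s t, 0 ≤ s → s ≤ t → t ≤ T → ∀ x,
      Tendsto (fun S => along μ S s t x) atTop (𝓝 (sewn μ t s x)) := by
    intro s t hs hst ht x
    have : Nonempty U := ⟨x⟩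
    apply CauchySeq.tendsto_limUnder
    rw [Metric.cauchySeq_iff']
    intro ε hε
    have lim : Tendsto (fun d : ℝ => L * A * (t - s) * d ^ (a - 1))
        (𝓝[>] 0) (𝓝 (L * A * (t - s) * 0 ^ (a - 1))) := by
      apply Tendsto.mono_left _ nhdsWithin_le_nhds
      apply Continuous.tendsto
      have := Real.continuous_rpow_const (q := a - 1) (by linarith)
      fun_prop
    rw [Real.zero_rpow (by linarith), mul_zero] at lim
    obtain ⟨d, hdε, hd0, hdδ⟩ := ((lim.eventually_lt_const hε).and
      ((eventually_mem_of_tendsto_nhdsWithin (tendsto_id (x := 𝓝[>] (0 : ℝ)))).and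
        (mem_nhdsWithin_of_mem_nhds
          (Iic_mem_nhds (show (0 : ℝ) < δ / 3 by positivity))))).exists
    simp only [id, Set.mem_Ioi] at hd0 hdδ
    obtain ⟨S₀, hS₀⟩ := exists_meshLE hd0 T
    refine ⟨S₀, fun S hS => ?_⟩
    rw [dist_eq_norm]
    have hS₀' : MeshLE S₀ (δ / 3) 0 T := fun u v h1 h2 h3 h4 => (hS₀ u v h1 h2 h3 h4).trans hdδ
    refine lt_of_le_of_lt ?_ hdε
    -- The composition along the finer set `S` plays the role of `ψ`: it has the flow property at
    -- the points of `S₀`, which is all that the comparison requires.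
    exact norm_sub_along_le (ψ := fun t s => along μ S s t) ha hμ.refl hL1 hA hd0.le
      (fun s u t h1 h2 h3 h4 h5 => along_comp_along hμ.refl (hS h5) h1 h2 h3 h4)
      (fun s t h1 h2 h3 h4 => (H T μ hμ S s t h1 h2 h3 (by linarith)).1) ht hs hst
      (hS₀.mono hs ht)
      (fun s' h1 h2 => hlip S₀ s' t (hs.trans h1) h2 ht (hS₀'.mono (hs.trans h1) ht)) x
  obtain ⟨S₀, hS₀⟩ := exists_meshLE (show (0 : ℝ) < δ / 3 by positivity) T
  have hev : ∀ s t, 0 ≤ s → s ≤ t → t ≤ T → ∀ᶠ S in atTop, LipBound L (along μ S s t) := by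
    intro s t hs hst ht
    filter_upwards [eventually_ge_atTop S₀] with S hS
    exact hlip S s t hs hst ht ((hS₀.superset hS).mono hs ht)
  refine ⟨hμ.refl, ⟨fun s hs hsT => ?_, fun s u t hs hsu hut ht => ?_⟩,
    fun s t hs hst ht hts x => ?_,
    fun s t hs hst ht x y => ?_, hlip⟩
  · ext x
    refine tendsto_nhds_unique (hlim s s hs le_rfl hsT x) ?_
    simp only [along_self hμ.refl _ hs hsT]
    exact tendsto_const_nhds
  · ext x
    refine tendsto_nhds_unique ?_ (hlim s t hs (hsu.trans hut) ht x)
    have h1 := hlim s u hs hsu (hut.trans ht) x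
    have h2 := hlim u t (hs.trans hsu) hut ht (sewn μ u s x)
    have h3 : Tendsto (fun S => along μ S u t (along μ S s u x) - along μ S u t (sewn μ u s x))
        atTop (𝓝 0) := by
      apply squeeze_zero_norm' (a := fun S => L * ‖along μ S s u x - sewn μ u s x‖)
      · filter_upwards [hev u t (hs.trans hsu) hut ht] with S hS using hS _ _
      · have := (tendsto_iff_norm_sub_tendsto_zero.1 h1).const_mul L
        simpa using this
    have h4 := h3.add h2
    simp only [sub_add_cancel, zero_add] at h4
    refine h4.congr' ?_
    filter_upwards [eventually_ge_atTop {u}] with S hS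
    exact congrFun (along_comp_along hμ.refl (hS (Finset.mem_singleton_self u)) hs hsu hut ht) x
  · exact le_of_tendsto ((hlim s t hs hst ht x).sub_const _).norm
      (Eventually.of_forall fun S => (H T μ hμ S s t hs hst ht (by linarith)).1 x)
  · refine le_of_tendsto ((hlim s t hs hst ht x).sub (hlim s t hs hst ht y)).norm ?_
    filter_upwards [hev s t hs hst ht] with S hS using hS x y

end SewingLimit
end RoughFlow

namespace RoughFlow

/-! ### Bounded Lipschitz vector fields and their time-one maps -/

section ODE

open Set

variable {U : Type*} [NormedAddCommGroup U] [NormedSpace ℝ U]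

/-- Mean value inequality for `θ ↦ W(b + θ(a - b)) - W(d + θ(c - d))`. Its derivative splits into
`W'` applied to `a - b - c + d` and a variation of `W'` applied to `c - d`. -/
theorem fourPoint_of_hasFDerivAt {K K' : ℝ} {W : U → U} {W' : U → U →L[ℝ] U} (hK' : 0 ≤ K')
    (h : ∀ x, HasFDerivAt W (W' x) x) (hb : ∀ x, ‖W' x‖ ≤ K)
    (hl : ∀ x y, ‖W' x - W' y‖ ≤ K' * ‖x - y‖) : FourPoint K K' W := by
  intro a b c d
  have hline : ∀ (a b : U) (θ : ℝ), HasDerivAt (fun θ : ℝ => W (b + θ • (a - b)))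
      (W' (b + θ • (a - b)) (a - b)) θ := by
    intro a b θ
    have h1 : HasDerivAt (fun θ : ℝ => b + θ • (a - b)) (a - b) θ := by
      simpa using ((hasDerivAt_id θ).smul_const (a - b)).const_add b
    exact (h _).comp_hasDerivAt θ h1
  have key := norm_image_sub_le_of_norm_deriv_le_segment_01'
    (f := fun θ : ℝ => W (b + θ • (a - b)) - W (d + θ • (c - d)))
    (C := K * ‖a - b - c + d‖ + K' * ‖c - d‖ * (‖a - c‖ + ‖b - d‖))
    (fun θ _ => ((hline a b θ).sub (hline c d θ)).hasDerivWithinAt) (fun θ hθ => ?_)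
  · simp only [one_smul, add_sub_cancel, zero_smul, add_zero] at key
    refine le_trans (le_of_eq ?_) key
    congr 1; abel
  · set P := b + θ • (a - b)
    set Q := d + θ • (c - d)
    have e : W' P (a - b) - W' Q (c - d) = W' P (a - b - c + d) + (W' P - W' Q) (c - d) := by
      simp only [map_sub, map_add, sub_apply]; abel
    have hPQ : ‖P - Q‖ ≤ ‖a - c‖ + ‖b - d‖ := by
      have : P - Q = θ • (a - c) + (1 - θ) • (b - d) := by simp only [P, Q]; module
      rw [this]
      refine (norm_add_le _ _).trans ?_
      rw [norm_smul, norm_smul, Real.norm_of_nonneg hθ.1, Real.norm_of_nonneg (by linarith [hθ.2])]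
      have h1 : θ * ‖a - c‖ ≤ 1 * ‖a - c‖ := by gcongr; exact hθ.2.le
      have h2 : (1 - θ) * ‖b - d‖ ≤ 1 * ‖b - d‖ := by gcongr; linarith [hθ.1]
      linarith
    rw [e]
    refine (norm_add_le _ _).trans (add_le_add ((ContinuousLinearMap.le_opNorm _ _).trans ?_)
      ((ContinuousLinearMap.le_opNorm _ _).trans ?_))
    · have := hb P; gcongr
    · calc ‖W' P - W' Q‖ * ‖c - d‖ ≤ (K' * (‖a - c‖ + ‖b - d‖)) * ‖c - d‖ := by
            gcongr; exact (hl P Q).trans (by gcongr)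
        _ = _ := by ring

/-- Grönwall's inequality on the unit interval. -/
theorem norm_le_of_deriv_le {f f' : ℝ → U} {K ε : ℝ} (hK : 0 ≤ K) (hε : 0 ≤ ε)
    (hf : ∀ u ∈ Icc (0 : ℝ) 1, HasDerivWithinAt f (f' u) (Icc 0 1) u)
    (hb : ∀ u ∈ Icc (0 : ℝ) 1, ‖f' u‖ ≤ K * ‖f u‖ + ε) :
    ∀ u ∈ Icc (0 : ℝ) 1, ‖f u‖ ≤ Real.exp K * (‖f 0‖ + ε) := by
  intro u hu
  have h1 := norm_le_gronwallBound_of_norm_deriv_right_le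
    (fun u hu => (hf u hu).continuousWithinAt)
    (fun u hu => (hf u (Ico_subset_Icc_self hu)).mono_of_mem_nhdsWithin
      (Icc_mem_nhdsGE_of_mem hu)) le_rfl
    (fun u hu => hb u (Ico_subset_Icc_self hu)) u hu
  refine h1.trans ?_
  rw [sub_zero]
  refine (gronwallBound_mono (norm_nonneg _) hε hK hu.2).trans ?_
  rcases hK.eq_or_lt with rfl | hK
  · simp [gronwallBound]
  · rw [gronwallBound_of_K_ne_0 hK.ne']
    -- This bound, from `1 - K ≤ exp(-K)`, removes the division by `K` and so agrees with the case
    -- `K = 0`.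
    have h2 : ε / K * (Real.exp (K * 1) - 1) ≤ ε / K * (K * Real.exp K) := by
      have : 1 - K ≤ Real.exp (-K) := by linarith [Real.add_one_le_exp (-K)]
      have h3 : Real.exp (-K) * Real.exp K = 1 := by rw [← Real.exp_add]; simp
      have h4 : (1 - K) * Real.exp K ≤ Real.exp (-K) * Real.exp K := by gcongr
      rw [mul_one]
      gcongr
      linarith
    have h3 : ε / K * (K * Real.exp K) = ε * Real.exp K := by field_simp
    rw [mul_one] at h2
    change ‖f 0‖ * Real.exp (K * 1) + ε / K * (Real.exp (K * 1) - 1) ≤ _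
    rw [mul_one]
    linarith

variable {W : U → U} {M K K' : ℝ}

theorem SolvesODE.norm_sub_le {x z : U} {y w : ℝ → U} (hK : 0 ≤ K) (hW : LipBound K W)
    (hy : SolvesODE W x y) (hw : SolvesODE W z w) :
    ∀ u ∈ Icc (0 : ℝ) 1, ‖y u - w u‖ ≤ Real.exp K * ‖x - z‖ := by
  have := norm_le_of_deriv_le (f := fun u => y u - w u) hK le_rfl
    (fun u hu => (hy.2 u hu).sub (hw.2 u hu)) (fun u hu => by simpa using hW (y u) (w u))
  simpa [hy.1, hw.1] using this

theorem SolvesODE.eqOn {x : U} {y w : ℝ → U} (hK : 0 ≤ K) (hW : LipBound K W)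
    (hy : SolvesODE W x y) (hw : SolvesODE W x w) : EqOn y w (Icc 0 1) := by
  intro u hu
  have := hy.norm_sub_le hK hW hw u hu
  rw [sub_self, norm_zero, mul_zero, norm_le_zero_iff, sub_eq_zero] at this
  exact this

/-- Picard–Lindelöf on the ball of radius `M` about `x`: a solution of speed at most `M` cannot
leave it in unit time, so no subdivision of `[0, 1]` is needed. -/
theorem exists_solvesODE [CompleteSpace U] (hK : 0 ≤ K) (hW : LipBound K W)
    (hM : ∀ x, ‖W x‖ ≤ M) (x : U) : ∃ y, SolvesODE W x y := by
  have hM0 : 0 ≤ M := (norm_nonneg _).trans (hM x)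
  have hlip : LipschitzWith K.toNNReal W := LipschitzWith.of_dist_le_mul fun a b => by
    rw [dist_eq_norm, dist_eq_norm, Real.coe_toNNReal _ hK]; exact hW a b
  have hpl : IsPicardLindelof (fun _ => W) (tmin := 0) (tmax := 1)
      ⟨(0 : ℝ), by simp⟩ x M.toNNReal 0 M.toNNReal K.toNNReal :=
    { lipschitzOnWith := fun _ _ => hlip.lipschitzOnWith
      continuousOn := fun _ _ => continuousOn_const
      norm_le := fun _ _ z _ => by rw [Real.coe_toNNReal _ hM0]; exact hM z
      mul_max_le := by simp }
  obtain ⟨y, h0, hy⟩ := hpl.exists_eq_forall_mem_Icc_hasDerivWithinAt₀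
  exact ⟨y, h0, hy⟩

theorem timeOne_eq {x : U} {y : ℝ → U} (hK : 0 ≤ K) (hW : LipBound K W) (hy : SolvesODE W x y) :
    timeOne W x = y 1 := by
  have h : ∃ y, SolvesODE W x y := ⟨y, hy⟩
  rw [timeOne, dif_pos h]
  exact h.choose_spec.eqOn hK hW hy (by simp)

theorem SolvesODE.norm_sub_initial_le {x : U} {y : ℝ → U} (hM : ∀ x, ‖W x‖ ≤ M)
    (hy : SolvesODE W x y) : ‖y 1 - x‖ ≤ M := by
  have := norm_image_sub_le_of_norm_deriv_le_segment_01' (fun u hu => hy.2 u hu)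
    (fun u _ => hM (y u))
  simpa [hy.1] using this

/-- Grönwall for the second order difference of four trajectories. The forcing term is a product of
two first order differences, each at most `exp K` times its initial value; a third `exp K` comes
from Grönwall itself. No derivative of the flow is taken. -/
theorem fourPoint_timeOne [CompleteSpace U] (hK : 0 ≤ K) (hK' : 0 ≤ K') (hW : FourPoint K K' W)
    (hM : ∀ x, ‖W x‖ ≤ M) : FourPoint (Real.exp K) (K' * Real.exp K ^ 3) (timeOne W) := by
  intro a b c d
  have hL := hW.lipBound
  obtain ⟨ya, ha⟩ := exists_solvesODE hK hL hM a
  obtain ⟨yb, hb⟩ := exists_solvesODE hK hL hM b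
  obtain ⟨yc, hc⟩ := exists_solvesODE hK hL hM c
  obtain ⟨yd, hd⟩ := exists_solvesODE hK hL hM d
  rw [timeOne_eq hK hL ha, timeOne_eq hK hL hb, timeOne_eq hK hL hc, timeOne_eq hK hL hd]
  have := norm_le_of_deriv_le (f := fun u => ya u - yb u - yc u + yd u)
    (ε := K' * (Real.exp K * ‖c - d‖) * (Real.exp K * ‖a - c‖ + Real.exp K * ‖b - d‖)) hK
    (by positivity)
    (fun u hu => (((ha.2 u hu).sub (hb.2 u hu)).sub (hc.2 u hu)).add (hd.2 u hu))
    (fun u hu => (hW _ _ _ _).trans (by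
      have h1 := hc.norm_sub_le hK hL hd u hu
      have h2 := ha.norm_sub_le hK hL hc u hu
      have h3 := hb.norm_sub_le hK hL hd u hu
      gcongr)) 1 (by simp)
  simp only [ha.1, hb.1, hc.1, hd.1] at this
  refine this.trans (le_of_eq ?_)
  ring

theorem norm_timeOne_sub_timeOne_le [CompleteSpace U] {W₂ : U → U} {K₂ M₂ ε : ℝ} (hK : 0 ≤ K)
    (hW : LipBound K W) (hM : ∀ x, ‖W x‖ ≤ M) (hK₂ : 0 ≤ K₂) (hW₂ : LipBound K₂ W₂)
    (hM₂ : ∀ x, ‖W₂ x‖ ≤ M₂) (hε : ∀ x, ‖W x - W₂ x‖ ≤ ε) (x : U) :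
    ‖timeOne W x - timeOne W₂ x‖ ≤ Real.exp K * ε := by
  obtain ⟨y, hy⟩ := exists_solvesODE hK hW hM x
  obtain ⟨z, hz⟩ := exists_solvesODE hK₂ hW₂ hM₂ x
  rw [timeOne_eq hK hW hy, timeOne_eq hK₂ hW₂ hz]
  have := norm_le_of_deriv_le (f := fun u => y u - z u) (ε := ε) hK
    ((norm_nonneg _).trans (hε x))
    (fun u hu => (hy.2 u hu).sub (hz.2 u hu)) (fun u hu => by
      calc ‖W (y u) - W₂ (z u)‖ = ‖(W (y u) - W (z u)) + (W (z u) - W₂ (z u))‖ := by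
            congr 1; abel
        _ ≤ _ := (norm_add_le _ _).trans (add_le_add (hW _ _) (hε _))) 1 (by simp)
  simpa [hy.1, hz.1] using this

end ODE
end RoughFlow

namespace RoughFlow

/-! ### Exponentials and logarithms of nilpotent elements -/

section Nilpotent

variable {A : Type*} [Ring A] [Algebra ℝ A]

/-- The exponential series truncated after degree `n`. -/
def nexp (n : ℕ) (a : A) : A := ∑ k ∈ Finset.range (n + 1), ((k.factorial : ℝ)⁻¹) • a ^ k

/-- The series of `log (1 + x)` truncated after degree `n`. -/
def nlog (n : ℕ) (x : A) : A := ∑ k ∈ Finset.Icc 1 n, ((-1 : ℝ) ^ (k + 1) / (k : ℝ)) • x ^ k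

/-- On nilpotent elements the truncated series is `IsNilpotent.exp`. The three truncation orders are
independent because conjugation needs a larger one for the sum than for the summands. -/
theorem nexp_add {a b : A} {n m l : ℕ} (hab : Commute a b) (ha : a ^ (n + 1) = 0)
    (hb : b ^ (m + 1) = 0) (hl : (a + b) ^ (l + 1) = 0) :
    nexp l (a + b) = nexp n a * nexp m b := by
  let _ : Module ℚ A := Module.compHom A (algebraMap ℚ ℝ)
  have key : ∀ {a : A} {n : ℕ}, a ^ (n + 1) = 0 → IsNilpotent.exp a = nexp n a := by
    intro a n h
    rw [IsNilpotent.exp_eq_sum h, nexp]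
    refine Finset.sum_congr rfl fun k _ => ?_
    change (algebraMap ℚ ℝ (k.factorial : ℚ)⁻¹) • a ^ k = _
    simp
  rw [← key ha, ← key hb, ← key hl]
  exact IsNilpotent.exp_add_of_commute hab ⟨_, ha⟩ ⟨_, hb⟩

@[simp]
theorem nexp_zero (n : ℕ) : nexp n (0 : A) = 1 := by
  rw [nexp, Finset.sum_eq_single 0] <;> simp +contextual

theorem nexp_neg_mul_nexp {a : A} {n : ℕ} (ha : a ^ (n + 1) = 0) :
    nexp n (-a) * nexp n a = 1 := by
  rw [← nexp_add (l := n) (Commute.neg_left (Commute.refl a)) (by rw [neg_pow, ha, mul_zero]) ha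
    (by simp)]
  simp

theorem nexp_mul_nexp_neg {a : A} {n : ℕ} (ha : a ^ (n + 1) = 0) :
    nexp n a * nexp n (-a) = 1 := by
  have := nexp_neg_mul_nexp (a := -a) (n := n) (by rw [neg_pow, ha, mul_zero])
  rwa [neg_neg] at this

/-- Conjugation by an exponential, up to second order in the adjoint action. -/
theorem nexp_conj_mem {b : A} {n : ℕ} (hb : b ^ (n + 1) = 0) (M : Submodule ℝ A) (x : A)
    (hx : b * (b * x - x * b) - (b * x - x * b) * b ∈ M) (hM : ∀ m ∈ M, b * m - m * b ∈ M) :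
    nexp n (-b) * x * nexp n b - x + (b * x - x * b) ∈ M := by
  -- Conjugation is the exponential of `l + r`, the commutator with `-b`, since left and right
  -- multiplications commute. Terms of order at least two in `l + r` are the ones that land in `M`.
  set l : Module.End ℝ A := LinearMap.mulLeft ℝ (-b) with hl
  set r : Module.End ℝ A := LinearMap.mulRight ℝ b with hr
  have hln : l ^ (n + 1) = 0 := by
    rw [LinearMap.pow_mulLeft, neg_pow, hb, mul_zero, LinearMap.mulLeft_zero_eq_zero]
  have hrn : r ^ (n + 1) = 0 := by
    rw [LinearMap.pow_mulRight, hb, LinearMap.mulRight_zero_eq_zero]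
  have hcomm : Commute l r := LinearMap.commute_mulLeft_right (-b) b
  have hD : (l + r) ^ (2 * n + 1 + 1) = 0 :=
    hcomm.add_pow_eq_zero_of_add_le_succ_of_pow_eq_zero hln hrn (by omega)
  have h1 := congrArg (fun f => f x) (nexp_add hcomm hln hrn hD)
  have e1 : nexp n l = LinearMap.mulLeft ℝ (nexp n (-b)) := by
    ext z
    simp only [nexp, hl, LinearMap.pow_mulLeft, LinearMap.sum_apply, LinearMap.smul_apply,
      LinearMap.mulLeft_apply, Finset.sum_mul, smul_mul_assoc]
  have e2 : nexp n r = LinearMap.mulRight ℝ (nexp n b) := by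
    ext z
    simp only [nexp, hr, LinearMap.pow_mulRight, LinearMap.sum_apply, LinearMap.smul_apply,
      LinearMap.mulRight_apply, Finset.mul_sum, mul_smul_comm]
  have hDx : ∀ z, (l + r) z = -(b * z - z * b) := fun z => by
    simp only [hl, hr, LinearMap.add_apply, LinearMap.mulLeft_apply, LinearMap.mulRight_apply]
    noncomm_ring
  have hpow : ∀ k, ((l + r) ^ (k + 1 + 1)) x ∈ M := by
    intro k
    induction k with
    | zero =>
      rw [zero_add, pow_succ', pow_one, Module.End.mul_apply, hDx, hDx]
      convert hx using 1
      noncomm_ring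
    | succ k ih =>
      rw [pow_succ', Module.End.mul_apply, hDx]
      exact M.neg_mem (hM _ ih)
  rw [e1, e2, Module.End.mul_apply, LinearMap.mulLeft_apply, LinearMap.mulRight_apply, nexp,
    Finset.sum_range_succ', Finset.sum_range_succ'] at h1
  simp only [LinearMap.add_apply, LinearMap.sum_apply, LinearMap.smul_apply, zero_add, pow_one,
    pow_zero, Nat.factorial_zero, Nat.factorial_one, Nat.cast_one, inv_one, one_smul,
    Module.End.one_apply] at h1
  have e3 : nexp n (-b) * x * nexp n b - x + (b * x - x * b) = ∑ k ∈ Finset.range (2 * n),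
      (((k + 1 + 1).factorial : ℝ)⁻¹) • ((l + r) ^ (k + 1 + 1)) x := by
    rw [mul_assoc, ← h1]
    have := hDx x
    rw [LinearMap.add_apply] at this
    rw [this]
    abel
  rw [e3]
  exact M.sum_mem fun k _ => M.smul_mem _ (hpow k)

open Polynomial in
/-- The truncated exponential and logarithm series are inverse to each other. -/
theorem nexp_nlog {x : A} {n : ℕ} (hx : x ^ (n + 1) = 0) : nexp n (nlog n x) = 1 + x := by
  set E : ℝ[X] := nexp n X with hE
  set G : ℝ[X] := nlog n X with hG
  have hGX : X ∣ G := by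
    refine Finset.dvd_sum fun k hk => ?_
    rw [smul_eq_C_mul]
    exact Dvd.dvd.mul_left (dvd_pow_self X (by have := (Finset.mem_Icc.1 hk).1; omega)) _
  have hE' : derivative E = E - C ((n.factorial : ℝ)⁻¹) * X ^ n := by
    have h1 : ∀ k : ℕ, derivative ((((k + 1).factorial : ℝ)⁻¹) • (X : ℝ[X]) ^ (k + 1)) =
        ((k.factorial : ℝ)⁻¹) • (X : ℝ[X]) ^ k := by
      intro k
      rw [derivative_smul, derivative_X_pow, add_tsub_cancel_right,
        ← smul_eq_C_mul, smul_smul]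
      congr 1
      rw [Nat.factorial_succ]
      push_cast
      have : (k.factorial : ℝ) ≠ 0 := by positivity
      have : (k : ℝ) + 1 ≠ 0 := by positivity
      field_simp
    have h2 : derivative E = ∑ k ∈ Finset.range n, ((k.factorial : ℝ)⁻¹) • (X : ℝ[X]) ^ k := by
      rw [hE, nexp, Finset.sum_range_succ', derivative_add, derivative_sum]
      simp only [h1, pow_zero, derivative_smul, derivative_one, smul_zero, add_zero]
    rw [h2, hE, nexp, Finset.sum_range_succ, smul_eq_C_mul]
    ring
  have hG' : (1 + X) * derivative G = 1 - (-X) ^ n := by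
    have h1 : derivative G = ∑ k ∈ Finset.range n, (-X : ℝ[X]) ^ k := by
      rw [hG, nlog, derivative_sum, Finset.range_eq_Ico, Finset.sum_Ico_eq_sum_range,
        ← Finset.Ico_add_one_right_eq_Icc, Finset.sum_Ico_eq_sum_range]
      refine Finset.sum_congr (by simp) fun k _ => ?_
      rw [derivative_smul, derivative_X_pow, ← smul_eq_C_mul, smul_smul]
      have : ((1 + k : ℕ) : ℝ) ≠ 0 := by positivity
      rw [div_mul_cancel₀ _ this, zero_add, Nat.add_sub_cancel_left, smul_eq_C_mul,
        show 1 + k + 1 = k + 2 by ring, pow_add, neg_pow (X : ℝ[X])]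
      simp
    rw [h1, ← mul_neg_geom_sum]
    ring
  -- Up to multiples of `X^n`, `E' = E` and `(1 + X) G' = 1`, so `(1 + X) Q' = Q` modulo `X^n`. With
  -- `Q(0) = 0` the resulting recursion kills every coefficient up to degree `n`, and `Q` vanishes
  -- at `x`.
  set Q : ℝ[X] := E.comp G - (1 + X) with hQ
  have hdiv : X ^ n ∣ (1 + X) * derivative Q - Q := by
    have e : (1 + X) * derivative Q - Q = -(E.comp G * (-X) ^ n) -
        C ((n.factorial : ℝ)⁻¹) * G ^ n * (1 - (-X) ^ n) := by
      have : derivative Q = (E.comp G - C ((n.factorial : ℝ)⁻¹) * G ^ n) * derivative G - 1 := by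
        rw [hQ, derivative_sub, derivative_comp, hE']
        simp
        ring
      rw [this, hQ]
      linear_combination (E.comp G - C ((n.factorial : ℝ)⁻¹) * G ^ n) * hG'
    rw [e]
    have hX : (X : ℝ[X]) ^ n ∣ (-X) ^ n := by rw [neg_pow]; exact Dvd.dvd.mul_left dvd_rfl _
    exact dvd_sub (dvd_neg.2 (Dvd.dvd.mul_left hX _))
      (Dvd.dvd.mul_right (Dvd.dvd.mul_left (pow_dvd_pow_of_dvd hGX n) _) _)
  have hrec : ∀ j < n, ((j : ℝ) + 1) * Q.coeff (j + 1) = (1 - j) * Q.coeff j := by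
    intro j hj
    have h1 := (X_pow_dvd_iff.1 hdiv) j hj
    rw [add_mul, one_mul, coeff_sub, coeff_add, coeff_derivative] at h1
    cases j with
    | zero => simp at h1 ⊢; linarith
    | succ j =>
      rw [coeff_X_mul, coeff_derivative] at h1
      push_cast at h1 ⊢
      linarith
  have hcoeff : ∀ j ≤ n, Q.coeff j = 0 := by
    intro j
    induction j with
    | zero =>
      intro _
      have hG0 : G.eval 0 = 0 := by
        obtain ⟨H, hH⟩ := hGX
        rw [hH]; simp
      have hE0 : E.eval 0 = 1 := by
        rw [hE, nexp, eval_finsetSum, Finset.sum_eq_single 0] <;> simp +contextual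
      rw [coeff_zero_eq_eval_zero, hQ, eval_sub, eval_comp, hG0, hE0]
      simp
    | succ j ih =>
      intro hj
      have := hrec j (by omega)
      rw [ih (by omega), mul_zero] at this
      exact (mul_eq_zero.1 this).resolve_left (by positivity)
  obtain ⟨R, hR⟩ : X ^ (n + 1) ∣ Q := X_pow_dvd_iff.2 fun d hd => hcoeff d (by omega)
  have h0 : aeval x Q = 0 := by rw [hR, map_mul, map_pow, aeval_X, hx, zero_mul]
  rw [hQ, map_sub, aeval_comp, sub_eq_zero] at h0
  have hGx : aeval x G = nlog n x := by simp [hG, nlog, map_sum]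
  have hEy : ∀ y : A, aeval y E = nexp n y := fun y => by simp [hE, nexp, map_sum]
  rw [hGx, hEy] at h0
  simpa using h0

end Nilpotent

/-! ### Truncated graded algebras and the Lie property of logarithms -/

/-- A grading by `0, …, n` of an algebra, given by its projections. -/
structure TruncGrading (n : ℕ) (A : Type*) [Ring A] [Algebra ℝ A] where
  part : ℕ → A →ₗ[ℝ] A
  sum_part : ∀ x, ∑ k ∈ Finset.range (n + 1), part k x = x
  part_part : ∀ j k x, part j (part k x) = if j = k then part k x else 0
  part_mul : ∀ m x y, part m (x * y) =
    ∑ ij ∈ Finset.HasAntidiagonal.antidiagonal m, part ij.1 x * part ij.2 y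

namespace TruncGrading

variable {n : ℕ} {A : Type*} [Ring A] [Algebra ℝ A] (G : TruncGrading n A)

theorem part_of_lt {k : ℕ} (hk : n < k) (x : A) : G.part k x = 0 := by
  rw [← G.sum_part x, map_sum]
  refine Finset.sum_eq_zero fun j hj => ?_
  rw [G.part_part, if_neg]
  have := Finset.mem_range.1 hj
  omega

theorem ext_part {x y : A} (h : ∀ k ≤ n, G.part k x = G.part k y) : x = y := by
  rw [← G.sum_part x, ← G.sum_part y]
  exact Finset.sum_congr rfl fun k hk => h k (by have := Finset.mem_range.1 hk; omega)

/-- The derivation acting on degree `k` as multiplication by `k`. -/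
def euler : A →ₗ[ℝ] A := ∑ k ∈ Finset.range (n + 1), (k : ℝ) • G.part k

theorem euler_apply (x : A) : G.euler x = ∑ k ∈ Finset.range (n + 1), (k : ℝ) • G.part k x := by
  simp [euler]

theorem part_euler (m : ℕ) (x : A) : G.part m (G.euler x) = (m : ℝ) • G.part m x := by
  by_cases hm : m ≤ n
  · rw [euler_apply, map_sum, Finset.sum_eq_single m]
    · rw [map_smul, G.part_part, if_pos rfl]
    · intro k _ hk
      rw [map_smul, G.part_part, if_neg hk.symm, smul_zero]
    · intro h
      exact absurd (Finset.mem_range.2 (by omega)) h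
  · rw [G.part_of_lt (by omega), G.part_of_lt (by omega), smul_zero]

theorem euler_mul (x y : A) : G.euler (x * y) = G.euler x * y + x * G.euler y := by
  refine G.ext_part fun m _ => ?_
  rw [part_euler, map_add, G.part_mul, G.part_mul, G.part_mul, ← Finset.sum_add_distrib,
    Finset.smul_sum]
  refine Finset.sum_congr rfl fun ij hij => ?_
  rw [part_euler, part_euler, smul_mul_assoc, mul_smul_comm, ← add_smul,
    ← Finset.HasAntidiagonal.mem_antidiagonal.1 hij]
  push_cast
  rfl

theorem euler_one : G.euler 1 = 0 := by
  have := G.euler_mul 1 1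
  simpa using this

/-- The Euler derivation kills `1` and acts on degree `k` by the nonzero scalar `k`. -/
theorem part_one {k : ℕ} (hk : k ≠ 0) : G.part k 1 = 0 := by
  have := G.part_euler k 1
  rw [euler_one, map_zero] at this
  exact (smul_eq_zero.1 this.symm).resolve_left (by exact_mod_cast hk)

theorem part_zero_one : G.part 0 1 = 1 := by
  conv_rhs => rw [← G.sum_part 1]
  rw [Finset.sum_eq_single 0]
  · exact fun k _ hk => G.part_one hk
  · simp

/-- The elements without components of degree less than `m`. -/
def filt (m : ℕ) : Submodule ℝ A where
  carrier := {x | ∀ k < m, G.part k x = 0}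
  zero_mem' _ _ := map_zero _
  add_mem' := fun hx hy k hk => by rw [map_add, hx k hk, hy k hk, add_zero]
  smul_mem' := fun c x hx k hk => by rw [map_smul, hx k hk, smul_zero]

theorem filt_mono {m m' : ℕ} (h : m ≤ m') : G.filt m' ≤ G.filt m :=
  fun _ hx k hk => hx k (hk.trans_le h)

theorem mul_mem_filt {i j : ℕ} {x y : A} (hx : x ∈ G.filt i) (hy : y ∈ G.filt j) :
    x * y ∈ G.filt (i + j) := by
  intro k hk
  rw [G.part_mul]
  refine Finset.sum_eq_zero fun ab hab => ?_
  have := Finset.HasAntidiagonal.mem_antidiagonal.1 hab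
  rcases lt_or_ge ab.1 i with h | h
  · rw [hx _ h, zero_mul]
  · rw [hy _ (by omega), mul_zero]

theorem eq_zero_of_mem_filt {x : A} (hx : x ∈ G.filt (n + 1)) : x = 0 :=
  G.ext_part fun k hk => by rw [hx k (by omega), map_zero]

theorem mem_filt_zero (x : A) : x ∈ G.filt 0 := fun k hk => absurd hk (by omega)

theorem pow_mem_filt {x : A} (hx : x ∈ G.filt 1) (k : ℕ) : x ^ k ∈ G.filt k := by
  induction k with
  | zero => exact G.mem_filt_zero _
  | succ k ih => rw [pow_succ]; exact G.mul_mem_filt ih hx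

theorem pow_eq_zero {x : A} (hx : x ∈ G.filt 1) : x ^ (n + 1) = 0 :=
  G.eq_zero_of_mem_filt (G.pow_mem_filt hx _)

theorem euler_mem_filt {m : ℕ} {x : A} (hx : x ∈ G.filt m) : G.euler x ∈ G.filt m :=
  fun k hk => by rw [part_euler, hx k hk, smul_zero]

/-- A graded Lie subalgebra in positive degrees. -/
structure IsLie (L : Submodule ℝ A) : Prop where
  bracket_mem : ∀ x ∈ L, ∀ y ∈ L, x * y - y * x ∈ L
  part_mem : ∀ k, ∀ x ∈ L, G.part k x ∈ L
  le_filt : L ≤ G.filt 1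

variable {G} {L : Submodule ℝ A}

theorem IsLie.euler_mem (hL : G.IsLie L) {x : A} (hx : x ∈ L) : G.euler x ∈ L := by
  rw [euler_apply]
  exact L.sum_mem fun k _ => L.smul_mem _ (hL.part_mem k x hx)

variable (G) in
/-- The logarithmic derivative of an exponential is the derivative of the exponent, up to
brackets. -/
theorem log_euler_sub_mem {a : A} (ha : a ∈ G.filt 1) (M : Submodule ℝ A)
    (h1 : a * G.euler a - G.euler a * a ∈ M) (hM : ∀ m ∈ M, a * m - m * a ∈ M) :
    nexp n (-a) * G.euler (nexp n a) - G.euler a ∈ M := by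
  set l : A →ₐ[ℝ] Module.End ℝ A := Algebra.lmul ℝ A with hl
  have hexp : ∀ b : A, nexp n (l b) = l (nexp n b) := fun b => by simp [nexp, map_sum]
  have hcomm : l a * G.euler - G.euler * l a = l (-G.euler a) := by
    ext z
    simp [hl, G.euler_mul]
  have hl1 : ∀ x y : A, l x * l y - l y * l x = l (x * y - y * x) := fun x y => by simp
  -- The conjugation formula is used in the endomorphism algebra, on the Euler derivation itself:
  -- its commutator with left multiplication by `a` is left multiplication by minus the Euler
  -- derivative of `a`. Evaluating at `1`, where the derivation vanishes, gives the claim.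
  have := nexp_conj_mem (b := l a) (n := n) (by rw [← map_pow, G.pow_eq_zero ha, map_zero])
    (M.map l.toLinearMap) G.euler
    (by
      rw [hcomm, hl1]
      refine Submodule.mem_map_of_mem (f := l.toLinearMap) ?_
      rw [← M.neg_mem_iff]
      convert h1 using 1
      noncomm_ring)
    (by
      rintro _ ⟨m, hm, rfl⟩
      exact ⟨_, hM m hm, (hl1 a m).symm⟩)
  obtain ⟨m, hm, hm'⟩ := this
  rw [hcomm, ← map_neg, hexp, hexp] at hm'
  have h2 : m * 1 = nexp n (-a) * G.euler (nexp n a * 1) - G.euler 1 + (-G.euler a) * 1 :=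
    congrArg (fun f : Module.End ℝ A => f 1) hm'
  rw [mul_one, mul_one, mul_one, G.euler_one, sub_zero] at h2
  rw [sub_eq_add_neg, ← h2]
  exact hm

theorem IsLie.log_euler_mem (hL : G.IsLie L) {a : A} (ha : a ∈ L) :
    nexp n (-a) * G.euler (nexp n a) ∈ L := by
  have := log_euler_sub_mem G (hL.le_filt ha) L (hL.bracket_mem _ ha _ (hL.euler_mem ha))
    (fun m hm => hL.bracket_mem _ ha _ hm)
  simpa using L.add_mem this (hL.euler_mem ha)

/-- Degree by degree. If `z` agrees with a Lie element `w` up to degree `m`, the brackets separating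
the logarithmic derivative from `D z` are Lie up to degree `m + 1`, because the error `z - w` is
only bracketed with elements of positive degree. So the degree `m + 1` part of `D z`, which is `(m +
1)` times that of `z`, is Lie. -/
theorem IsLie.mem_of_log_euler_mem (hL : G.IsLie L) {z : A} (hz : z ∈ G.filt 1)
    (h : nexp n (-z) * G.euler (nexp n z) ∈ L) : z ∈ L := by
  have key : ∀ m, ∃ w ∈ L, z - w ∈ G.filt (m + 1) := by
    intro m
    induction m with
    | zero => exact ⟨0, L.zero_mem, by simpa using hz⟩
    | succ m ih =>
      obtain ⟨w, hw, hzw⟩ := ih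
      set r := z - w with hr
      have hzr : z = w + r := by rw [hr]; abel
      have hw1 := hL.le_filt hw
      have hbr : ∀ {x y : A}, x ∈ G.filt 1 → y ∈ G.filt (m + 1) →
          x * y - y * x ∈ G.filt (m + 1 + 1) := fun hx hy =>
        (G.filt _).sub_mem (by rw [add_comm (m + 1) 1]; exact G.mul_mem_filt hx hy)
          (G.mul_mem_filt hy hx)
      have hM : ∀ x ∈ L ⊔ G.filt (m + 1 + 1), z * x - x * z ∈ L ⊔ G.filt (m + 1 + 1) := by
        intro x hx
        obtain ⟨y, hy, f, hf, rfl⟩ := Submodule.mem_sup.1 hx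
        have e : z * (y + f) - (y + f) * z =
            (w * y - y * w) + (-(y * r - r * y) + (z * f - f * z)) := by
          rw [hzr]; noncomm_ring
        rw [e]
        refine Submodule.add_mem_sup (hL.bracket_mem _ hw _ hy) ((G.filt _).add_mem
          ((G.filt _).neg_mem (hbr (hL.le_filt hy) hzw)) (hbr hz ?_))
        exact G.filt_mono (by omega) hf
      have hdiff := log_euler_sub_mem G hz (L ⊔ G.filt (m + 1 + 1)) (by
        have e : z * G.euler z - G.euler z * z = (w * G.euler w - G.euler w * w) +
            ((z * G.euler r - G.euler r * z) + -(G.euler w * r - r * G.euler w)) := by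
          rw [hzr, map_add]; noncomm_ring
        rw [e]
        exact Submodule.add_mem_sup (hL.bracket_mem _ hw _ (hL.euler_mem hw))
          ((G.filt _).add_mem (hbr hz (G.euler_mem_filt hzw))
            ((G.filt _).neg_mem (hbr (G.euler_mem_filt hw1) hzw)))) hM
      have heul : G.euler z ∈ L ⊔ G.filt (m + 1 + 1) := by
        have := Submodule.sub_mem _ (Submodule.mem_sup_left h) hdiff
        simpa using this
      obtain ⟨y, hy, f, hf, hyf⟩ := Submodule.mem_sup.1 heul
      have hpart : G.part (m + 1) z ∈ L := by
        have h1 : ((m + 1 : ℕ) : ℝ) • G.part (m + 1) z = G.part (m + 1) y := by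
          rw [← G.part_euler, ← hyf, map_add, hf (m + 1) (by omega), add_zero]
        have h2 : ((m + 1 : ℕ) : ℝ) ≠ 0 := by positivity
        rw [← inv_smul_smul₀ h2 (G.part (m + 1) z), h1]
        exact L.smul_mem _ (hL.part_mem _ _ hy)
      -- Only the component of degree `m + 1` of the approximation is corrected.
      refine ⟨w - G.part (m + 1) w + G.part (m + 1) z,
        L.add_mem (L.sub_mem hw (hL.part_mem _ _ hw)) hpart, fun k hk => ?_⟩
      have e : z - (w - G.part (m + 1) w + G.part (m + 1) z) = r - G.part (m + 1) r := by
        rw [hr, map_sub]; abel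
      rw [e, map_sub, G.part_part]
      rcases Nat.lt_succ_iff_lt_or_eq.1 hk with h | rfl
      · rw [if_neg h.ne, sub_zero, hzw k h]
      · rw [if_pos rfl, sub_self]
  obtain ⟨w, hw, hzw⟩ := key n
  rwa [sub_eq_zero.1 (G.eq_zero_of_mem_filt hzw)]

/-- A form of the Baker–Campbell–Hausdorff theorem. -/
theorem IsLie.mem_of_nexp_eq (hL : G.IsLie L) {a b z : A} (ha : a ∈ L) (hb : b ∈ L)
    (hz : z ∈ G.filt 1) (h : nexp n z = nexp n (-a) * nexp n b) : z ∈ L := by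
  have ha0 := G.pow_eq_zero (hL.le_filt ha)
  have hb0 := G.pow_eq_zero (hL.le_filt hb)
  have hinv : nexp n (-z) = nexp n (-b) * nexp n a := by
    refine left_inv_eq_right_inv (nexp_neg_mul_nexp (G.pow_eq_zero hz)) ?_
    rw [h, mul_assoc, ← mul_assoc (nexp n b), nexp_mul_nexp_neg hb0, one_mul,
      nexp_neg_mul_nexp ha0]
  refine hL.mem_of_log_euler_mem hz ?_
  -- The logarithmic derivative of a product is the conjugate of that of the first factor plus that
  -- of the second. Both factors are exponentials of Lie elements, and conjugation by `exp b`
  -- preserves `L`.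
  have e : nexp n (-z) * G.euler (nexp n z) =
      nexp n (-b) * (nexp n a * G.euler (nexp n (-a))) * nexp n b +
        nexp n (-b) * G.euler (nexp n b) := by
    rw [hinv, h, G.euler_mul]
    have : nexp n (-b) * nexp n a * (nexp n (-a) * G.euler (nexp n b)) =
        nexp n (-b) * (nexp n a * nexp n (-a)) * G.euler (nexp n b) := by noncomm_ring
    rw [mul_add, this, nexp_mul_nexp_neg ha0, mul_one]
    noncomm_ring
  rw [e]
  refine L.add_mem ?_ (hL.log_euler_mem hb)
  have hx : nexp n a * G.euler (nexp n (-a)) ∈ L := by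
    have := hL.log_euler_mem (L.neg_mem ha)
    rwa [neg_neg] at this
  set x := nexp n a * G.euler (nexp n (-a))
  have hbx := hL.bracket_mem _ hb _ hx
  have := nexp_conj_mem hb0 L x (hL.bracket_mem _ hb _ hbx) (fun m hm => hL.bracket_mem _ hb _ hm)
  have h2 := L.add_mem (L.sub_mem this hbx) hx
  simpa using h2

end TruncGrading

end RoughFlow

namespace RoughFlow

/-! ### The grading of the truncated tensor algebra -/

section Grading

variable {V : Type*} [NormedAddCommGroup V] [NormedSpace ℝ V]

/-- The homogeneous components of the tensor algebra. -/
abbrev homog (V : Type*) [NormedAddCommGroup V] [NormedSpace ℝ V] (k : ℕ) :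
    Submodule ℝ (TensorAlgebra ℝ V) :=
  LinearMap.range (TensorAlgebra.ι ℝ : V →ₗ[ℝ] TensorAlgebra ℝ V) ^ k

/-- `algProj` as a linear map. -/
def algProjL (k : ℕ) : TensorAlgebra ℝ V →ₗ[ℝ] TensorAlgebra ℝ V where
  toFun := algProj k
  map_add' x y := map_add (GradedRing.proj (homog V) k) x y
  map_smul' c x := by
    simp only [algProj, GradedRing.proj_apply, DirectSum.decompose_smul, RingHom.id_apply]
    rfl

theorem algProjL_apply (k : ℕ) (a : TensorAlgebra ℝ V) : algProjL k a = algProj k a := rfl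

theorem algProj_mem (k : ℕ) (a : TensorAlgebra ℝ V) : algProj k a ∈ homog V k :=
  SetLike.coe_mem (DirectSum.decompose (homog V) a k)

theorem algProj_of_mem {j : ℕ} {a : TensorAlgebra ℝ V} (ha : a ∈ homog V j) (k : ℕ) :
    algProj k a = if k = j then a else 0 := by
  unfold algProj
  split_ifs with h
  · subst h
    rw [GradedRing.proj_apply]
    exact DirectSum.decompose_of_mem_same (homog V) ha
  · rw [GradedRing.proj_apply]
    exact DirectSum.decompose_of_mem_ne (homog V) ha (Ne.symm h)

theorem algProj_algProj (j k : ℕ) (a : TensorAlgebra ℝ V) :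
    algProj j (algProj k a) = if j = k then algProj k a else 0 :=
  algProj_of_mem (algProj_mem k a) j

theorem homog_induction {p : TensorAlgebra ℝ V → Prop} (h : ∀ k, ∀ a ∈ homog V k, p a)
    (hadd : ∀ a b, p a → p b → p (a + b)) (a : TensorAlgebra ℝ V) : p a :=
  DirectSum.Decomposition.inductionOn (homog V) (h 0 0 (Submodule.zero_mem _))
    (fun m => h _ m m.2) hadd a

theorem algProj_mul (m : ℕ) (a b : TensorAlgebra ℝ V) : algProj m (a * b) =
    ∑ ij ∈ Finset.HasAntidiagonal.antidiagonal m, algProj ij.1 a * algProj ij.2 b := by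
  simp only [← algProjL_apply]
  induction a using homog_induction with
  | h i a ha =>
    induction b using homog_induction with
    | h j b hb =>
      have hab : a * b ∈ homog V (i + j) := by
        rw [homog, pow_add]; exact Submodule.mul_mem_mul ha hb
      simp only [algProjL_apply, algProj_of_mem ha, algProj_of_mem hb, algProj_of_mem hab]
      by_cases hm : m = i + j
      · rw [if_pos hm, Finset.sum_eq_single (i, j)]
        · simp
        · rintro ⟨k, l⟩ hkl hne
          by_cases hk : k = i
          · rw [if_neg (c := l = j), mul_zero]
            rintro rfl
            exact hne (by rw [hk])
          · simp [hk]
        · intro h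
          exact absurd (Finset.HasAntidiagonal.mem_antidiagonal.2 hm.symm) h
      · rw [if_neg hm, eq_comm]
        refine Finset.sum_eq_zero fun kl hkl => ?_
        have := Finset.HasAntidiagonal.mem_antidiagonal.1 hkl
        by_cases hk : kl.1 = i
        · rw [if_neg (c := kl.2 = j), mul_zero]
          omega
        · simp [hk]
    | hadd b c hb hc => simp only [mul_add, map_add, hb, hc, Finset.sum_add_distrib]
  | hadd b c hb hc => simp only [add_mul, map_add, hb, hc, Finset.sum_add_distrib]

variable {n : ℕ} (ν : TensorNorm n V)

theorem TensorNorm.algProj_eq_zero {k : ℕ} (hk : n < k) (a : TensorAlgebra ℝ V) :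
    ν.toSeminorm (algProj k a) = 0 := by
  refine (ν.eq_zero_iff' _).2 fun j hj => ?_
  rw [algProj_algProj, if_neg (by omega)]

/-- `toTrunc` as a linear map. -/
def toTruncL : TensorAlgebra ℝ V →ₗ[ℝ] TruncTensor ν where
  toFun := toTrunc ν
  map_add' a b := Completion.coe_add (α := AlgTensor ν) a b
  map_smul' c a := Completion.coe_smul (X := AlgTensor ν) c a

theorem toTruncL_apply (a : TensorAlgebra ℝ V) : toTruncL ν a = toTrunc ν a := rfl

theorem denseRange_toTruncL : DenseRange (toTruncL ν) :=
  Completion.denseRange_coe (α := AlgTensor ν)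

theorem norm_toTrunc (a : TensorAlgebra ℝ V) : ‖toTrunc ν a‖ = ν.toSeminorm a :=
  Completion.norm_coe (E := AlgTensor ν) a

theorem norm_toTruncL (a : TensorAlgebra ℝ V) : ‖toTruncL ν a‖ = ν.toSeminorm a :=
  norm_toTrunc ν a

theorem toTrunc_mul (a b : TensorAlgebra ℝ V) :
    toTrunc ν (a * b) = toTrunc ν a * toTrunc ν b :=
  Completion.coe_mul (α := AlgTensor ν) a b

theorem toTrunc_one : toTrunc ν 1 = 1 := Completion.coe_one (AlgTensor ν)

theorem exists_norm_algProj_le (k : ℕ) : ∃ C, ∀ a : TensorAlgebra ℝ V,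
    ‖(toTruncL ν ∘ₗ algProjL k) a‖ ≤ C * ‖toTruncL ν a‖ := by
  obtain ⟨C, hC⟩ := ν.proj_bounded' k
  refine ⟨C, fun a => ?_⟩
  rw [LinearMap.comp_apply, norm_toTruncL, norm_toTruncL]
  exact hC a

/-- The projection `π_k` as a continuous linear map. -/
def projL (k : ℕ) : TruncTensor ν →L[ℝ] TruncTensor ν :=
  (toTruncL ν ∘ₗ algProjL k).extendOfNorm (toTruncL ν)

theorem projL_toTrunc (k : ℕ) (a : TensorAlgebra ℝ V) :
    projL ν k (toTrunc ν a) = toTrunc ν (algProj k a) :=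
  LinearMap.extendOfNorm_eq (denseRange_toTruncL ν) (exists_norm_algProj_le ν k) a

theorem proj_eq_projL (k : ℕ) : proj ν k = projL ν k := by
  refine Completion.map_unique (α := AlgTensor ν) (β := AlgTensor ν) (f := fun a : AlgTensor ν =>
    (show AlgTensor ν from algProj k a)) (projL ν k).uniformContinuous fun a => ?_
  exact (projL_toTrunc ν k a).symm

theorem trunc_induction {p : TruncTensor ν → Prop} (hp : IsClosed {x | p x})
    (h : ∀ a, p (toTrunc ν a)) (x : TruncTensor ν) : p x :=
  (denseRange_toTruncL ν).induction_on x hp h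

/-- Components of degree larger than `n` have seminorm zero and so disappear in the completion. -/
theorem sum_toTrunc_algProj (a : TensorAlgebra ℝ V) :
    ∑ k ∈ Finset.range (n + 1), toTrunc ν (algProj k a) = toTrunc ν a := by
  simp only [← toTruncL_apply, ← algProjL_apply]
  induction a using homog_induction with
  | h k a ha =>
    simp only [algProjL_apply, algProj_of_mem ha]
    by_cases hk : k ≤ n
    · rw [Finset.sum_eq_single k]
      · simp
      · intro j _ hj; simp [hj]
      · intro h; exact absurd (Finset.mem_range.2 (by omega)) h
    · rw [Finset.sum_eq_zero, eq_comm, ← norm_le_zero_iff, norm_toTruncL]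
      · have := ν.algProj_eq_zero (show n < k by omega) a
        rw [algProj_of_mem ha, if_pos rfl] at this
        exact this.le
      · intro j hj
        have := Finset.mem_range.1 hj
        rw [if_neg (by omega), map_zero]
  | hadd a b ha hb => simp only [map_add, Finset.sum_add_distrib, ha, hb]

/-- The grading of `T^n(V)`. -/
def grading : TruncGrading n (TruncTensor ν) where
  part k := (projL ν k).toLinearMap
  sum_part x := by
    simp only [ContinuousLinearMap.coe_coe]
    refine trunc_induction ν (p := fun x => ∑ k ∈ Finset.range (n + 1), projL ν k x = x)
      (isClosed_eq (by fun_prop) continuous_id) (fun a => ?_) x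
    simp only [projL_toTrunc]
    exact sum_toTrunc_algProj ν a
  part_part j k x := by
    simp only [ContinuousLinearMap.coe_coe]
    refine trunc_induction ν
      (p := fun x => projL ν j (projL ν k x) = if j = k then projL ν k x else 0)
      (isClosed_eq (by fun_prop) (by split_ifs <;> fun_prop)) (fun a => ?_) x
    simp only [projL_toTrunc, algProj_algProj]
    split_ifs
    · rfl
    · exact map_zero (toTruncL ν)
  part_mul m x y := by
    simp only [ContinuousLinearMap.coe_coe]
    refine trunc_induction ν (p := fun x => projL ν m (x * y) = ∑ ij ∈
      Finset.HasAntidiagonal.antidiagonal m, projL ν ij.1 x * projL ν ij.2 y)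
      (isClosed_eq (by fun_prop) (by fun_prop)) (fun a => ?_) x
    refine trunc_induction ν (p := fun y => projL ν m (toTrunc ν a * y) = ∑ ij ∈
      Finset.HasAntidiagonal.antidiagonal m, projL ν ij.1 (toTrunc ν a) * projL ν ij.2 y)
      (isClosed_eq (by fun_prop) (by fun_prop)) (fun b => ?_) y
    rw [← toTrunc_mul]
    simp only [projL_toTrunc, algProj_mul, ← toTrunc_mul]
    exact map_sum (toTruncL ν) _ _

/-! ### The closed Lie algebra -/

/-- The Lie subalgebra of the tensor algebra generated by `V`, as a subspace. -/
def algLie (V : Type*) [NormedAddCommGroup V] [NormedSpace ℝ V] :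
    Submodule ℝ (TensorAlgebra ℝ V) :=
  sInf {M | (∀ v : V, TensorAlgebra.ι ℝ v ∈ M) ∧ ∀ a ∈ M, ∀ b ∈ M, a * b - b * a ∈ M}

theorem algLie_le {M : Submodule ℝ (TensorAlgebra ℝ V)}
    (hι : ∀ v : V, TensorAlgebra.ι ℝ v ∈ M)
    (hM : ∀ a ∈ M, ∀ b ∈ M, a * b - b * a ∈ M) : algLie V ≤ M :=
  sInf_le ⟨hι, hM⟩

theorem ι_mem_algLie (v : V) : TensorAlgebra.ι ℝ v ∈ algLie V :=
  Submodule.mem_sInf.2 fun _ hM => hM.1 v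

theorem bracket_mem_algLie {a b : TensorAlgebra ℝ V} (ha : a ∈ algLie V) (hb : b ∈ algLie V) :
    a * b - b * a ∈ algLie V :=
  Submodule.mem_sInf.2 fun M hM =>
    hM.2 a (Submodule.mem_sInf.1 ha M hM) b (Submodule.mem_sInf.1 hb M hM)

/-- Reduces statements about the closed Lie algebra to the uncompleted tensor algebra, where the
differential operators are defined, plus a closedness argument. -/
theorem lieElements_eq :
    lieElements ν = closure (toTrunc ν '' (algLie V : Set (TensorAlgebra ℝ V))) := by
  unfold lieElements
  congr 1
  let _ : LieRing (TruncTensor ν) := LieRing.ofAssociativeRing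
  apply Set.Subset.antisymm
  · let M : LieSubalgebra ℝ (TruncTensor ν) :=
      { (algLie V).map (toTruncL ν) with
        lie_mem' := by
          rintro _ _ ⟨a, ha, rfl⟩ ⟨b, hb, rfl⟩
          refine ⟨a * b - b * a, bracket_mem_algLie ha hb, ?_⟩
          rw [map_sub, toTruncL_apply, toTruncL_apply, toTrunc_mul, toTrunc_mul]
          rfl }
    have : LieSubalgebra.lieSpan ℝ (TruncTensor ν)
        (Set.range fun v : V => toTrunc ν (TensorAlgebra.ι ℝ v)) ≤ M := by
      refine LieSubalgebra.lieSpan_le.2 ?_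
      rintro _ ⟨v, rfl⟩
      exact ⟨_, ι_mem_algLie v, rfl⟩
    exact this
  · rintro _ ⟨a, ha, rfl⟩
    have := algLie_le (M := (LieSubalgebra.lieSpan ℝ (TruncTensor ν)
        (Set.range fun v : V => toTrunc ν (TensorAlgebra.ι ℝ v))).toSubmodule.comap (toTruncL ν))
      (fun v => LieSubalgebra.subset_lieSpan ⟨v, rfl⟩)
      (fun a ha b hb => by
        rw [Submodule.mem_comap, map_sub, toTruncL_apply, toTruncL_apply, toTrunc_mul,
          toTrunc_mul]
        exact LieSubalgebra.lie_mem _ ha hb)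
    exact this ha

/-- The closed Lie algebra `g^n(V)` as a subspace. -/
def closedLie : Submodule ℝ (TruncTensor ν) :=
  ((algLie V).map (toTruncL ν)).topologicalClosure

theorem coe_closedLie : (closedLie ν : Set (TruncTensor ν)) = lieElements ν := by
  rw [lieElements_eq]; rfl

theorem closedLie_induction {p : TruncTensor ν → Prop} (hp : IsClosed {x | p x})
    (h : ∀ a ∈ algLie V, p (toTrunc ν a)) {x : TruncTensor ν} (hx : x ∈ closedLie ν) : p x := by
  have : (closedLie ν : Set (TruncTensor ν)) ⊆ {x | p x} := by
    refine closure_minimal ?_ hp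
    rintro _ ⟨a, ha, rfl⟩
    exact h a ha
  exact this hx

theorem toTrunc_mem_closedLie {a : TensorAlgebra ℝ V} (ha : a ∈ algLie V) :
    toTrunc ν a ∈ closedLie ν :=
  Submodule.le_topologicalClosure _ (Submodule.mem_map_of_mem (f := toTruncL ν) ha)

theorem isClosed_closedLie : IsClosed (closedLie ν : Set (TruncTensor ν)) :=
  Submodule.isClosed_topologicalClosure _

theorem ι_mem_homog (v : V) : TensorAlgebra.ι ℝ v ∈ homog V 1 := by
  rw [homog, pow_one]; exact LinearMap.mem_range_self _ v

/-- Elements all of whose components are Lie form a subspace containing `V` and stable under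
brackets: after swapping one antidiagonal sum, a component of a bracket is a sum of brackets of
components. -/
theorem algProj_mem_algLie {a : TensorAlgebra ℝ V} (ha : a ∈ algLie V) (k : ℕ) :
    algProj k a ∈ algLie V := by
  have := algLie_le (V := V) (M := ⨅ k, (algLie V).comap (algProjL k))
    (fun v => by
      refine Submodule.mem_iInf _ |>.2 fun k => ?_
      rw [Submodule.mem_comap, algProjL_apply, algProj_of_mem (ι_mem_homog v)]
      split_ifs
      · exact ι_mem_algLie v
      · exact Submodule.zero_mem _)
    (fun a ha b hb => by
      rw [Submodule.mem_iInf] at ha hb ⊢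
      intro k
      rw [Submodule.mem_comap, map_sub, algProjL_apply, algProjL_apply, algProj_mul, algProj_mul,
        ← Finset.Nat.sum_antidiagonal_swap, ← Finset.sum_sub_distrib]
      exact Submodule.sum_mem _ fun ij _ => bracket_mem_algLie (ha ij.2) (hb ij.1))
  exact (Submodule.mem_iInf _).1 (this ha) k

theorem algProj_zero_of_mem_algLie {a : TensorAlgebra ℝ V} (ha : a ∈ algLie V) :
    algProj 0 a = 0 := by
  have := algLie_le (V := V) (M := LinearMap.ker (algProjL 0))
    (fun v => by
      rw [LinearMap.mem_ker, algProjL_apply, algProj_of_mem (ι_mem_homog v), if_neg (by omega)])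
    (fun a ha b hb => by
      rw [LinearMap.mem_ker, algProjL_apply] at *
      rw [← algProjL_apply, map_sub, algProjL_apply, algProjL_apply, algProj_mul, algProj_mul]
      simp [ha, hb])
  exact LinearMap.mem_ker.1 (this ha)

theorem isLie_closedLie : (grading ν).IsLie (closedLie ν) where
  bracket_mem x hx y hy := by
    refine closedLie_induction ν (p := fun x => x * y - y * x ∈ closedLie ν)
      ((isClosed_closedLie ν).preimage (by fun_prop)) (fun a ha => ?_) hx
    refine closedLie_induction ν (p := fun y => toTrunc ν a * y - y * toTrunc ν a ∈ closedLie ν)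
      ((isClosed_closedLie ν).preimage (by fun_prop)) (fun b hb => ?_) hy
    rw [← toTrunc_mul, ← toTrunc_mul, ← toTruncL_apply, ← toTruncL_apply, ← map_sub]
    exact toTrunc_mem_closedLie ν (bracket_mem_algLie ha hb)
  part_mem k x hx := by
    refine closedLie_induction ν (p := fun x => projL ν k x ∈ closedLie ν)
      ((isClosed_closedLie ν).preimage (by fun_prop)) (fun a ha => ?_) hx
    rw [projL_toTrunc]
    exact toTrunc_mem_closedLie ν (algProj_mem_algLie ha k)
  le_filt x hx k hk := by
    obtain rfl : k = 0 := by omega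
    refine closedLie_induction ν (p := fun x => projL ν 0 x = 0)
      (isClosed_eq (by fun_prop) continuous_const) (fun a ha => ?_) hx
    rw [projL_toTrunc, algProj_zero_of_mem_algLie ha]
    exact map_zero (toTruncL ν)

end Grading

/-! ### Increments of rough paths -/

section Increments

variable {V : Type*} [NormedAddCommGroup V] [NormedSpace ℝ V] {n : ℕ} {ν : TensorNorm n V}

theorem tlog_eq (a : TruncTensor ν) : tlog ν a = nlog n (a - 1) := rfl

theorem mem_groupElements {g : TruncTensor ν} (hg : g ∈ groupElements ν) :
    ∃ a ∈ closedLie ν, nexp n a = g := by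
  obtain ⟨a, ha, rfl⟩ := hg
  rw [← coe_closedLie] at ha
  exact ⟨a, ha, rfl⟩

theorem inverse_nexp {a : TruncTensor ν} (ha : a ∈ closedLie ν) :
    Ring.inverse (nexp n a) = nexp n (-a) := by
  have h0 := (grading ν).pow_eq_zero ((isLie_closedLie ν).le_filt ha)
  exact Ring.inverse_unit ⟨nexp n a, nexp n (-a), nexp_mul_nexp_neg h0, nexp_neg_mul_nexp h0⟩

theorem nlog_mem_filt {x : TruncTensor ν} (hx : x ∈ (grading ν).filt 1) :
    nlog n x ∈ (grading ν).filt 1 :=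
  Submodule.sum_mem _ fun k hk => Submodule.smul_mem _ _
    ((grading ν).filt_mono (Finset.mem_Icc.1 hk).1 ((grading ν).pow_mem_filt hx k))

theorem nexp_sub_one_mem_filt {a : TruncTensor ν} (ha : a ∈ (grading ν).filt 1) :
    nexp n a - 1 ∈ (grading ν).filt 1 := by
  rw [nexp, Finset.sum_range_succ']
  simp only [pow_zero, Nat.factorial_zero, Nat.cast_one, inv_one, one_smul, add_sub_cancel_right]
  exact Submodule.sum_mem _ fun k _ => Submodule.smul_mem _ _
    ((grading ν).filt_mono (by omega) ((grading ν).pow_mem_filt ha (k + 1)))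

/-- The increments of a path with values in the group `G^n(V)` belong to that group. -/
theorem tlog_incr {X : ℝ → TruncTensor ν} {s t : ℝ} (hs : X s ∈ groupElements ν)
    (ht : X t ∈ groupElements ν) : incr X t s - 1 ∈ (grading ν).filt 1 ∧
      tlog ν (incr X t s) ∈ closedLie ν ∧ nexp n (tlog ν (incr X t s)) = incr X t s := by
  obtain ⟨a, ha, hXs⟩ := mem_groupElements hs
  obtain ⟨b, hb, hXt⟩ := mem_groupElements ht
  have hL := isLie_closedLie ν
  have he : incr X t s = nexp n (-a) * nexp n b := by
    rw [incr, ← hXs, ← hXt, inverse_nexp ha]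
  have h1 : incr X t s - 1 ∈ (grading ν).filt 1 := by
    have e : incr X t s - 1 = (nexp n (-a) - 1) * nexp n b + (nexp n b - 1) := by
      rw [he, sub_mul, one_mul]; abel
    rw [e]
    exact Submodule.add_mem _ ((grading ν).mul_mem_filt (i := 1) (j := 0) (nexp_sub_one_mem_filt
      (hL.le_filt ((closedLie ν).neg_mem ha))) ((grading ν).mem_filt_zero _))
      (nexp_sub_one_mem_filt (hL.le_filt hb))
  have h2 : nexp n (tlog ν (incr X t s)) = incr X t s := by
    rw [tlog_eq, nexp_nlog ((grading ν).pow_eq_zero h1)]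
    abel
  exact ⟨h1, hL.mem_of_nexp_eq ha hb (nlog_mem_filt h1) (h2.trans he), h2⟩

/-- Chen's relation. -/
theorem incr_mul_incr {X : ℝ → TruncTensor ν} {s u t : ℝ} (hu : X u ∈ groupElements ν) :
    incr X u s * incr X t u = incr X t s := by
  obtain ⟨b, hb, hXu⟩ := mem_groupElements hu
  have h0 := (grading ν).pow_eq_zero ((isLie_closedLie ν).le_filt hb)
  rw [incr, incr, incr, ← hXu, inverse_nexp hb, mul_assoc, ← mul_assoc (nexp n b),
    nexp_mul_nexp_neg h0, one_mul]

theorem incr_self {X : ℝ → TruncTensor ν} {s : ℝ} (hs : X s ∈ groupElements ν) :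
    incr X s s = 1 := by
  obtain ⟨b, hb, hXs⟩ := mem_groupElements hs
  have h0 := (grading ν).pow_eq_zero ((isLie_closedLie ν).le_filt hb)
  rw [incr, ← hXs, inverse_nexp hb, nexp_neg_mul_nexp h0]

end Increments

end RoughFlow

namespace RoughFlow

/-! ### Differential operators attached to tensors -/

section Fields

variable {U : Type*} [NormedAddCommGroup U] [NormedSpace ℝ U]
  {V : Type*} [NormedAddCommGroup V] [NormedSpace ℝ V] {N : ℕ} (F : FieldMap N V U)

/-- The operator `F^⊗(a)` on sequences of functions. -/
def fieldHom : TensorAlgebra ℝ V →ₐ[ℝ] Module.End ℝ (regular N U U) :=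
  TensorAlgebra.lift ℝ (fieldOp F U)

/-- The constant sequence of the identity of `U`. -/
def idSeq (N : ℕ) (U : Type*) [NormedAddCommGroup U] [NormedSpace ℝ U] : regular N U U :=
  ⟨fun _ => id, fun _ _ => contDiff_id⟩

theorem algField_eq (a : TensorAlgebra ℝ V) : algField F a = (fieldHom F a (idSeq N U)).1 0 := rfl

theorem fieldHom_ι (v : V) (g : regular N U U) (k : ℕ) (x : U) :
    (fieldHom F (TensorAlgebra.ι ℝ v) g).1 k x =
      if k < N then fderiv ℝ (g.1 (k + 1)) x (F.toLinearMap v x) else 0 := by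
  rw [fieldHom, TensorAlgebra.lift_ι_apply]
  rfl

theorem algField_add (a b : TensorAlgebra ℝ V) :
    algField F (a + b) = algField F a + algField F b := by
  simp only [algField_eq, map_add]; rfl

theorem algField_smul (c : ℝ) (a : TensorAlgebra ℝ V) :
    algField F (c • a) = c • algField F a := by
  simp only [algField_eq, map_smul]; rfl

theorem algField_algebraMap (r : ℝ) (x : U) :
    algField F (algebraMap ℝ (TensorAlgebra ℝ V) r) x = r • x := by
  rw [algField_eq, AlgHom.commutes]
  rfl

/-- For homogeneous `a`, all the relevant entries of the sequence `F^⊗(a) Id` agree. -/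
theorem fieldHom_idSeq {m : ℕ} {a : TensorAlgebra ℝ V} (ha : a ∈ homog V m) :
    ∀ k ≤ N, (fieldHom F a (idSeq N U)).1 k = if k + m ≤ N then algField F a else 0 := by
  induction ha using Submodule.pow_induction_on_left' with
  | algebraMap r =>
    intro k hk
    rw [if_pos (by simpa using hk), algField_eq, AlgHom.commutes]
    rfl
  | add x y i hx hy ihx ihy =>
    intro k hk
    rw [map_add, algField_add]
    change (fieldHom F x (idSeq N U)).1 k + (fieldHom F y (idSeq N U)).1 k = _
    rw [ihx k hk, ihy k hk]
    split_ifs <;> simp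
  | mem_mul m hm i x hx ih =>
    obtain ⟨v, rfl⟩ := hm
    have h : ∀ k ≤ N, ∀ z, (fieldHom F (TensorAlgebra.ι ℝ v * x) (idSeq N U)).1 k z =
        if k + (i + 1) ≤ N then fderiv ℝ (algField F x) z (F.toLinearMap v z) else 0 := by
      intro k hk z
      rw [map_mul, Module.End.mul_apply, fieldHom_ι]
      by_cases hkN : k < N
      · rw [if_pos hkN, ih (k + 1) hkN]
        by_cases h1 : k + (i + 1) ≤ N
        · rw [if_pos h1, if_pos (by omega)]
        · rw [if_neg h1, if_neg (by omega)]
          simp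
      · rw [if_neg hkN, if_neg (by omega)]
    intro k hk
    ext z
    rw [h k hk z]
    by_cases h1 : k + (i + 1) ≤ N
    · have h0 := h 0 (Nat.zero_le _) z
      rw [if_pos (by omega)] at h0
      rw [if_pos h1, if_pos h1]
      exact h0.symm
    · rw [if_neg h1, if_neg h1]
      rfl

theorem algField_eq_zero {m : ℕ} (hm : N < m) {a : TensorAlgebra ℝ V} (ha : a ∈ homog V m) :
    algField F a = 0 := by
  have := fieldHom_idSeq F ha 0 (Nat.zero_le _)
  rwa [if_neg (by omega)] at this

/-- `algField` at a point, as a linear map. -/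
def algFieldL (x : U) : TensorAlgebra ℝ V →ₗ[ℝ] U where
  toFun a := algField F a x
  map_add' a b := by rw [algField_add]; rfl
  map_smul' c a := by rw [algField_smul]; rfl

theorem algField_eq_sum (a : TensorAlgebra ℝ V) :
    algField F a = fun x => ∑ k ∈ Finset.range (N + 1), algField F (algProj k a) x := by
  ext x
  change algFieldL F x a = ∑ k ∈ Finset.range (N + 1), algFieldL F x (algProjL k a)
  induction a using homog_induction with
  | h m a ha =>
    simp only [algProjL_apply, algProj_of_mem ha]
    by_cases hm : m ≤ N
    · rw [Finset.sum_eq_single m]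
      · simp
      · intro j _ hj; simp [hj]
      · intro h; exact absurd (Finset.mem_range.2 (by omega)) h
    · rw [Finset.sum_eq_zero]
      · exact congrFun (algField_eq_zero F (by omega) ha) x
      · intro j hj
        have := Finset.mem_range.1 hj
        rw [if_neg (by omega), map_zero]
  | hadd a b ha hb => simp only [map_add, Finset.sum_add_distrib, ha, hb]

/-- The elements acting as first order operators of degree `i`, that is, as derivations along a
vector field. -/
def firstOrder (i : ℕ) : Submodule ℝ (TensorAlgebra ℝ V) where
  carrier := {a | ∃ w : U → U, (i ≤ N → ContDiff ℝ (N + 1 - i : ℕ) w) ∧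
    ∀ (g : regular N U U) (k : ℕ), k + i ≤ N → ∀ x,
      (fieldHom F a g).1 k x = fderiv ℝ (g.1 (k + i)) x (w x)}
  zero_mem' := ⟨0, fun _ => contDiff_const, fun g k _ x => by
    rw [map_zero]; simp⟩
  add_mem' := by
    rintro a b ⟨w, hw, ha⟩ ⟨z, hz, hb⟩
    refine ⟨w + z, fun h => (hw h).add (hz h), fun g k hk x => ?_⟩
    rw [map_add, Pi.add_apply, map_add, ← ha g k hk, ← hb g k hk]
    rfl
  smul_mem' := by
    rintro c a ⟨w, hw, ha⟩
    refine ⟨c • w, fun h => (hw h).const_smul c, fun g k hk x => ?_⟩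
    rw [map_smul, Pi.smul_apply, map_smul, ← ha g k hk]
    rfl

theorem ι_mem_firstOrder (v : V) : TensorAlgebra.ι ℝ v ∈ firstOrder F 1 := by
  refine ⟨F.toLinearMap v, fun _ => by simpa using F.contDiff v, fun g k hk x => ?_⟩
  rw [fieldHom_ι, if_pos (by omega)]

/-- The second order parts of the two compositions cancel by symmetry of the second derivative,
leaving the derivation along the bracket of the two fields. -/
theorem bracket_mem_firstOrder {i j : ℕ} (hi : 1 ≤ i) (hj : 1 ≤ j) {a b : TensorAlgebra ℝ V}
    (ha : a ∈ firstOrder F i) (hb : b ∈ firstOrder F j) : a * b - b * a ∈ firstOrder F (i + j) := by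
  obtain ⟨w, hw, ha⟩ := ha
  obtain ⟨z, hz, hb⟩ := hb
  refine ⟨fun x => fderiv ℝ z x (w x) - fderiv ℝ w x (z x), fun hij => ?_, fun g k hk x => ?_⟩
  · have hw := hw (by omega)
    have hz := hz (by omega)
    -- Differentiating a field loses one derivative. Since `i, j ≥ 1`, both `N - i` and `N - j` are
    -- at least `N + 1 - (i + j)`.
    refine ContDiff.sub ?_ ?_
    · exact (hz.fderiv_right (m := (N + 1 - (i + j) : ℕ)) (by norm_cast; omega)).clm_apply
        (hw.of_le (by norm_cast; omega))
    · exact (hw.fderiv_right (m := (N + 1 - (i + j) : ℕ)) (by norm_cast; omega)).clm_apply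
        (hz.of_le (by norm_cast; omega))
  · have hw := hw (by omega)
    have hz := hz (by omega)
    set f := g.1 (k + (i + j)) with hf
    have hf2 : ContDiff ℝ 2 f := (g.2 _ hk).of_le (by norm_cast; omega)
    have hfd : DifferentiableAt ℝ (fderiv ℝ f) x :=
      (hf2.fderiv_right (m := 1) (by norm_num)).differentiable (by simp) x
    have hwd : DifferentiableAt ℝ w x := hw.differentiable (by norm_cast; omega) x
    have hzd : DifferentiableAt ℝ z x := hz.differentiable (by norm_cast; omega) x
    have e1 : (fieldHom F b g).1 (k + i) = fun y => fderiv ℝ f y (z y) := by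
      ext y
      rw [hb g (k + i) (by omega) y, add_assoc]
    have e2 : (fieldHom F a g).1 (k + j) = fun y => fderiv ℝ f y (w y) := by
      ext y
      rw [ha g (k + j) (by omega) y, add_assoc, add_comm j i]
    have hsymm : fderiv ℝ (fderiv ℝ f) x (w x) (z x) = fderiv ℝ (fderiv ℝ f) x (z x) (w x) :=
      (hf2.contDiffAt.isSymmSndFDerivAt (by simp)).eq _ _
    have h1 : (fieldHom F (a * b - b * a) g).1 k x =
        (fieldHom F a (fieldHom F b g)).1 k x - (fieldHom F b (fieldHom F a g)).1 k x := by
      rw [map_sub, map_mul, map_mul]; rfl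
    rw [h1, ha _ k (by omega) x, hb _ k (by omega) x, e1, e2, fderiv_clm_apply hfd hzd,
      fderiv_clm_apply hfd hwd]
    simp only [add_apply, ContinuousLinearMap.comp_apply, ContinuousLinearMap.flip_apply, map_sub]
    rw [hsymm]
    abel

theorem algProj_mem_firstOrder {a : TensorAlgebra ℝ V} (ha : a ∈ algLie V) {i : ℕ} (hi : 1 ≤ i) :
    algProj i a ∈ firstOrder F i := by
  have := algLie_le (V := V)
    -- Vanishing in degree zero is carried along so that only components of positive degree meet in
    -- a bracket.
    (M := LinearMap.ker (algProjL 0) ⊓ ⨅ i : ℕ, ⨅ _ : 1 ≤ i, (firstOrder F i).comap (algProjL i))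
    (fun v => by
      simp only [Submodule.mem_inf, Submodule.mem_iInf, Submodule.mem_comap, LinearMap.mem_ker,
        algProjL_apply, algProj_of_mem (ι_mem_homog v)]
      refine ⟨by simp, fun i _ => ?_⟩
      split_ifs with h
      · rw [h]; exact ι_mem_firstOrder F v
      · exact Submodule.zero_mem _)
    (fun a ha b hb => by
      simp only [Submodule.mem_inf, Submodule.mem_iInf, Submodule.mem_comap, LinearMap.mem_ker,
        map_sub, algProjL_apply] at *
      refine ⟨by simp [algProj_mul, ha.1, hb.1], fun m hm => ?_⟩
      rw [algProj_mul, algProj_mul,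
        ← Finset.Nat.sum_antidiagonal_swap (f := fun ij : ℕ × ℕ => algProj ij.1 b * algProj ij.2 a),
        ← Finset.sum_sub_distrib]
      refine Submodule.sum_mem _ fun ij hij => ?_
      obtain ⟨i, j⟩ := ij
      have hij := Finset.HasAntidiagonal.mem_antidiagonal.1 hij
      simp only [Prod.swap_prod_mk] at hij ⊢
      rcases Nat.eq_zero_or_pos i with rfl | hi
      · rw [ha.1]; simp
      rcases Nat.eq_zero_or_pos j with rfl | hj
      · rw [hb.1]; simp
      rw [← hij]
      exact bracket_mem_firstOrder F hi hj (ha.2 i hi) (hb.2 j hj))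
  have h := (Submodule.mem_inf.1 (this ha)).2
  simp only [Submodule.mem_iInf] at h
  exact h i hi

/-- A Lie component acts as a derivation along the field it defines on the identity, so composing
operators amounts to differentiating `F^⊗(e) Id` along that field. The condition `i + m ≤ N` keeps
the product below the truncation. -/
theorem algField_lie_mul {a e : TensorAlgebra ℝ V} (ha : a ∈ algLie V) {i m : ℕ}
    (he : e ∈ homog V m) (hN : i + m ≤ N) (x : U) :
    fderiv ℝ (algField F e) x (algField F (algProj i a) x) = algField F (algProj i a * e) x := by
  rcases Nat.eq_zero_or_pos i with rfl | hi
  · rw [algProj_zero_of_mem_algLie ha, zero_mul]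
    have : algField F (0 : TensorAlgebra ℝ V) x = 0 := map_zero (algFieldL F x)
    rw [this, map_zero]
  · obtain ⟨w, _, hw⟩ := algProj_mem_firstOrder F ha hi
    have h1 : algField F (algProj i a) x = w x := by
      rw [algField_eq, hw (idSeq N U) 0 (by omega) x]
      change fderiv ℝ id x (w x) = _
      simp
    have h2 : algField F (algProj i a * e) x = fderiv ℝ (algField F e) x (w x) := by
      rw [algField_eq, map_mul, Module.End.mul_apply, hw _ 0 (by omega) x, zero_add,
        fieldHom_idSeq F he i (by omega), if_pos hN]
    rw [h1, h2]

end Fields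

end RoughFlow

namespace RoughFlow

/-! ### Extension of the differential operators to completed tensors -/

section Extension

open Filter Topology

section SteinLip

variable {U E : Type*} [NormedAddCommGroup U] [NormedSpace ℝ U] [NormedAddCommGroup E]
  [NormedSpace ℝ E]

/-- For `m = 1` the Lipschitz bound on the derivative is the one assumed, transported through
isometries. For `m ≥ 2` it comes from the bound on the second derivative. -/
theorem SteinLip.fderiv_bounds {m : ℕ} {M : ℝ} {f : U → E} (hm : 1 ≤ m) (h : SteinLip m M f) :
    Differentiable ℝ f ∧ (∀ x, ‖f x‖ ≤ M) ∧ (∀ x, ‖fderiv ℝ f x‖ ≤ M) ∧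
      ∀ x y, ‖fderiv ℝ f x - fderiv ℝ f y‖ ≤ M * ‖x - y‖ := by
  obtain ⟨hc, hb, hl⟩ := h
  refine ⟨hc.differentiable (by norm_cast; omega), fun x => ?_, fun x => ?_, ?_⟩
  · simpa using hb 0 (by omega) x
  · simpa [norm_iteratedFDeriv_one] using hb 1 hm x
  · rcases hm.eq_or_lt with rfl | hm
    · intro x y
      refine le_trans (le_of_eq ?_) (hl x y)
      have e : ∀ z, iteratedFDeriv ℝ 1 f z = (continuousMultilinearCurryRightEquiv' ℝ 0 U E).symm
          (iteratedFDeriv ℝ 0 (fderiv ℝ f) z) := fun z => by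
        rw [iteratedFDeriv_succ_eq_comp_right]; rfl
      rw [← dist_eq_norm, ← dist_eq_norm, e, e]
      exact (((continuousMultilinearCurryRightEquiv' ℝ 0 U E).symm.dist_map _ _).trans
        ((continuousMultilinearCurryFin0 ℝ U (U →L[ℝ] E)).symm.dist_map _ _)).symm
    · intro x y
      have hd : Differentiable ℝ (fderiv ℝ f) :=
        (hc.fderiv_right (m := 1) (by norm_cast)).differentiable (by simp)
      refine convex_univ.norm_image_sub_le_of_norm_fderiv_le (fun z _ => hd z) (fun z _ => ?_)
        (Set.mem_univ y) (Set.mem_univ x)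
      rw [← norm_iteratedFDeriv_one, norm_iteratedFDeriv_fderiv]
      exact hb 2 hm z

end SteinLip

variable {U : Type*} [NormedAddCommGroup U] [NormedSpace ℝ U]
  {V : Type*} [NormedAddCommGroup V] [NormedSpace ℝ V] {N : ℕ} {ν : TensorNorm N V}
  {F : FieldMap N V U}

/-- Degree zero is not covered by the hypothesis: there a scalar acts as a homothety, which is
unbounded (hence the term in `‖x‖`) but has a constant derivative. In degree `1 ≤ k ≤ N` the
regularity index `N + 1 - k` is at least one. -/
theorem exists_homog_bound (hF : ExtendsContinuously ν F) {k : ℕ} (hk : k ≤ N) :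
    ∃ C ≥ 0, ∀ a ∈ homog V k, Differentiable ℝ (algField F a) ∧
      (∀ x, ‖algField F a x‖ ≤ C * ν.toSeminorm a * (1 + if k = 0 then ‖x‖ else 0)) ∧
      (∀ x, ‖fderiv ℝ (algField F a) x‖ ≤ C * ν.toSeminorm a) ∧
      ∀ x y, ‖fderiv ℝ (algField F a) x - fderiv ℝ (algField F a) y‖ ≤
        C * ν.toSeminorm a * ‖x - y‖ := by
  have hν : ∀ a, 0 ≤ ν.toSeminorm a := fun a => apply_nonneg _ _
  rcases Nat.eq_zero_or_pos k with rfl | hk0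
  · have h1 : 0 < ν.toSeminorm 1 := by
      refine lt_of_le_of_ne (hν 1) fun h => ?_
      have h2 := (ν.eq_zero_iff' 1).1 h.symm 0 (Nat.zero_le _)
      have h3 : (1 : TensorAlgebra ℝ V) ∈ homog V 0 := by
        rw [homog, pow_zero]; exact Submodule.one_le.1 le_rfl
      rw [algProj_of_mem h3, if_pos rfl] at h2
      have : algField F (1 : TensorAlgebra ℝ V) = id := by
        ext x; simpa using algField_algebraMap F 1 x
      have h4 := congrArg (TensorAlgebra.algebraMapInv (R := ℝ) (M := V)) h2
      simp at h4
    refine ⟨(ν.toSeminorm 1)⁻¹, by positivity, fun a ha => ?_⟩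
    rw [homog, pow_zero] at ha
    obtain ⟨r, rfl⟩ := Submodule.mem_one.1 ha
    have e : algField F (algebraMap ℝ (TensorAlgebra ℝ V) r) = fun x => r • x :=
      funext fun x => algField_algebraMap F r x
    have e2 : (ν.toSeminorm 1)⁻¹ * ν.toSeminorm (algebraMap ℝ (TensorAlgebra ℝ V) r) = ‖r‖ := by
      rw [Algebra.algebraMap_eq_smul_one, map_smul_eq_mul]
      field_simp
    have e3 : ∀ x, fderiv ℝ (fun x : U => r • x) x = r • ContinuousLinearMap.id ℝ U := fun x => by
      rw [fderiv_fun_const_smul differentiableAt_fun_id]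
      simp
    rw [e, e2]
    refine ⟨by fun_prop, fun x => ?_, fun x => ?_, fun x y => ?_⟩
    · rw [norm_smul, if_pos rfl]
      gcongr
      linarith
    · rw [e3, norm_smul]
      exact mul_le_of_le_one_right (norm_nonneg _) ContinuousLinearMap.norm_id_le
    · rw [e3, e3, sub_self, norm_zero]
      positivity
  · obtain ⟨C, hC⟩ := hF k (Finset.mem_Icc.2 ⟨hk0, hk⟩)
    refine ⟨|C|, abs_nonneg _, fun a ha => ?_⟩
    obtain ⟨h1, h2, h3, h4⟩ := (hC a ha).fderiv_bounds (by omega)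
    have hle : C * ν.toSeminorm a ≤ |C| * ν.toSeminorm a :=
      mul_le_mul_of_nonneg_right (le_abs_self C) (hν a)
    refine ⟨h1, fun x => ?_, fun x => (h3 x).trans hle, fun x y => (h4 x y).trans (by gcongr)⟩
    rw [if_neg (by omega), add_zero, mul_one]
    exact (h2 x).trans hle

theorem exists_algField_bound (hF : ExtendsContinuously ν F) :
    ∃ C ≥ 0, ∀ a, Differentiable ℝ (algField F a) ∧
      (∀ x, ‖algField F a x‖ ≤ C * ν.toSeminorm a * (1 + ‖x‖)) ∧
      (algProj 0 a = 0 → ∀ x, ‖algField F a x‖ ≤ C * ν.toSeminorm a) ∧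
      (∀ x, ‖fderiv ℝ (algField F a) x‖ ≤ C * ν.toSeminorm a) ∧
      ∀ x y, ‖fderiv ℝ (algField F a) x - fderiv ℝ (algField F a) y‖ ≤
        C * ν.toSeminorm a * ‖x - y‖ := by
  have hν : ∀ a, 0 ≤ ν.toSeminorm a := fun a => apply_nonneg _ _
  have H := fun k (hk : k ∈ Finset.range (N + 1)) =>
    exists_homog_bound hF (k := k) (by have := Finset.mem_range.1 hk; omega)
  choose! c hc0 hc using H
  choose P hP using ν.proj_bounded'
  have hPa : ∀ k ∈ Finset.range (N + 1), ∀ a,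
      c k * ν.toSeminorm (algProj k a) ≤ c k * |P k| * ν.toSeminorm a := by
    intro k hk a
    rw [mul_assoc]
    refine mul_le_mul_of_nonneg_left ((hP k a).trans ?_) (hc0 k hk)
    exact mul_le_mul_of_nonneg_right (le_abs_self _) (hν a)
  have hterm : ∀ k ∈ Finset.range (N + 1), 0 ≤ c k * |P k| := fun k hk =>
    mul_nonneg (hc0 k hk) (abs_nonneg _)
  refine ⟨∑ k ∈ Finset.range (N + 1), c k * |P k|, Finset.sum_nonneg hterm, fun a => ?_⟩
  have hd : ∀ k ∈ Finset.range (N + 1), Differentiable ℝ (algField F (algProj k a)) :=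
    fun k hk => (hc k hk _ (algProj_mem k a)).1
  have hfd : ∀ x, fderiv ℝ (algField F a) x =
      ∑ k ∈ Finset.range (N + 1), fderiv ℝ (algField F (algProj k a)) x := by
    intro x
    rw [algField_eq_sum]
    exact fderiv_fun_sum fun k hk => hd k hk x
  refine ⟨?_, fun x => ?_, fun h0 x => ?_, fun x => ?_, fun x y => ?_⟩
  · rw [algField_eq_sum]
    exact Differentiable.fun_sum hd
  · rw [algField_eq_sum, Finset.sum_mul, Finset.sum_mul]
    refine norm_sum_le_of_le _ fun k hk => ((hc k hk _ (algProj_mem k a)).2.1 x).trans ?_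
    have := hPa k hk a
    have h1 : (if k = 0 then ‖x‖ else 0) ≤ ‖x‖ := by split_ifs <;> simp
    have h2 : 0 ≤ (if k = 0 then ‖x‖ else 0) := by split_ifs <;> simp
    have := mul_nonneg (hterm k hk) (hν a)
    gcongr
  · rw [algField_eq_sum, Finset.sum_mul]
    refine norm_sum_le_of_le _ fun k hk => ?_
    rcases Nat.eq_zero_or_pos k with rfl | hk0
    · rw [h0]
      have : algField F (0 : TensorAlgebra ℝ V) x = 0 := map_zero (algFieldL F x)
      rw [this, norm_zero]
      exact mul_nonneg (hterm 0 hk) (hν a)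
    · refine ((hc k hk _ (algProj_mem k a)).2.1 x).trans ?_
      rw [if_neg (by omega), add_zero, mul_one]
      exact hPa k hk a
  · rw [hfd, Finset.sum_mul]
    exact norm_sum_le_of_le _ fun k hk =>
      ((hc k hk _ (algProj_mem k a)).2.2.1 x).trans (hPa k hk a)
  · rw [hfd, hfd, ← Finset.sum_sub_distrib, Finset.sum_mul, Finset.sum_mul]
    exact norm_sum_le_of_le _ fun k hk =>
      ((hc k hk _ (algProj_mem k a)).2.2.2 x y).trans
        (mul_le_mul_of_nonneg_right (hPa k hk a) (norm_nonneg _))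

/-- The continuous extension of `a ↦ F^⊗(a) Id`, together with its derivative, its bounds, and
the fact that Lie elements act as first order operators. -/
structure FieldExtension (ν : TensorNorm N V) (F : FieldMap N V U) [CompleteSpace U] where
  val : U → TruncTensor ν →L[ℝ] U
  deriv : U → TruncTensor ν →L[ℝ] U →L[ℝ] U
  bound : ℝ
  bound_nonneg : 0 ≤ bound
  vectorField_eq : ∀ e x, vectorField ν F e x = val x e
  hasFDerivAt : ∀ e x, HasFDerivAt (fun x => val x e) (deriv x e) x
  norm_deriv_le : ∀ e x, ‖deriv x e‖ ≤ bound * ‖e‖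
  norm_deriv_sub_le : ∀ e x y, ‖deriv x e - deriv y e‖ ≤ bound * ‖e‖ * ‖x - y‖
  norm_val_le : ∀ e, projL ν 0 e = 0 → ∀ x, ‖val x e‖ ≤ bound * ‖e‖
  val_one : ∀ x, val x 1 = x
  deriv_val : ∀ a ∈ closedLie ν, ∀ e i m, i + m ≤ N → ∀ x,
    deriv x (projL ν m e) (val x (projL ν i a)) = val x (projL ν i a * projL ν m e)

/-- Values and derivatives extend separately by density. The extended derivative is the derivative
of the extended value because derivatives converge uniformly in `x`; the remaining identities and
bounds are closed conditions. -/
theorem exists_fieldExtension [CompleteSpace U] (hF : ExtendsContinuously ν F) :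
    Nonempty (FieldExtension ν F) := by
  obtain ⟨C, hC0, hC⟩ := exists_algField_bound hF
  let fderivL : U → TensorAlgebra ℝ V →ₗ[ℝ] U →L[ℝ] U := fun x =>
    { toFun := fun a => fderiv ℝ (algField F a) x
      map_add' := fun a b => by
        rw [algField_add]; exact fderiv_add ((hC a).1 x) ((hC b).1 x)
      map_smul' := fun c a => by
        rw [algField_smul]; exact fderiv_const_smul ((hC a).1 x) c }
  have hfderivL : ∀ x a, fderivL x a = fderiv ℝ (algField F a) x := fun _ _ => rfl
  have hd := denseRange_toTruncL ν
  have hval : ∀ x, ∃ C, ∀ a, ‖algFieldL F x a‖ ≤ C * ‖toTruncL ν a‖ := fun x =>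
    ⟨C * (1 + ‖x‖), fun a => ((hC a).2.1 x).trans (le_of_eq (by rw [norm_toTruncL]; ring))⟩
  have hder : ∀ x a, ‖fderivL x a‖ ≤ C * ‖toTruncL ν a‖ := fun x a => by
    rw [norm_toTruncL]; exact (hC a).2.2.2.1 x
  let val : U → TruncTensor ν →L[ℝ] U := fun x => (algFieldL F x).extendOfNorm (toTruncL ν)
  let der : U → TruncTensor ν →L[ℝ] U →L[ℝ] U := fun x => (fderivL x).extendOfNorm (toTruncL ν)
  have val_eq : ∀ x a, val x (toTrunc ν a) = algField F a x := fun x a =>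
    LinearMap.extendOfNorm_eq hd (hval x) a
  have der_eq : ∀ x a, der x (toTrunc ν a) = fderiv ℝ (algField F a) x := fun x a =>
    LinearMap.extendOfNorm_eq hd ⟨C, hder x⟩ a
  have der_le : ∀ e x, ‖der x e‖ ≤ C * ‖e‖ := fun e x =>
    LinearMap.norm_extendOfNorm_apply_le hd C (hder x) e
  refine ⟨⟨val, der, C, hC0, fun e x => ?_, fun e x => ?_, der_le, fun e x y => ?_,
    fun e he x => ?_, fun x => ?_, fun a ha e i m him x => ?_⟩⟩
  · have huc : UniformContinuous (fun a : AlgTensor ν => algField F a x) := by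
      have h1 := (val x).uniformContinuous.comp (Completion.uniformContinuous_coe (AlgTensor ν))
      have h2 : (fun a : AlgTensor ν => algField F a x) = val x ∘ fun a : AlgTensor ν =>
          (a : Completion (AlgTensor ν)) := funext fun a => (val_eq x a).symm
      rw [h2]
      exact h1
    exact congrFun (Completion.extension_unique huc (val x).uniformContinuous
      fun a => (val_eq x a).symm) e
  -- The filter of algebraic tensors approaching `e`.
  · let l : Filter (TensorAlgebra ℝ V) := comap (toTrunc ν) (𝓝 e)
    have hl : l.NeBot := comap_neBot_iff.2 fun t ht => by
      obtain ⟨_, h1, a, rfl⟩ := mem_closure_iff_nhds.1 (hd e) t ht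
      exact ⟨a, h1⟩
    have htend : Tendsto (toTrunc ν) l (𝓝 e) := tendsto_comap
    refine hasFDerivAt_of_tendstoUniformly (l := l) (f := fun a => algField F a)
      (f' := fun a y => fderiv ℝ (algField F a) y) (g' := fun y => der y e) ?_
      (fun a y => ((hC a).1 y).hasFDerivAt) (fun y => ?_) x
    · rw [Metric.tendstoUniformly_iff]
      intro ε hε
      have h1 : Tendsto (fun a => C * ‖e - toTrunc ν a‖) l (𝓝 0) := by
        have := ((tendsto_const_nhds (x := e)).sub htend).norm.const_mul C
        simpa using this
      filter_upwards [h1.eventually_lt_const hε] with a ha y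
      rw [dist_eq_norm, ← der_eq, ← map_sub]
      exact (der_le _ _).trans_lt ha
    · refine (((val y).continuous.tendsto e).comp htend).congr fun a => ?_
      exact val_eq y a
  · refine trunc_induction ν (p := fun e => ‖der x e - der y e‖ ≤ C * ‖e‖ * ‖x - y‖)
      (isClosed_le (by fun_prop) (by fun_prop)) (fun a => ?_) e
    rw [der_eq, der_eq, norm_toTrunc]
    exact (hC a).2.2.2.2 x y
  -- Subtracting the scalar part turns the constraint into a statement about all `e`, which can be
  -- checked on a dense set.
  · have h1 : ∀ e, ‖val x (e - projL ν 0 e)‖ ≤ C * ‖e - projL ν 0 e‖ := by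
      refine fun e => trunc_induction ν
        (p := fun e => ‖val x (e - projL ν 0 e)‖ ≤ C * ‖e - projL ν 0 e‖)
        (isClosed_le (by fun_prop) (by fun_prop)) (fun a => ?_) e
      have e1 : toTrunc ν a - projL ν 0 (toTrunc ν a) = toTrunc ν (a - algProj 0 a) := by
        rw [projL_toTrunc]; exact (map_sub (toTruncL ν) a (algProj 0 a)).symm
      rw [e1, val_eq, norm_toTrunc]
      refine (hC _).2.2.1 ?_ x
      rw [← algProjL_apply, map_sub, algProjL_apply, algProjL_apply, algProj_algProj, if_pos rfl,
        sub_self]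
    simpa [he] using h1 e
  · rw [← toTrunc_one, val_eq]
    simpa using algField_algebraMap F 1 x
  · refine closedLie_induction ν (p := fun a => der x (projL ν m e) (val x (projL ν i a)) =
      val x (projL ν i a * projL ν m e)) (isClosed_eq (by fun_prop) (by fun_prop))
      (fun a ha => ?_) ha
    refine trunc_induction ν (p := fun e => der x (projL ν m e) (val x (projL ν i (toTrunc ν a))) =
      val x (projL ν i (toTrunc ν a) * projL ν m e)) (isClosed_eq (by fun_prop) (by fun_prop))
      (fun b => ?_) e
    rw [projL_toTrunc, projL_toTrunc, ← toTrunc_mul, val_eq, val_eq, der_eq]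
    exact algField_lie_mul F ha (algProj_mem m b) him x

end Extension

end RoughFlow

namespace RoughFlow

/-! ### Homogeneous bounds in the truncated tensor algebra -/

section Homogeneous

variable {V : Type*} [NormedAddCommGroup V] [NormedSpace ℝ V] {n : ℕ} {ν : TensorNorm n V}

/-- The component of degree `k` of `e` is at most `M * η ^ k`. -/
def HomogBound (ν : TensorNorm n V) (M η : ℝ) (e : TruncTensor ν) : Prop :=
  ∀ k, ‖projL ν k e‖ ≤ M * η ^ k

variable {M M' η η' : ℝ} {e e' : TruncTensor ν}

theorem projL_eq_zero {k : ℕ} (hk : n < k) (e : TruncTensor ν) : projL ν k e = 0 :=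
  (grading ν).part_of_lt hk e

theorem sum_projL (e : TruncTensor ν) : ∑ k ∈ Finset.range (n + 1), projL ν k e = e :=
  (grading ν).sum_part e

theorem HomogBound.nonneg (h : HomogBound ν M η e) : 0 ≤ M := by
  simpa using (norm_nonneg _).trans (h 0)

theorem HomogBound.mono (h : HomogBound ν M η e) (hη : 0 ≤ η) (hM : M ≤ M') (hη' : η ≤ η') :
    HomogBound ν M' η' e := fun k => (h k).trans (by
  have := h.nonneg
  have := this.trans hM
  gcongr)

theorem HomogBound.add (h : HomogBound ν M η e) (h' : HomogBound ν M' η e') :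
    HomogBound ν (M + M') η (e + e') := fun k => by
  rw [map_add, add_mul]
  exact (norm_add_le _ _).trans (add_le_add (h k) (h' k))

theorem HomogBound.smul (h : HomogBound ν M η e) (c : ℝ) : HomogBound ν (|c| * M) η (c • e) :=
  fun k => by
    rw [map_smul, norm_smul, mul_assoc]
    exact mul_le_mul_of_nonneg_left (h k) (abs_nonneg c)

theorem HomogBound.smul_of_le (h : HomogBound ν M η e) (hη : 0 ≤ η) {c : ℝ} (hc : |c| ≤ 1) :
    HomogBound ν M η (c • e) :=
  (h.smul c).mono hη (mul_le_of_le_one_left h.nonneg hc) le_rfl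

/-- A degree `k ≤ n` splits in `k + 1 ≤ n + 1` ways, and higher degrees vanish. The new constant
does not involve `η`, so polynomial maps respect the scaling of degree `k` as `η^k`. -/
theorem HomogBound.mul (h : HomogBound ν M η e) (hη : 0 ≤ η) (h' : HomogBound ν M' η e') :
    HomogBound ν ((n + 1) * M * M') η (e * e') := fun k => by
  have hM := h.nonneg
  have hM' := h'.nonneg
  rcases lt_or_ge n k with hk | hk
  · rw [projL_eq_zero hk, norm_zero]
    positivity
  have e1 : projL ν k (e * e') = ∑ ij ∈ Finset.HasAntidiagonal.antidiagonal k,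
      projL ν ij.1 e * projL ν ij.2 e' := (grading ν).part_mul k e e'
  rw [e1]
  calc _ ≤ ∑ ij ∈ Finset.HasAntidiagonal.antidiagonal k, M * M' * η ^ k := by
        refine norm_sum_le_of_le _ fun ij hij => (norm_mul_le _ _).trans ?_
        rw [← Finset.HasAntidiagonal.mem_antidiagonal.1 hij]
        calc _ ≤ (M * η ^ ij.1) * (M' * η ^ ij.2) := by
              have := h ij.1
              have := h' ij.2
              gcongr
          _ = _ := by ring
    _ = ((k : ℝ) + 1) * (M * M' * η ^ k) := by simp
    _ ≤ ((n : ℝ) + 1) * (M * M' * η ^ k) := by gcongr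
    _ = _ := by ring

theorem projL_zero_one : projL ν 0 1 = 1 := (grading ν).part_zero_one

theorem projL_one {k : ℕ} (hk : k ≠ 0) : projL ν k 1 = 0 := (grading ν).part_one hk

theorem homogBound_one (hη : 0 ≤ η) : HomogBound ν ‖(1 : TruncTensor ν)‖ η 1 := fun k => by
  rcases eq_or_ne k 0 with rfl | hk
  · simp [projL_zero_one]
  · rw [projL_one hk, norm_zero]
    positivity

theorem homogBound_zero (hη : 0 ≤ η) (hM : 0 ≤ M) : HomogBound ν M η 0 := fun k => by
  rw [map_zero, norm_zero]; positivity

/-- Maps of the truncated tensor algebra that preserve homogeneous bounds. -/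
def PreservesHomog (ν : TensorNorm n V) (f : TruncTensor ν → TruncTensor ν) : Prop :=
  ∀ M, ∃ M', ∀ η, 0 ≤ η → ∀ e, HomogBound ν M η e → HomogBound ν M' η (f e)

theorem preservesHomog_pow (k : ℕ) : PreservesHomog ν fun e => e ^ k := fun M => by
  induction k with
  | zero => exact ⟨_, fun η hη e _ => by simpa using homogBound_one hη⟩
  | succ k ih =>
    obtain ⟨M', h⟩ := ih
    exact ⟨_, fun η hη e he => by simpa only [pow_succ] using (h η hη e he).mul hη he⟩

theorem preservesHomog_sum_pow (s : Finset ℕ) (c : ℕ → ℝ) :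
    PreservesHomog ν fun e => ∑ k ∈ s, c k • e ^ k := fun M => by
  induction s using Finset.induction_on with
  | empty => exact ⟨0, fun η hη e _ => by simpa using homogBound_zero hη le_rfl⟩
  | insert k s hk ih =>
    obtain ⟨M', h⟩ := ih
    obtain ⟨M'', h'⟩ := preservesHomog_pow (ν := ν) k M
    exact ⟨_, fun η hη e he => by
      simpa only [Finset.sum_insert hk] using ((h' η hη e he).smul (c k)).add (h η hη e he)⟩

theorem preservesHomog_nexp : PreservesHomog ν (nexp n) := preservesHomog_sum_pow _ _

theorem preservesHomog_nlog : PreservesHomog ν (nlog n) := preservesHomog_sum_pow _ _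

/-- Powers beyond the order of interest are absorbed in a constant, as `η` ranges over a bounded
interval. -/
theorem pow_le_mul_pow {H : ℝ} (hη : 0 ≤ η) (hH : η ≤ H) {j k m : ℕ} (h1 : j ≤ k)
    (h2 : k ≤ j + m) : η ^ k ≤ (1 + H) ^ m * η ^ j := by
  obtain ⟨l, rfl⟩ := Nat.exists_eq_add_of_le h1
  rw [pow_add, mul_comm]
  have h3 : η ^ l ≤ (1 + H) ^ l := by gcongr; linarith
  have h4 : (1 + H) ^ l ≤ (1 + H) ^ m := pow_le_pow_right₀ (by linarith) (by omega)
  have := h3.trans h4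
  gcongr

theorem HomogBound.norm_le {H : ℝ} (h : HomogBound ν M η e) (hη : 0 ≤ η) (hH : η ≤ H)
    (h0 : projL ν 0 e = 0) : ‖e‖ ≤ (n + 1) * M * (1 + H) ^ n * η := by
  have hM := h.nonneg
  conv_lhs => rw [← sum_projL e]
  calc _ ≤ ∑ k ∈ Finset.range (n + 1), M * ((1 + H) ^ n * η) := by
        refine norm_sum_le_of_le _ fun k hk => ?_
        have hk := Finset.mem_range.1 hk
        rcases eq_or_ne k 0 with rfl | hk0
        · rw [h0, norm_zero]
          have : 0 ≤ 1 + H := by linarith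
          positivity
        · refine (h k).trans (mul_le_mul_of_nonneg_left ?_ hM)
          simpa using pow_le_mul_pow hη hH (j := 1) (k := k) (m := n) (by omega) (by omega)
    _ = _ := by simp; ring

end Homogeneous

/-! ### Euler estimates for the time one maps -/

section EulerEstimates

variable {U : Type*} [NormedAddCommGroup U] [NormedSpace ℝ U] [CompleteSpace U]
  {V : Type*} [NormedAddCommGroup V] [NormedSpace ℝ V] {N : ℕ} {ν : TensorNorm N V}
  {F : FieldMap N V U} (G : FieldExtension ν F)

namespace FieldExtension

theorem norm_val_sub_le (e : TruncTensor ν) (x y : U) :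
    ‖G.val x e - G.val y e‖ ≤ G.bound * ‖e‖ * ‖x - y‖ :=
  convex_univ.norm_image_sub_le_of_norm_hasFDerivWithin_le
    (fun z _ => (G.hasFDerivAt e z).hasFDerivWithinAt) (fun z _ => G.norm_deriv_le e z)
    (Set.mem_univ y) (Set.mem_univ x)

theorem fourPoint_val {C : ℝ} {e : TruncTensor ν} (h : G.bound * ‖e‖ ≤ C) :
    FourPoint C C fun x => G.val x e :=
  fourPoint_of_hasFDerivAt ((mul_nonneg G.bound_nonneg (norm_nonneg e)).trans h)
    (G.hasFDerivAt e) (fun x => (G.norm_deriv_le e x).trans h)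
    (fun x y => (G.norm_deriv_sub_le e x y).trans (by gcongr))

/-- The defect of the relation `F(Λ) F(e) Id = F(Λ e) Id`. -/
def defect (Λ e : TruncTensor ν) (x : U) : U := G.deriv x e (G.val x Λ) - G.val x (Λ * e)

/-- In total degree at most `N` the two terms cancel since Lie elements act as derivations; in
higher degree the product of the tensors is truncated to zero and only the derivative term survives.
-/
theorem defect_eq {Λ : TruncTensor ν} (hΛ : Λ ∈ closedLie ν) (e : TruncTensor ν) (x : U) :
    G.defect Λ e x = ∑ i ∈ Finset.range (N + 1), ∑ m ∈ Finset.range (N + 1),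
      if i + m ≤ N then 0 else G.deriv x (projL ν m e) (G.val x (projL ν i Λ)) := by
  have h1 : G.deriv x e (G.val x Λ) = ∑ i ∈ Finset.range (N + 1), ∑ m ∈ Finset.range (N + 1),
      G.deriv x (projL ν m e) (G.val x (projL ν i Λ)) := by
    conv_lhs => rw [← sum_projL e, ← sum_projL Λ]
    simp only [map_sum, sum_apply]
  have h2 : G.val x (Λ * e) = ∑ i ∈ Finset.range (N + 1), ∑ m ∈ Finset.range (N + 1),
      G.val x (projL ν i Λ * projL ν m e) := by
    conv_lhs => rw [← sum_projL e, ← sum_projL Λ]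
    simp only [Finset.sum_mul_sum, map_sum]
  rw [defect, h1, h2, ← Finset.sum_sub_distrib]
  refine Finset.sum_congr rfl fun i _ => ?_
  rw [← Finset.sum_sub_distrib]
  refine Finset.sum_congr rfl fun m _ => ?_
  split_ifs with him
  · rw [G.deriv_val Λ hΛ e i m him, sub_self]
  · have h3 : projL ν i Λ * projL ν m e = 0 := by
      refine (grading ν).eq_zero_of_mem_filt ((grading ν).filt_mono (show N + 1 ≤ i + m by omega)
        ((grading ν).mul_mem_filt ?_ ?_)) <;>
      · intro k hk
        exact ((grading ν).part_part _ _ _).trans (if_neg hk.ne)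
    rw [h3, map_zero, sub_zero]

/-- Each surviving term has degree at least `N + 1`. The factor 2 in the constant comes from the
product rule in the Lipschitz estimate. -/
theorem exists_defect_bound {H M : ℝ} (hH : 0 ≤ H) (hM : 0 ≤ M) :
    ∃ C ≥ 0, ∀ η, 0 ≤ η → η ≤ H → ∀ Λ ∈ closedLie ν, HomogBound ν M η Λ → ∀ e,
      HomogBound ν M η e → Near (C * η ^ (N + 1)) (C * η ^ (N + 1)) (G.defect Λ e) 0 := by
  have hB := G.bound_nonneg
  set B := G.bound
  refine ⟨(N + 1) * ((N + 1) * (2 * (B * M) * (B * M) * (1 + H) ^ N)), by positivity,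
    fun η hη hηH Λ hΛ hMΛ e he => ?_⟩
  have hd : ∀ m x, ‖G.deriv x (projL ν m e)‖ ≤ B * M * η ^ m := fun m x =>
    (G.norm_deriv_le _ x).trans (by rw [mul_assoc]; exact mul_le_mul_of_nonneg_left (he m) hB)
  have hd' : ∀ m x y, ‖G.deriv x (projL ν m e) - G.deriv y (projL ν m e)‖ ≤
      B * M * η ^ m * ‖x - y‖ := fun m x y => (G.norm_deriv_sub_le _ x y).trans (by
        rw [mul_assoc B M]; gcongr; exact he m)
  have h0 : projL ν 0 Λ = 0 := (isLie_closedLie ν).le_filt hΛ 0 one_pos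
  have hv : ∀ i x, ‖G.val x (projL ν i Λ)‖ ≤ B * M * η ^ i := fun i x =>
    (G.norm_val_le _ (by
      rcases eq_or_ne i 0 with rfl | hi
      · rw [h0, map_zero]
      · exact ((grading ν).part_part _ _ _).trans (if_neg hi.symm)) x).trans
      (by rw [mul_assoc]; exact mul_le_mul_of_nonneg_left (hMΛ i) hB)
  have hv' : ∀ i x y, ‖G.val x (projL ν i Λ) - G.val y (projL ν i Λ)‖ ≤
      B * M * η ^ i * ‖x - y‖ := fun i x y => (G.norm_val_sub_le _ x y).trans (by
        rw [mul_assoc B M]; gcongr; exact hMΛ i)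
  have key : ∀ (D : ℝ), 0 ≤ D → ∀ g : ℕ → ℕ → U,
      (∀ i m, ‖g i m‖ ≤ 2 * (B * M) * (B * M) * η ^ (i + m) * D) →
      ‖∑ i ∈ Finset.range (N + 1), ∑ m ∈ Finset.range (N + 1),
        (if i + m ≤ N then 0 else g i m)‖ ≤
      (N + 1) * ((N + 1) * (2 * (B * M) * (B * M) * (1 + H) ^ N)) * η ^ (N + 1) * D := by
    intro D hD g hg
    have : ∀ i ∈ Finset.range (N + 1), ∀ m ∈ Finset.range (N + 1),
        ‖(if i + m ≤ N then 0 else g i m)‖ ≤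
          2 * (B * M) * (B * M) * ((1 + H) ^ N * η ^ (N + 1)) * D := by
      intro i hi m hm
      rw [Finset.mem_range] at hi hm
      split_ifs with him
      · rw [norm_zero]; positivity
      · refine (hg i m).trans ?_
        have := pow_le_mul_pow hη hηH (j := N + 1) (k := i + m) (m := N) (by omega) (by omega)
        gcongr
    refine (norm_sum_le_of_le _ fun i hi => norm_sum_le_of_le _ (this i hi)).trans (le_of_eq ?_)
    simp only [Finset.sum_const, Finset.card_range, nsmul_eq_mul]
    push_cast
    ring
  refine ⟨fun x => ?_, fun x y => ?_⟩
  · have := key 1 zero_le_one (fun i m => G.deriv x (projL ν m e) (G.val x (projL ν i Λ)))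
      (fun i m => (ContinuousLinearMap.le_opNorm _ _).trans (by
        calc _ ≤ (B * M * η ^ m) * (B * M * η ^ i) := by
              gcongr
              exacts [hd m x, hv i x]
          _ = 1 * (B * M) * (B * M) * η ^ (i + m) * 1 := by ring
          _ ≤ _ := by gcongr; norm_num))
    rw [mul_one, ← G.defect_eq hΛ] at this
    simpa using this
  · have := key ‖x - y‖ (norm_nonneg _) (fun i m => G.deriv x (projL ν m e)
      (G.val x (projL ν i Λ)) - G.deriv y (projL ν m e) (G.val y (projL ν i Λ)))
      (fun i m => by
        have e1 : G.deriv x (projL ν m e) (G.val x (projL ν i Λ)) -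
            G.deriv y (projL ν m e) (G.val y (projL ν i Λ)) =
            G.deriv x (projL ν m e) (G.val x (projL ν i Λ) - G.val y (projL ν i Λ)) +
            (G.deriv x (projL ν m e) - G.deriv y (projL ν m e)) (G.val y (projL ν i Λ)) := by
          rw [map_sub, sub_apply]; abel
        rw [e1]
        refine (norm_add_le _ _).trans ((add_le_add (ContinuousLinearMap.le_opNorm _ _)
          (ContinuousLinearMap.le_opNorm _ _)).trans ?_)
        calc _ ≤ (B * M * η ^ m) * (B * M * η ^ i * ‖x - y‖) +
              (B * M * η ^ m * ‖x - y‖) * (B * M * η ^ i) := by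
              gcongr
              exacts [hd m x, hv' i x y, hd' m x y, hv i y]
          _ = _ := by ring)
    simp only [Pi.zero_apply, sub_zero]
    rw [G.defect_eq hΛ, G.defect_eq hΛ, ← Finset.sum_sub_distrib]
    refine le_of_eq_of_le ?_ this
    congr 1
    refine Finset.sum_congr rfl fun i _ => ?_
    rw [← Finset.sum_sub_distrib]
    refine Finset.sum_congr rfl fun m _ => ?_
    split_ifs <;> simp

theorem nexp_smul_mul (c : ℝ) (a e : TruncTensor ν) : nexp N (c • a) * e =
    ∑ k ∈ Finset.range (N + 1), ((k.factorial : ℝ)⁻¹ * c ^ k) • (a ^ k * e) := by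
  simp only [nexp, Finset.sum_mul, smul_pow, smul_smul, smul_mul_assoc]

/-- An index shift, exact because nilpotency kills the top term. The coefficients on the right are
the derivatives in `c` of those of `exp(ca) e`. -/
theorem mul_nexp_smul_mul (c : ℝ) {a : TruncTensor ν} (ha : a ^ (N + 1) = 0)
    (e : TruncTensor ν) : a * (nexp N (c • a) * e) =
    ∑ k ∈ Finset.range (N + 1), ((k.factorial : ℝ)⁻¹ * (k * c ^ (k - 1))) • (a ^ k * e) := by
  rw [nexp_smul_mul, Finset.mul_sum, Finset.sum_range_succ, Finset.sum_range_succ']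
  simp only [mul_smul_comm, ← mul_assoc, ← pow_succ', ha, zero_mul, smul_zero, add_zero,
    Nat.cast_zero, mul_zero, zero_smul]
  refine Finset.sum_congr rfl fun k _ => ?_
  congr 1
  rw [Nat.factorial_succ]
  push_cast
  have : (k.factorial : ℝ) ≠ 0 := by positivity
  have : (k : ℝ) + 1 ≠ 0 := by positivity
  field_simp

/-- Moving along `y` differentiates the field in the direction `F(Λ)`, while the decreasing
exponential removes `F(Λ · )`; the difference is the defect. This replaces an iterated Taylor
expansion by a single integration. -/
theorem hasDerivWithinAt_val_nexp {Λ : TruncTensor ν} (hΛ : Λ ^ (N + 1) = 0) (e : TruncTensor ν)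
    {x : U} {y : ℝ → U} (hy : SolvesODE (fun x => G.val x Λ) x y) {u : ℝ}
    (hu : u ∈ Set.Icc (0 : ℝ) 1) :
    HasDerivWithinAt (fun u => G.val (y u) (nexp N ((1 - u) • Λ) * e))
      (G.defect Λ (nexp N ((1 - u) • Λ) * e) (y u)) (Set.Icc 0 1) u := by
  have h1 : ∀ k : ℕ, HasDerivWithinAt (fun u : ℝ => ((k.factorial : ℝ)⁻¹ * (1 - u) ^ k) •
      G.val (y u) (Λ ^ k * e))
      (((k.factorial : ℝ)⁻¹ * (1 - u) ^ k) • G.deriv (y u) (Λ ^ k * e) (G.val (y u) Λ) +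
        ((k.factorial : ℝ)⁻¹ * (k * (1 - u) ^ (k - 1) * (-1))) • G.val (y u) (Λ ^ k * e))
      (Set.Icc 0 1) u := fun k =>
    HasDerivWithinAt.fun_smul
      ((((hasDerivAt_id u).const_sub 1).fun_pow k).const_mul _).hasDerivWithinAt
      ((G.hasFDerivAt (Λ ^ k * e) (y u)).comp_hasDerivWithinAt u (hy.2 u hu))
  have h2 := HasDerivWithinAt.fun_sum fun k (_ : k ∈ Finset.range (N + 1)) => h1 k
  convert h2 using 1
  · ext u
    rw [nexp_smul_mul]
    simp only [map_sum, map_smul]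
  · rw [defect, mul_nexp_smul_mul _ hΛ, nexp_smul_mul, Finset.sum_add_distrib, sub_eq_add_neg]
    simp only [map_sum, map_smul, sum_apply, smul_apply, ← Finset.sum_neg_distrib, ← neg_smul,
      mul_neg, mul_one]

/-- Taylor expansion of `F(e) Id` along the time one map of `F(Λ) Id`. -/
theorem exists_remainder_bound {H M : ℝ} (hH : 0 ≤ H) (hM : 0 ≤ M) :
    ∃ C ≥ 0, ∀ η, 0 ≤ η → η ≤ H → ∀ Λ ∈ closedLie ν, HomogBound ν M η Λ →
      (∀ x, ‖G.val x Λ‖ ≤ C * η) ∧ FourPoint (C * η) (C * η) (fun x => G.val x Λ) ∧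
      ∀ e, HomogBound ν M η e → Near (C * η ^ (N + 1)) (C * η ^ (N + 1))
        (fun x => G.val (timeOne (fun x => G.val x Λ) x) e - G.val x (nexp N Λ * e)) 0 := by
  obtain ⟨M₁, hM₁⟩ := preservesHomog_nexp (ν := ν) M
  set M₂ := max M ((N + 1) * M₁ * M)
  obtain ⟨C₁, hC₁, hdef⟩ := G.exists_defect_bound (M := M₂) hH (hM.trans (le_max_left _ _))
  have hB := G.bound_nonneg
  set C₀ := G.bound * ((N + 1) * M * (1 + H) ^ N)
  have hC₀ : 0 ≤ C₀ := by positivity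
  -- The exponential is the Lipschitz constant of trajectories in their starting point, needed when
  -- defects along two trajectories are compared.
  set C := max C₀ (C₁ * Real.exp (C₀ * H))
  have hC₁C : C₁ ≤ C := le_trans
    (le_mul_of_one_le_right hC₁ (Real.one_le_exp (by positivity))) (le_max_right _ _)
  refine ⟨C, hC₀.trans (le_max_left _ _), fun η hη hηH Λ hΛ hMΛ => ?_⟩
  have hΛf := (isLie_closedLie ν).le_filt hΛ
  have h0 : projL ν 0 Λ = 0 := hΛf 0 one_pos
  have hn : G.bound * ‖Λ‖ ≤ C₀ * η := by
    rw [mul_assoc]; gcongr; exact hMΛ.norm_le hη hηH h0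
  have hn' : G.bound * ‖Λ‖ ≤ C * η := hn.trans (by gcongr; exact le_max_left _ _)
  have hv : ∀ x, ‖G.val x Λ‖ ≤ C * η := fun x => (G.norm_val_le Λ h0 x).trans hn'
  refine ⟨hv, G.fourPoint_val hn', fun e he => ?_⟩
  have hK : 0 ≤ C₀ * η := by positivity
  have hlip : LipBound (C₀ * η) fun x => G.val x Λ := (G.fourPoint_val hn).lipBound
  have hΛ0 := (grading ν).pow_eq_zero hΛf
  have hE : ∀ u ∈ Set.Icc (0 : ℝ) 1, Near (C₁ * η ^ (N + 1)) (C₁ * η ^ (N + 1))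
      (G.defect Λ (nexp N ((1 - u) • Λ) * e)) 0 := fun u hu => by
    refine hdef η hη hηH Λ hΛ (hMΛ.mono hη (le_max_left _ _) le_rfl) _ (HomogBound.mono
      (HomogBound.mul (hM₁ η hη _ (hMΛ.smul_of_le hη ?_)) hη he) hη (le_max_right _ _) le_rfl)
    rw [abs_le]
    constructor <;> linarith [hu.1, hu.2]
  have hEn : ∀ u ∈ Set.Icc (0 : ℝ) 1, ∀ z, ‖G.defect Λ (nexp N ((1 - u) • Λ) * e) z‖ ≤
      C₁ * η ^ (N + 1) := fun u hu z => by simpa using (hE u hu).1 z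
  have hEl : ∀ u ∈ Set.Icc (0 : ℝ) 1, ∀ z w, ‖G.defect Λ (nexp N ((1 - u) • Λ) * e) z -
      G.defect Λ (nexp N ((1 - u) • Λ) * e) w‖ ≤ C₁ * η ^ (N + 1) * ‖z - w‖ :=
    fun u hu z w => by simpa using (hE u hu).2 z w
  have hend : ∀ {x : U} {y : ℝ → U}, SolvesODE (fun x => G.val x Λ) x y →
      G.val (timeOne (fun x => G.val x Λ) x) e - G.val x (nexp N Λ * e) =
      G.val (y 1) (nexp N ((1 - (1 : ℝ)) • Λ) * e) -
        G.val (y 0) (nexp N ((1 - (0 : ℝ)) • Λ) * e) := fun hy => by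
    rw [timeOne_eq hK hlip hy, hy.1]; simp
  refine ⟨fun x => ?_, fun x z => ?_⟩
  · obtain ⟨y, hy⟩ := exists_solvesODE hK hlip hv x
    have := norm_image_sub_le_of_norm_deriv_le_segment_01'
      (fun u hu => G.hasDerivWithinAt_val_nexp hΛ0 e hy hu)
      (fun u hu => hEn u (Set.Ico_subset_Icc_self hu) (y u))
    simp only [Pi.zero_apply, sub_zero]
    rw [hend hy]
    exact this.trans (by gcongr)
  · obtain ⟨y, hy⟩ := exists_solvesODE hK hlip hv x
    obtain ⟨w, hw⟩ := exists_solvesODE hK hlip hv z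
    have := norm_image_sub_le_of_norm_deriv_le_segment_01'
      (C := C * η ^ (N + 1) * ‖x - z‖)
      (fun u hu => (G.hasDerivWithinAt_val_nexp hΛ0 e hy hu).sub
        (G.hasDerivWithinAt_val_nexp hΛ0 e hw hu))
      (fun u hu => (hEl u (Set.Ico_subset_Icc_self hu) (y u) (w u)).trans (by
        calc _ ≤ C₁ * η ^ (N + 1) * (Real.exp (C₀ * H) * ‖x - z‖) := by
              gcongr
              refine (hy.norm_sub_le hK hlip hw u (Set.Ico_subset_Icc_self hu)).trans ?_
              gcongr
          _ = C₁ * Real.exp (C₀ * H) * η ^ (N + 1) * ‖x - z‖ := by ring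
          _ ≤ _ := by gcongr; exact le_max_right _ _))
    simp only [Pi.zero_apply, sub_zero]
    rw [hend hy, hend hw]
    refine le_of_eq_of_le ?_ this
    congr 1
    simp only [Pi.sub_apply]
    abel

end FieldExtension

end EulerEstimates

end RoughFlow

namespace RoughFlow

/-! ### Estimates for rough paths -/

section RoughPathEstimates

variable {V : Type*} [NormedAddCommGroup V] [NormedSpace ℝ V] {p T : ℝ} {ν : TensorNorm ⌊p⌋₊ V}

namespace RoughPath

variable (X Y : RoughPath p T ν)

theorem size_nonneg : 0 ≤ X.size := Real.sSup_nonneg (by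
  rintro r ⟨i, hi, s, t, hs, hst, ht, rfl⟩
  have : 0 < t - s := sub_pos.2 hst
  positivity)

theorem distance_nonneg : 0 ≤ X.distance Y := Real.sSup_nonneg (by
  rintro r ⟨i, hi, s, t, hs, hst, ht, rfl⟩
  have : 0 < t - s := sub_pos.2 hst
  positivity)

variable {i : ℕ} {s t : ℝ}

theorem norm_proj_le (hi : i ∈ Finset.Icc 1 ⌊p⌋₊) (hs : 0 ≤ s) (hst : s < t) (ht : t ≤ T) :
    ‖proj ν i (incr X.path t s)‖ ≤ X.size * (t - s) ^ ((i : ℝ) / p) := by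
  have : 0 < t - s := sub_pos.2 hst
  rw [← div_le_iff₀ (by positivity)]
  refine le_csSup ?_ ⟨i, hi, s, t, hs, hst, ht, rfl⟩
  obtain ⟨C, hC⟩ := X.holder
  exact ⟨C, by rintro r ⟨i, hi, s, t, hs, hst, ht, rfl⟩; exact hC i hi s t hs hst ht⟩

theorem norm_proj_sub_le (hi : i ∈ Finset.Icc 1 ⌊p⌋₊) (hs : 0 ≤ s) (hst : s < t) (ht : t ≤ T) :
    ‖proj ν i (incr X.path t s) - proj ν i (incr Y.path t s)‖ ≤
      X.distance Y * (t - s) ^ ((i : ℝ) / p) := by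
  have : 0 < t - s := sub_pos.2 hst
  rw [← div_le_iff₀ (by positivity)]
  refine le_csSup ?_ ⟨i, hi, s, t, hs, hst, ht, rfl⟩
  refine ⟨X.size + Y.size, ?_⟩
  rintro r ⟨i, hi, s, t, hs, hst, ht, rfl⟩
  have : 0 < t - s := sub_pos.2 hst
  rw [div_le_iff₀ (by positivity), add_mul]
  exact (norm_sub_le _ _).trans
    (add_le_add (X.norm_proj_le hi hs hst ht) (Y.norm_proj_le hi hs hst ht))

/-- Keeps the neighbours of `X` in a bounded set, on which the constants are uniform. -/
theorem size_le_add_distance : Y.size ≤ X.size + X.distance Y := by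
  refine Real.sSup_le ?_ (add_nonneg X.size_nonneg (X.distance_nonneg Y))
  rintro r ⟨i, hi, s, t, hs, hst, ht, rfl⟩
  have : 0 < t - s := sub_pos.2 hst
  rw [div_le_iff₀ (by positivity), add_mul]
  have h1 := X.norm_proj_le hi hs hst ht
  have h2 := X.norm_proj_sub_le Y hi hs hst ht
  have h3 := norm_le_norm_add_norm_sub' (proj ν i (incr Y.path t s)) (proj ν i (incr X.path t s))
  rw [norm_sub_rev] at h3
  linarith

theorem path_mem (hs : 0 ≤ s) (hsT : s ≤ T) : X.path s ∈ groupElements ν := X.mem_group s ⟨hs, hsT⟩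

theorem rpow_div_eq (hst : s ≤ t) (i : ℕ) :
    (t - s) ^ ((i : ℝ) / p) = ((t - s) ^ (1 / p)) ^ i := by
  rw [← Real.rpow_natCast, ← Real.rpow_mul (sub_nonneg.2 hst)]
  congr 1
  ring

theorem homogBound_incr_sub_one (hs : 0 ≤ s) (hst : s ≤ t) (ht : t ≤ T) :
    HomogBound ν X.size ((t - s) ^ (1 / p)) (incr X.path t s - 1) := by
  rcases hst.eq_or_lt with rfl | hlt
  · rw [incr_self (X.path_mem hs ht), sub_self (1 : TruncTensor ν)]
    exact homogBound_zero (Real.rpow_nonneg (sub_nonneg.2 le_rfl) _) X.size_nonneg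
  have h0 := sub_nonneg.2 hst
  have h1 := (tlog_incr (X.path_mem hs (hst.trans ht)) (X.path_mem (hs.trans hst) ht)).1
  have hX := X.size_nonneg
  intro k
  rcases eq_or_ne k 0 with rfl | hk0
  · rw [show projL ν 0 _ = 0 from h1 0 one_pos, norm_zero]
    positivity
  rcases lt_or_ge ⌊p⌋₊ k with hk | hk
  · rw [projL_eq_zero hk, norm_zero]
    positivity
  rw [map_sub, projL_one hk0, sub_zero, ← proj_eq_projL, ← rpow_div_eq hst]
  exact X.norm_proj_le (Finset.mem_Icc.2 ⟨Nat.one_le_iff_ne_zero.2 hk0, hk⟩) hs hlt ht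

theorem norm_incr_sub_le (hs : 0 ≤ s) (hst : s ≤ t) (ht : t ≤ T) :
    ‖incr X.path t s - incr Y.path t s‖ ≤
      X.distance Y * ∑ k ∈ Finset.range (⌊p⌋₊ + 1), ((t - s) ^ (1 / p)) ^ k := by
  have h0 := sub_nonneg.2 hst
  have hd := X.distance_nonneg Y
  rcases hst.eq_or_lt with rfl | hlt
  · rw [incr_self (X.path_mem hs ht), incr_self (Y.path_mem hs ht), sub_self, norm_zero]
    positivity
  have hX := (tlog_incr (X.path_mem hs (hst.trans ht)) (X.path_mem (hs.trans hst) ht)).1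
  have hY := (tlog_incr (Y.path_mem hs (hst.trans ht)) (Y.path_mem (hs.trans hst) ht)).1
  conv_lhs => rw [← sum_projL (incr X.path t s - incr Y.path t s)]
  rw [Finset.mul_sum]
  refine norm_sum_le_of_le _ fun k hk => ?_
  rcases eq_or_ne k 0 with rfl | hk0
  · have e : incr X.path t s - incr Y.path t s =
        (incr X.path t s - 1) - (incr Y.path t s - 1) := by abel
    rw [e, map_sub, show projL ν 0 _ = 0 from hX 0 one_pos,
      show projL ν 0 _ = 0 from hY 0 one_pos, sub_zero, norm_zero]
    positivity
  · rw [map_sub, ← proj_eq_projL, ← rpow_div_eq hst]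
    exact X.norm_proj_sub_le Y (Finset.mem_Icc.2 ⟨Nat.one_le_iff_ne_zero.2 hk0,
      Nat.lt_succ_iff.1 (Finset.mem_range.1 hk)⟩) hs hlt ht

end RoughPath

end RoughPathEstimates

/-! ### The time one maps form an almost flow -/

section AlmostFlow

variable {U : Type*} [NormedAddCommGroup U] [NormedSpace ℝ U] [CompleteSpace U]
  {V : Type*} [NormedAddCommGroup V] [NormedSpace ℝ V] {p T : ℝ} {ν : TensorNorm ⌊p⌋₊ V}
  {F : FieldMap ⌊p⌋₊ V U}

theorem FieldExtension.logField_eq (G : FieldExtension ν F) (X : RoughPath p T ν) (t s : ℝ) :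
    logField F X t s = fun x => G.val x (tlog ν (incr X.path t s)) :=
  funext fun x => G.vectorField_eq _ x

/-- Truncated logarithms preserve the scaling of increments, so the Taylor estimate applies with `η
= (t - s)^(1/p)`, and its error `η^(N+1)` is the required power of `t - s`. -/
theorem exists_almostFlow_mu (hp : 0 < p) (hF : ExtendsContinuously ν F) (R : ℝ) :
    ∃ C ≥ 0, ∀ X : RoughPath p T ν, X.size ≤ R →
      AlmostFlow T C (1 / p) (((⌊p⌋₊ : ℝ) + 1) / p) (mu F X) := by
  rcases lt_or_ge T 0 with hT | hT
  · exact ⟨0, le_rfl, fun X _ => ⟨fun s h1 h2 => by linarith, fun s t h1 h2 h3 => by linarith,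
      fun s t h1 h2 h3 => by linarith, fun s u t h1 h2 h3 h4 => by linarith⟩⟩
  obtain ⟨G⟩ := exists_fieldExtension hF
  obtain ⟨M₁, hM₁⟩ := preservesHomog_nlog (ν := ν) (max R 0)
  set M := max M₁ (max R 0 + ‖(1 : TruncTensor ν)‖)
  have hM : 0 ≤ M := le_trans (by positivity) (le_max_right _ _)
  set H := T ^ (1 / p)
  have hH : 0 ≤ H := by positivity
  obtain ⟨C, hC, hrem⟩ := G.exists_remainder_bound (H := H) hH hM
  set E := Real.exp (C * H)
  have hE : 0 < E := Real.exp_pos _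
  -- One constant for all the requirements: `C E` bounds the growth of `exp(Cη) - 1`, `C H E³` is
  -- the second order constant, and `C E + 2 C` collects the three remainders in the comparison of
  -- `μ_tu ∘ μ_us` with `μ_ts`.
  set C' := C * E + C * H * E ^ 3 + C * E + 2 * C
  have hc1 : 0 ≤ C * E := by positivity
  have hc2 : 0 ≤ C * H * E ^ 3 := by positivity
  refine ⟨C', by positivity, fun X hX => ?_⟩
  let Λ : ℝ → ℝ → TruncTensor ν := fun t s => tlog ν (incr X.path t s)
  have hmu : ∀ t s, mu F X t s = timeOne fun x => G.val x (Λ t s) := fun t s => by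
    rw [mu, G.logField_eq]
  have hmem := fun {s t} (hs : 0 ≤ s) (hst : s ≤ t) (ht : t ≤ T) =>
    tlog_incr (X.path_mem hs (hst.trans ht)) (X.path_mem (hs.trans hst) ht)
  have hhom : ∀ {s t η}, 0 ≤ s → s ≤ t → t ≤ T → (t - s) ^ (1 / p) ≤ η →
      HomogBound ν M η (Λ t s) ∧ HomogBound ν M η (incr X.path t s) := by
    intro s t η hs hst ht hη
    have h0 : 0 ≤ (t - s) ^ (1 / p) := Real.rpow_nonneg (sub_nonneg.2 hst) _
    have h1 := (X.homogBound_incr_sub_one hs hst ht).mono h0 (hX.trans (le_max_left R 0)) hη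
    refine ⟨(hM₁ η (h0.trans hη) _ h1).mono (h0.trans hη) (le_max_left _ _) le_rfl, ?_⟩
    have h2 := h1.add (homogBound_one (h0.trans hη))
    rw [sub_add_cancel] at h2
    exact h2.mono (h0.trans hη) (le_max_right _ _) le_rfl
  have hηH : ∀ {s t}, 0 ≤ s → s ≤ t → t ≤ T → (t - s) ^ (1 / p) ≤ H := fun hs hst ht =>
    Real.rpow_le_rpow (sub_nonneg.2 hst) (by linarith) (by positivity)
  have hη0 : ∀ {s t : ℝ}, s ≤ t → 0 ≤ (t - s) ^ (1 / p) := fun hst =>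
    Real.rpow_nonneg (sub_nonneg.2 hst) _
  have hall := fun {s t η} (hs : 0 ≤ s) (hst : s ≤ t) (ht : t ≤ T) (hη : (t - s) ^ (1 / p) ≤ η)
    (hηH : η ≤ H) => hrem η ((hη0 hst).trans hη) hηH (Λ t s) (hmem hs hst ht).2.1
      (hhom hs hst ht hη).1
  have hfour : ∀ s t, 0 ≤ s → s ≤ t → t ≤ T → FourPoint (Real.exp (C * (t - s) ^ (1 / p)))
      (C * (t - s) ^ (1 / p) * Real.exp (C * (t - s) ^ (1 / p)) ^ 3) (mu F X t s) := by
    intro s t hs hst ht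
    obtain ⟨hn, h4, -⟩ := hall hs hst ht le_rfl (hηH hs hst ht)
    have := mul_nonneg hC (hη0 hst)
    rw [hmu]
    exact fourPoint_timeOne this this h4 hn
  have hexp : ∀ {s t}, 0 ≤ s → s ≤ t → t ≤ T → Real.exp (C * (t - s) ^ (1 / p)) ≤ E :=
    fun hs hst ht => Real.exp_le_exp.2 (mul_le_mul_of_nonneg_left (hηH hs hst ht) hC)
  have hlip : ∀ s t, 0 ≤ s → s ≤ t → t ≤ T → LipBound E (mu F X t s) := fun s t hs hst ht =>
    (hfour s t hs hst ht).lipBound.mono (hexp hs hst ht)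
  refine ⟨fun s hs hsT => ?_, fun s t hs hst ht => ?_, fun s t hs hst ht x => ?_,
    fun s u t hs hsu hut ht => ?_⟩
  · obtain ⟨hn, -, -⟩ := hall hs le_rfl hsT le_rfl (hηH hs le_rfl hsT)
    have hz : ∀ x, G.val x (Λ s s) = 0 := fun x => by
      have : Λ s s = 0 := by
        simp only [Λ]
        rw [incr_self (X.path_mem hs hsT), tlog_eq, sub_self, nlog]
        exact Finset.sum_eq_zero fun k hk => by
          rw [zero_pow (by have := Finset.mem_Icc.1 hk; omega), smul_zero]
      rw [this, map_zero]
    ext x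
    rw [hmu, timeOne_eq (K := 0) (y := fun _ => x) le_rfl (fun x y => by simp [hz])
      ⟨rfl, fun u _ => by rw [hz]; exact hasDerivWithinAt_const _ _ _⟩, id]
  · intro a b c d
    refine (hfour s t hs hst ht a b c d).trans ?_
    have h1 := hexp hs hst ht
    have h2 := hηH hs hst ht
    have h3 := hη0 hst
    set η := (t - s) ^ (1 / p)
    have h4 : Real.exp (C * η) ≤ 1 + C' * η := by
      have h5 : 1 - C * η ≤ Real.exp (-(C * η)) := by linarith [Real.add_one_le_exp (-(C * η))]
      have h6 : Real.exp (-(C * η)) * Real.exp (C * η) = 1 := by rw [← Real.exp_add]; simp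
      have h7 : (1 - C * η) * Real.exp (C * η) ≤ Real.exp (-(C * η)) * Real.exp (C * η) := by
        gcongr
      have h8 : C * η * Real.exp (C * η) ≤ C * η * E := by gcongr
      have h9 : C * E * η ≤ C' * η := by
        gcongr; simp only [C']; linarith
      linarith
    have h5 : C * η * Real.exp (C * η) ^ 3 ≤ C' := by
      calc C * η * Real.exp (C * η) ^ 3 ≤ C * H * E ^ 3 := by gcongr
        _ ≤ C' := by simp only [C']; linarith
    gcongr
  · obtain ⟨hn, h4, -⟩ := hall hs hst ht le_rfl (hηH hs hst ht)
    have h0 := mul_nonneg hC (hη0 hst)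
    obtain ⟨y, hy⟩ := exists_solvesODE h0 h4.lipBound hn x
    rw [hmu, timeOne_eq h0 h4.lipBound hy]
    refine (hy.norm_sub_initial_le hn).trans ?_
    have := hη0 hst
    gcongr
    simp only [C']
    linarith
  · have hst := hsu.trans hut
    have hus : (u - s) ^ (1 / p) ≤ (t - s) ^ (1 / p) :=
      Real.rpow_le_rpow (sub_nonneg.2 hsu) (by linarith) (by positivity)
    have htu : (t - u) ^ (1 / p) ≤ (t - s) ^ (1 / p) :=
      Real.rpow_le_rpow (sub_nonneg.2 hut) (by linarith) (by positivity)
    have hH' := hηH hs hst ht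
    have huT := hut.trans ht
    have hu0 := hs.trans hsu
    have h1 : HomogBound ν M ((t - s) ^ (1 / p)) 1 := (homogBound_one (hη0 hst)).mono (hη0 hst)
      (le_trans (by simp) (le_max_right _ _)) le_rfl
    -- Three expansions: of `μ_tu`, of `F(X_tu)` along `μ_us`, and of `μ_ts`. Their main terms
    -- cancel by Chen's relation. All are taken at the common scale `(t - s)^(1/p)`.
    have r1 := (hall hu0 hut ht htu hH').2.2 1 h1
    have r2 := (hall hs hsu huT hus hH').2.2 _ (hhom hu0 hut ht htu).2
    have r3 := (hall hs hst ht le_rfl hH').2.2 1 h1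
    have hpow : ((t - s) ^ (1 / p)) ^ (⌊p⌋₊ + 1) = (t - s) ^ (((⌊p⌋₊ : ℝ) + 1) / p) := by
      rw [← RoughPath.rpow_div_eq hst]; push_cast; rfl
    rw [hpow, ← hmu, (hmem hu0 hut ht).2.2] at r1
    rw [hpow, ← hmu, (hmem hs hsu huT).2.2, incr_mul_incr (X.path_mem hu0 huT)] at r2
    rw [hpow, ← hmu, (hmem hs hst ht).2.2] at r3
    simp only [mul_one, G.val_one] at r1 r2 r3
    have hw : 0 ≤ (t - s) ^ (((⌊p⌋₊ : ℝ) + 1) / p) := Real.rpow_nonneg (sub_nonneg.2 hst) _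
    set w := (t - s) ^ (((⌊p⌋₊ : ℝ) + 1) / p)
    have hl := hlip s u hs hsu huT
    have hE1 : 1 ≤ E := Real.one_le_exp (by positivity)
    have hCE : C ≤ C * E := le_mul_of_one_le_right hC hE1
    constructor
    · intro x
      have q1 := r1.1 (mu F X u s x)
      have q2 := r2.1 x
      have q3 := r3.1 x
      simp only [Pi.zero_apply, sub_zero] at q1 q2 q3
      calc ‖(mu F X t u ∘ mu F X u s) x - mu F X t s x‖
          = ‖(mu F X t u (mu F X u s x) - G.val (mu F X u s x) (incr X.path t u)) +
            (G.val (mu F X u s x) (incr X.path t u) - G.val x (incr X.path t s)) -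
            (mu F X t s x - G.val x (incr X.path t s))‖ := by
            rw [Function.comp_apply]; congr 1; abel
        _ ≤ C * w + C * w + C * w := (norm_sub_le _ _).trans
            (add_le_add ((norm_add_le _ _).trans (add_le_add q1 q2)) q3)
        _ = (3 * C) * w := by ring
        _ ≤ C' * w := by gcongr; simp only [C']; linarith
    · intro x y
      have q1 := r1.2 (mu F X u s x) (mu F X u s y)
      have q2 := r2.2 x y
      have q3 := r3.2 x y
      simp only [Pi.zero_apply, sub_zero] at q1 q2 q3
      calc ‖(mu F X t u ∘ mu F X u s) x - mu F X t s x -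
            ((mu F X t u ∘ mu F X u s) y - mu F X t s y)‖
          = ‖((mu F X t u (mu F X u s x) - G.val (mu F X u s x) (incr X.path t u)) -
              (mu F X t u (mu F X u s y) - G.val (mu F X u s y) (incr X.path t u))) +
            ((G.val (mu F X u s x) (incr X.path t u) - G.val x (incr X.path t s)) -
              (G.val (mu F X u s y) (incr X.path t u) - G.val y (incr X.path t s))) -
            ((mu F X t s x - G.val x (incr X.path t s)) -
              (mu F X t s y - G.val y (incr X.path t s)))‖ := by
            simp only [Function.comp_apply]; congr 1; abel
        _ ≤ C * w * (E * ‖x - y‖) + C * w * ‖x - y‖ + C * w * ‖x - y‖ := (norm_sub_le _ _).trans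
            (add_le_add ((norm_add_le _ _).trans (add_le_add (q1.trans (by
              gcongr; exact hl x y)) q2)) q3)
        _ = (C * E + 2 * C) * w * ‖x - y‖ := by ring
        _ ≤ C' * w * ‖x - y‖ := by gcongr; simp only [C']; linarith

end AlmostFlow

end RoughFlow

namespace RoughFlow

/-! ### Partitions -/

namespace Partition

variable {s t : ℝ} (P : Partition s t)

theorem pt_lt_pt {i j : ℕ} (hij : i < j) (hj : j ≤ P.m) : P.pt i < P.pt j := by
  induction j, hij using Nat.le_induction with
  | base => exact P.pt_lt i (by omega)
  | succ j _ ih => exact (ih (by omega)).trans (P.pt_lt j (by omega))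

theorem pt_le_pt {i j : ℕ} (hij : i ≤ j) (hj : j ≤ P.m) : P.pt i ≤ P.pt j := by
  rcases hij.eq_or_lt with rfl | h
  · exact le_rfl
  · exact (P.pt_lt_pt h hj).le

theorem sub_le_mesh {i : ℕ} (hi : i < P.m) : P.pt (i + 1) - P.pt i ≤ P.mesh :=
  le_ciSup (f := fun i : Fin P.m => P.pt (i + 1) - P.pt i) (Set.finite_range _).bddAbove ⟨i, hi⟩

theorem mesh_nonneg : 0 ≤ P.mesh :=
  Real.iSup_nonneg fun i => (sub_pos.2 (P.pt_lt i i.2)).le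

/-- The set of the points of a partition. -/
def points : Finset ℝ := (Finset.range (P.m + 1)).image P.pt

theorem pt_mem_points {i : ℕ} (hi : i ≤ P.m) : P.pt i ∈ P.points :=
  Finset.mem_image_of_mem _ (Finset.mem_range.2 (by omega))

theorem inner_points {i : ℕ} (hi : i < P.m) : inner P.points (P.pt i) (P.pt (i + 1)) = ∅ := by
  refine Finset.eq_empty_of_forall_notMem fun x hx => ?_
  obtain ⟨h1, h2, h3⟩ := mem_inner.1 hx
  obtain ⟨k, hk, rfl⟩ := Finset.mem_image.1 h1
  have hk := Finset.mem_range.1 hk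
  rcases le_or_gt k i with h | h
  · exact absurd h2 (not_lt.2 (P.pt_le_pt h hi.le))
  · exact absurd h3 (not_lt.2 (P.pt_le_pt h (by omega)))

/-- With `j + 1` the first index whose point exceeds `u`, an interval free of partition points lies
between the points of index `j` and `j + 1`. -/
theorem meshLE_points : MeshLE P.points P.mesh s t := by
  intro u v hu huv hv h
  have hex : ∃ k, k ≤ P.m ∧ u < P.pt k := ⟨P.m, le_rfl, by rw [P.pt_last]; linarith⟩
  classical
  obtain ⟨h1, h2⟩ := Nat.find_spec hex
  have h3 := fun k (hk : k < Nat.find hex) => Nat.find_min hex hk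
  rcases hk : Nat.find hex with _ | j
  · rw [hk, P.pt_zero] at h2
    linarith
  rw [hk] at h1 h2
  have h4 : P.pt j ≤ u := not_lt.1 fun h => h3 j (by omega) ⟨by omega, h⟩
  have h5 : v ≤ P.pt (j + 1) := by
    by_contra! h6
    have : P.pt (j + 1) ∈ inner P.points u v := mem_inner.2 ⟨P.pt_mem_points h1, h2, h6⟩
    simp [h] at this
  linarith [P.sub_le_mesh (show j < P.m by omega)]

theorem comp_eq_along {U : Type*} {T : ℝ} {μ : ℝ → ℝ → U → U}
    (hμ : ∀ s, 0 ≤ s → s ≤ T → μ s s = id) (hs : 0 ≤ s) (ht : t ≤ T) :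
    P.comp μ = along μ P.points s t := by
  have h0 : ∀ j ≤ P.m, s ≤ P.pt j := fun j hj =>
    P.pt_zero.ge.trans (P.pt_le_pt (Nat.zero_le j) hj)
  have h1 : ∀ j ≤ P.m, P.pt j ≤ t := fun j hj =>
    (P.pt_le_pt hj le_rfl).trans P.pt_last.le
  have key : ∀ j ≤ P.m, compUpTo μ P.pt j = along μ P.points s (P.pt j) := by
    intro j
    induction j with
    | zero =>
      intro hj
      have h2 := h1 0 hj
      rw [P.pt_zero] at h2 ⊢
      exact (along_self hμ _ hs (h2.trans ht)).symm
    | succ j ih =>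
      intro hj
      rw [compUpTo, ih (by omega), ← along_of_inner_eq_empty μ (P.inner_points (by omega)),
        along_comp_along hμ (P.pt_mem_points (by omega)) hs (h0 j (by omega))
          (P.pt_lt j (by omega)).le ((h1 _ hj).trans ht)]
  rw [Partition.comp, key P.m le_rfl, P.pt_last]

end Partition

/-! ### Continuity of the solution flow -/

section Continuity

variable {U : Type*} [NormedAddCommGroup U]

/-- The modulus of continuity of a flow of Lipschitz maps. -/
theorem IsFlow.norm_sub_le {T L η m : ℝ} {φ : ℝ → ℝ → U → U} (hφ : IsFlow T φ) (hL : 1 ≤ L)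
    (hlip : ∀ s t, 0 ≤ s → s ≤ t → t ≤ T → LipBound L (φ t s))
    (hm : ∀ s t, 0 ≤ s → s ≤ t → t ≤ T → t - s < η → ∀ x, ‖φ t s x - x‖ ≤ m) {s t s' t' : ℝ}
    (hs : 0 ≤ s) (hst : s ≤ t) (ht : t ≤ T) (hs' : 0 ≤ s') (hst' : s' ≤ t') (ht' : t' ≤ T)
    (h1 : |s' - s| < η) (h2 : |t' - t| < η) (x : U) :
    ‖φ t' s' x - φ t s x‖ ≤ 2 * ((1 + L) * m) := by
  rw [abs_lt] at h1 h2
  have hm0 : 0 ≤ m := (norm_nonneg _).trans (hm s s hs le_rfl (hst.trans ht) (by linarith) x)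
  -- Shrinking an interval slightly at both ends. Two nearby intervals are each compared with their
  -- intersection; if they are disjoint, both are shorter than `η`.
  have hsub : ∀ {s t σ τ}, 0 ≤ s → s ≤ σ → σ ≤ τ → τ ≤ t → t ≤ T → σ - s < η → t - τ < η →
      ‖φ t s x - φ τ σ x‖ ≤ (1 + L) * m := by
    intro s t σ τ hs hsσ hστ hτt ht h1 h2
    have hσ := hs.trans hsσ
    have hτ := hτt.trans ht
    rw [← hφ.comp hs (hsσ.trans hστ) hτt ht, ← hφ.comp hs hsσ hστ hτ]
    have e1 := hm τ t (hσ.trans hστ) hτt ht h2 (φ τ σ (φ σ s x))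
    have e2 := hlip σ τ hσ hστ hτ (φ σ s x) x
    have e3 := hm s σ hs hsσ (hστ.trans hτ) h1 x
    calc _ ≤ m + L * m := (norm_sub_le_norm_sub_add_norm_sub _ _ _).trans
          (add_le_add e1 (e2.trans (by gcongr)))
      _ = _ := by ring
  have hsmall : ‖φ t' s' x - x‖ ≤ m → ‖φ t s x - x‖ ≤ m →
      ‖φ t' s' x - φ t s x‖ ≤ 2 * ((1 + L) * m) := fun e1 e2 => by
    have e3 := norm_sub_le_norm_sub_add_norm_sub (φ t' s' x) x (φ t s x)
    rw [norm_sub_rev x] at e3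
    nlinarith
  rcases lt_or_ge t s' with h | h
  · exact hsmall (hm _ _ hs' hst' ht' (by linarith) x) (hm _ _ hs hst ht (by linarith) x)
  rcases lt_or_ge t' s with h' | h'
  · exact hsmall (hm _ _ hs' hst' ht' (by linarith) x) (hm _ _ hs hst ht (by linarith) x)
  have hστ : max s s' ≤ min t t' := max_le (le_min hst h') (le_min h hst')
  have e1 := hsub hs (le_max_left s s') hστ (min_le_left t t') ht
    (by rcases max_cases s s' with h | h <;> linarith)
    (by rcases min_cases t t' with h | h <;> linarith)
  have e2 := hsub hs' (le_max_right s s') hστ (min_le_right t t') ht'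
    (by rcases max_cases s s' with h | h <;> linarith)
    (by rcases min_cases t t' with h | h <;> linarith)
  have e3 := norm_sub_le_norm_sub_add_norm_sub (φ t' s' x) (φ (min t t') (max s s') x) (φ t s x)
  rw [norm_sub_rev (φ (min t t') (max s s') x)] at e3
  linarith

variable [NormedSpace ℝ U] [CompleteSpace U]
  {V : Type*} [NormedAddCommGroup V] [NormedSpace ℝ V] {p T : ℝ} {ν : TensorNorm ⌊p⌋₊ V}
  {F : FieldMap ⌊p⌋₊ V U}

theorem exists_logField_bound (hF : ExtendsContinuously ν F) (X : RoughPath p T ν) {s t : ℝ}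
    (hs : 0 ≤ s) (hst : s ≤ t) (ht : t ≤ T) :
    ∃ K ≥ 0, LipBound K (logField F X t s) ∧ ∀ x, ‖logField F X t s x‖ ≤ K := by
  obtain ⟨G⟩ := exists_fieldExtension hF
  have h := (tlog_incr (X.path_mem hs (hst.trans ht)) (X.path_mem (hs.trans hst) ht)).2.1
  rw [G.logField_eq]
  exact ⟨_, mul_nonneg G.bound_nonneg (norm_nonneg _), G.norm_val_sub_le _,
    G.norm_val_le _ ((isLie_closedLie ν).le_filt h 0 one_pos)⟩

theorem continuous_tlog : Continuous (tlog ν) := by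
  refine continuous_finsetSum _ fun k _ => ?_
  have h : Continuous fun a : TruncTensor ν => (a - 1) ^ k :=
    (continuous_id.sub continuous_const).pow k
  exact h.const_smul ((-1 : ℝ) ^ (k + 1) / (k : ℝ))

/-- The distance controls the increment over the fixed interval, and the logarithm is continuous.
The difference of two logarithms has no scalar part, so the two vector fields are close uniformly on
`U`, and Grönwall concludes. -/
theorem exists_norm_mu_sub_lt (hF : ExtendsContinuously ν F) (X : RoughPath p T ν) {s t : ℝ}
    (hs : 0 ≤ s) (hst : s ≤ t) (ht : t ≤ T) {ε : ℝ} (hε : 0 < ε) :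
    ∃ η > 0, ∀ Y : RoughPath p T ν, X.distance Y < η → ∀ x,
      ‖mu F Y t s x - mu F X t s x‖ < ε := by
  obtain ⟨G⟩ := exists_fieldExtension hF
  obtain ⟨K, hK, hKl, hKb⟩ := exists_logField_bound hF X hs hst ht
  have hB := G.bound_nonneg
  set ε' := ε / (Real.exp K * (G.bound + 1))
  have hε' : 0 < ε' := by positivity
  obtain ⟨δ, hδ, hlog⟩ := Metric.continuous_iff.1 (continuous_tlog (ν := ν)) (incr X.path t s)
    ε' hε'
  have h0 := sub_nonneg.2 hst
  set D := ∑ k ∈ Finset.range (⌊p⌋₊ + 1), ((t - s) ^ (1 / p)) ^ k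
  have hD : 0 ≤ D := by positivity
  refine ⟨δ / (D + 1), by positivity, fun Y hY x => ?_⟩
  have hd : dist (incr Y.path t s) (incr X.path t s) < δ := by
    rw [dist_comm, dist_eq_norm]
    rw [lt_div_iff₀ (by positivity)] at hY
    have := X.norm_incr_sub_le Y hs hst ht
    have := X.distance_nonneg Y
    linarith
  have hΛ := hlog _ hd
  rw [dist_comm, dist_eq_norm] at hΛ
  obtain ⟨K₂, hK₂, hKl₂, hKb₂⟩ := exists_logField_bound hF Y hs hst ht
  have hX := (tlog_incr (X.path_mem hs (hst.trans ht)) (X.path_mem (hs.trans hst) ht)).2.1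
  have hY' := (tlog_incr (Y.path_mem hs (hst.trans ht)) (Y.path_mem (hs.trans hst) ht)).2.1
  have hsub : ∀ x, ‖logField F X t s x - logField F Y t s x‖ ≤ G.bound * ε' := fun x => by
    rw [G.logField_eq, G.logField_eq, ← map_sub]
    refine (G.norm_val_le _ ((isLie_closedLie ν).le_filt
      ((closedLie ν).sub_mem hX hY') 0 one_pos) x).trans ?_
    gcongr
  rw [norm_sub_rev]
  calc _ ≤ Real.exp K * (G.bound * ε') :=
        norm_timeOne_sub_timeOne_le hK hKl hKb hK₂ hKl₂ hKb₂ hsub x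
    _ < Real.exp K * ((G.bound + 1) * ε') := by gcongr; linarith
    _ = ε := by simp only [ε']; field_simp

/-- Induction on the number of points. The Lipschitz bound is needed for the maps of `X` only: the
last map is changed first, at the point reached with `Y`. -/
theorem exists_norm_along_sub_lt (hF : ExtendsContinuously ν F) (X : RoughPath p T ν) {L : ℝ}
    (hL : 0 ≤ L) (hlip : ∀ s t, 0 ≤ s → s ≤ t → t ≤ T → LipBound L (mu F X t s)) (S : Finset ℝ)
    {s t : ℝ} (hs : 0 ≤ s) (hst : s ≤ t) (ht : t ≤ T) {ε : ℝ} (hε : 0 < ε) :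
    ∃ η > 0, ∀ Y : RoughPath p T ν, X.distance Y < η → ∀ x,
      ‖along (mu F Y) S s t x - along (mu F X) S s t x‖ < ε := by
  induction hn : (inner S s t).card using Nat.strong_induction_on generalizing t ε with
  | _ n ih =>
  rcases (inner S s t).eq_empty_or_nonempty with h | h
  · simp only [along_of_inner_eq_empty _ h]
    exact exists_norm_mu_sub_lt hF X hs hst ht hε
  have hv := Finset.max'_mem _ h
  obtain ⟨hvS, hsv, hvt⟩ := mem_inner.1 hv
  have halong : ∀ μ : ℝ → ℝ → U → U, along μ S s t =
      μ t ((inner S s t).max' h) ∘ along μ S s ((inner S s t).max' h) := fun μ => by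
    rw [along, dif_pos h]
  generalize (inner S s t).max' h = v at *
  obtain ⟨η₁, hη₁, h₁⟩ := ih _ (hn ▸ inner_card_lt le_rfl hvt.le hv (by simp [mem_inner])) hsv.le
    (hvt.le.trans ht) (show 0 < ε / 2 / (L + 1) by positivity) rfl
  obtain ⟨η₂, hη₂, h₂⟩ := exists_norm_mu_sub_lt hF X (hs.trans hsv.le) hvt.le ht (half_pos hε)
  refine ⟨min η₁ η₂, lt_min hη₁ hη₂, fun Y hY x => ?_⟩
  have e1 := h₁ Y (hY.trans_le (min_le_left _ _)) x
  have e2 := h₂ Y (hY.trans_le (min_le_right _ _)) (along (mu F Y) S s v x)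
  have e3 := hlip v t (hs.trans hsv.le) hvt.le ht (along (mu F Y) S s v x)
    (along (mu F X) S s v x)
  have e4 : L * ‖along (mu F Y) S s v x - along (mu F X) S s v x‖ ≤ ε / 2 := by
    rw [lt_div_iff₀ (by positivity)] at e1
    have := norm_nonneg (along (mu F Y) S s v x - along (mu F X) S s v x)
    linarith
  rw [halong, halong, Function.comp_apply, Function.comp_apply]
  have := norm_sub_le_norm_sub_add_norm_sub (mu F Y t v (along (mu F Y) S s v x))
    (mu F X t v (along (mu F Y) S s v x)) (mu F X t v (along (mu F X) S s v x))
  linarith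

end Continuity

/-! ### The solution flow -/

section SolutionFlow

variable {U : Type*} [NormedAddCommGroup U] [NormedSpace ℝ U] [CompleteSpace U]
  {V : Type*} [NormedAddCommGroup V] [NormedSpace ℝ V] {p T : ℝ} {ν : TensorNorm ⌊p⌋₊ V}
  {F : FieldMap ⌊p⌋₊ V U}

theorem one_lt_exponent (hp : 0 < p) : 1 < ((⌊p⌋₊ : ℝ) + 1) / p := by
  rw [one_lt_div hp]
  exact Nat.lt_floor_add_one p

theorem exists_uniform_sewing (hp : 0 < p) (hF : ExtendsContinuously ν F) (R : ℝ) :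
    ∃ C ≥ 0, ∃ A ≥ 0, ∃ L ≥ 1, ∃ δ > 0, ∀ X : RoughPath p T ν, X.size ≤ R →
      AlmostFlow T C (1 / p) (((⌊p⌋₊ : ℝ) + 1) / p) (mu F X) ∧
      IsSewing T (((⌊p⌋₊ : ℝ) + 1) / p) A L δ (mu F X) (sewn (mu F X)) := by
  obtain ⟨C, hC, hX⟩ := exists_almostFlow_mu (T := T) hp hF R
  obtain ⟨A, hA, L, hL, δ, hδ, h⟩ := exists_isSewing (U := U) T hC (one_div_pos.2 hp)
    (one_lt_exponent hp)
  exact ⟨C, hC, A, hA, L, hL, δ, hδ, fun X hR => ⟨hX X hR, h _ (hX X hR)⟩⟩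

/-- Both flows are replaced by compositions along one fixed finite set, with an error uniform near
`X`, and such a composition depends continuously on the path. The change of times costs `ε / 2`,
each of the three other errors `ε / 8`. -/
theorem continuity_sewn_mu (hp : 0 < p) (hF : ExtendsContinuously ν F) (X : RoughPath p T ν)
    {s t : ℝ} (hs : 0 ≤ s) (hst : s ≤ t) (ht : t ≤ T) {ε : ℝ} (hε : 0 < ε) :
    ∃ η > 0, ∀ (Y : RoughPath p T ν) (s' t' : ℝ), 0 ≤ s' → s' ≤ t' → t' ≤ T → |s' - s| < η →
      |t' - t| < η → X.distance Y < η → ∀ x,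
        ‖sewn (mu F Y) t' s' x - sewn (mu F X) t s x‖ < ε := by
  have ha := one_lt_exponent hp
  obtain ⟨C, hC, A, hA, L, hL, δ, hδ, hsew⟩ :=
    exists_uniform_sewing (T := T) hp hF (X.size + 1)
  set a := ((⌊p⌋₊ : ℝ) + 1) / p
  have hlim : ∀ (c : ℝ) {b : ℝ}, 0 < b → Filter.Tendsto (fun d : ℝ => c * d ^ b)
      (nhdsWithin 0 (Set.Ioi 0)) (nhds 0) := fun c b hb => by
    have h1 : ContinuousAt (fun d : ℝ => c * d ^ b) 0 :=
      (Real.continuousAt_rpow_const 0 b (Or.inr hb.le)).const_mul c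
    have h2 := h1.tendsto
    simp only [Real.zero_rpow hb.ne', mul_zero] at h2
    exact h2.mono_left nhdsWithin_le_nhds
  have hsmall : ∀ g : ℝ → ℝ, Filter.Tendsto g (nhdsWithin 0 (Set.Ioi 0)) (nhds 0) → ∀ r > 0,
      ∃ d > 0, d ≤ δ ∧ g d < r := fun g hg r hr => by
    have h1 : ∀ᶠ d in nhdsWithin (0 : ℝ) (Set.Ioi 0), 0 < d := self_mem_nhdsWithin
    have h2 : ∀ᶠ d in nhdsWithin (0 : ℝ) (Set.Ioi 0), d ≤ δ :=
      mem_nhdsWithin_of_mem_nhds (Iic_mem_nhds hδ)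
    obtain ⟨d, hd⟩ := (h1.and (h2.and (hg.eventually_lt_const hr))).exists
    exact ⟨d, hd⟩
  obtain ⟨d, hd, hdδ, hdε⟩ := hsmall _ (hlim (L * A * (t - s)) (sub_pos.2 ha)) (ε / 8)
    (by positivity)
  obtain ⟨h, hh, hhδ, hhε⟩ := hsmall
    (fun h => 2 * ((1 + L) * (A * h ^ a + C * h ^ (1 / p))))
    (by simpa using (((hlim A (zero_lt_one.trans ha)).add (hlim C (one_div_pos.2 hp))).const_mul
      (1 + L)).const_mul 2) (ε / 2) (by positivity)
  obtain ⟨S, hS⟩ := exists_meshLE hd T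
  have hS' := hS.mono hs ht
  obtain ⟨hXa, hXs⟩ := hsew X (by linarith)
  have hlipX : ∀ s t, 0 ≤ s → s ≤ t → t ≤ T →
      LipBound (1 + C * T ^ (1 / p)) (mu F X t s) := fun s t hs hst ht =>
    (hXa.fourPoint s t hs hst ht).lipBound.mono (by
      have := sub_nonneg.2 hst
      gcongr
      linarith)
  have hT : 0 ≤ T := hs.trans (hst.trans ht)
  obtain ⟨η, hη, hclose⟩ := exists_norm_along_sub_lt hF X (by positivity) hlipX S hs hst ht
    (show 0 < ε / 8 by positivity)
  -- The bound 1 keeps the size of `Y` below `X.size + 1`, for which the sewing constants were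
  -- chosen.
  refine ⟨min (min η 1) h, by positivity, fun Y s' t' hs' hst' ht' h1 h2 h3 x => ?_⟩
  have h3' := h3.trans_le (min_le_left _ _)
  obtain ⟨hYa, hYs⟩ := hsew Y (by
    linarith [X.size_le_add_distance Y, h3'.trans_le (min_le_right _ _)])
  have e1 := hYs.flow.norm_sub_le (m := A * h ^ a + C * h ^ (1 / p)) hL hYs.lip
    (fun s t hs hst ht hts x => by
    have hts' := sub_nonneg.2 hst
    have f1 := hYs.near s t hs hst ht (hts.le.trans hhδ) x
    have f2 := hYa.near_id s t hs hst ht x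
    refine (norm_sub_le_norm_sub_add_norm_sub _ (mu F Y t s x) _).trans
      (add_le_add (f1.trans ?_) (f2.trans ?_)) <;> gcongr) hs hst ht hs' hst' ht'
    (h1.trans_le (min_le_right _ _)) (h2.trans_le (min_le_right _ _)) x
  have e2 := (hYs.norm_sub_along_le ha hL hA hd.le hdδ hs hst ht hS' x).trans_lt hdε
  have e3 := (hXs.norm_sub_along_le ha hL hA hd.le hdδ hs hst ht hS' x).trans_lt hdε
  have e4 := hclose Y (h3'.trans_le (min_le_left _ _)) x
  have e5 : sewn (mu F Y) t' s' x - sewn (mu F X) t s x =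
      (sewn (mu F Y) t' s' x - sewn (mu F Y) t s x) +
      (sewn (mu F Y) t s x - along (mu F Y) S s t x) +
      (along (mu F Y) S s t x - along (mu F X) S s t x) -
      (sewn (mu F X) t s x - along (mu F X) S s t x) := by abel
  rw [e5]
  refine (norm_sub_le _ _).trans_lt ?_
  have e6 := norm_add₃_le (a := sewn (mu F Y) t' s' x - sewn (mu F Y) t s x)
    (b := sewn (mu F Y) t s x - along (mu F Y) S s t x)
    (c := along (mu F Y) S s t x - along (mu F X) S s t x)
  linarith

/-- As `c` may depend on `R`, the sewing rate already suffices: the factor in the size of `X` is at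
least one, and `t - s ≤ T`. -/
theorem exists_norm_sub_comp_le (hp : 0 < p) (hF : ExtendsContinuously ν F) (R : ℝ) :
    ∃ c > 0, ∃ δ > 0, ∀ X : RoughPath p T ν, X.size ≤ R → ∀ s t, 0 ≤ s → s ≤ t → t ≤ T →
      ∀ P : Partition s t, P.mesh ≤ δ → ∀ x, ‖sewn (mu F X) t s x - P.comp (mu F X) x‖ ≤
        c * (1 + X.size ^ ⌊p⌋₊) ^ 2 * T * P.mesh ^ (((⌊p⌋₊ : ℝ) + 1) / p - 1) := by
  have ha := one_lt_exponent hp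
  obtain ⟨C, -, A, hA, L, hL, δ, hδ, hsew⟩ := exists_uniform_sewing (T := T) hp hF R
  refine ⟨L * A + 1, by positivity, δ, hδ, fun X hX s t hs hst ht P hP x => ?_⟩
  have h := (hsew X hX).2
  rw [P.comp_eq_along h.refl hs ht]
  refine (h.norm_sub_along_le ha hL hA P.mesh_nonneg hP hs hst ht P.meshLE_points x).trans ?_
  have h1 : 1 ≤ (1 + X.size ^ ⌊p⌋₊) ^ 2 :=
    one_le_pow₀ (le_add_of_nonneg_right (pow_nonneg X.size_nonneg _))
  have h2 : L * A ≤ (L * A + 1) * (1 + X.size ^ ⌊p⌋₊) ^ 2 := by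
    have : 0 ≤ L * A := by positivity
    nlinarith
  have h3 := P.mesh_nonneg
  have h4 := sub_nonneg.2 hst
  gcongr
  linarith

end SolutionFlow

end RoughFlow

end

/-! ### The main theorem -/

theorem mainTheorem1
    {U : Type*} [NormedAddCommGroup U] [NormedSpace ℝ U] [CompleteSpace U]
    {V : Type*} [NormedAddCommGroup V] [NormedSpace ℝ V] [CompleteSpace V]
    (p T : ℝ) (hp : 2 ≤ p) (hT : 0 ≤ T)
    (ν : RoughFlow.TensorNorm ⌊p⌋₊ V)
    (F : RoughFlow.FieldMap ⌊p⌋₊ V U)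
    (hF : RoughFlow.ExtendsContinuously ν F) :
    -- the equations defining the maps `μ_ts` are uniquely solvable
    (∀ (X : RoughFlow.RoughPath p T ν) (s t : ℝ), 0 ≤ s → s ≤ t → t ≤ T → ∀ x : U,
      (∃ y, RoughFlow.SolvesODE (RoughFlow.logField F X t s) x y) ∧
      ∀ y z, RoughFlow.SolvesODE (RoughFlow.logField F X t s) x y →
        RoughFlow.SolvesODE (RoughFlow.logField F X t s) x z → Set.EqOn y z (Set.Icc 0 1)) ∧
    ∃ φ : RoughFlow.RoughPath p T ν → ℝ → ℝ → U → U,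
      -- existence, with an exponent larger than one that does not depend on `X`
      (∀ X, RoughFlow.SolvesRDE F X (((⌊p⌋₊ : ℝ) + 1) / p) (φ X)) ∧
      -- uniqueness, whatever the exponent
      (∀ X, ∀ a : ℝ, 1 < a → ∀ ψ : ℝ → ℝ → U → U, RoughFlow.SolvesRDE F X a ψ →
        ∀ s t, 0 ≤ s → s ≤ t → t ≤ T → ψ t s = φ X t s) ∧
      -- continuity in `((s, t), X)`, for the uniform norm on maps from `U` to itself
      (∀ (X : RoughFlow.RoughPath p T ν) (s t : ℝ), 0 ≤ s → s ≤ t → t ≤ T →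
        ∀ ε > 0, ∃ η > 0, ∀ (Y : RoughFlow.RoughPath p T ν) (s' t' : ℝ),
          0 ≤ s' → s' ≤ t' → t' ≤ T → |s' - s| < η → |t' - t| < η → X.distance Y < η →
            ∀ x, ‖φ Y t' s' x - φ X t s x‖ < ε) ∧
      -- approximation by compositions along partitions, uniformly on bounded sets of rough paths
      (∀ R : ℝ, ∃ c > 0, ∃ δ > 0, ∀ X : RoughFlow.RoughPath p T ν, X.size ≤ R →
        ∀ s t, 0 ≤ s → s ≤ t → t ≤ T → ∀ P : RoughFlow.Partition s t, P.mesh ≤ δ →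
          ∀ x, ‖φ X t s x - P.comp (RoughFlow.mu F X) x‖ ≤
            c * (1 + X.size ^ ⌊p⌋₊) ^ 2 * T * P.mesh ^ (((⌊p⌋₊ : ℝ) + 1) / p - 1)) := by
  have hp0 : 0 < p := by linarith
  refine ⟨fun X s t hs hst ht x => ?_, fun X => RoughFlow.sewn (RoughFlow.mu F X), fun X => ?_,
    fun X a ha ψ hψ s t hs hst ht => ?_,
    fun X s t hs hst ht ε hε => RoughFlow.continuity_sewn_mu hp0 hF X hs hst ht hε,
    RoughFlow.exists_norm_sub_comp_le hp0 hF⟩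
  · obtain ⟨K, hK, hl, hb⟩ := RoughFlow.exists_logField_bound hF X hs hst ht
    exact ⟨RoughFlow.exists_solvesODE hK hl hb x, fun y z hy hz => hy.eqOn hK hl hz⟩
  · obtain ⟨_, _, A, hA, L, -, δ, hδ, h⟩ :=
      RoughFlow.exists_uniform_sewing (T := T) hp0 hF X.size
    have hX := (h X le_rfl).2
    refine ⟨hX.flow, δ, hδ, A + 1, by positivity, fun s t hs hst ht hts x =>
      (hX.near s t hs hst ht hts x).trans ?_⟩
    have := Real.rpow_nonneg (sub_nonneg.2 hst) (((⌊p⌋₊ : ℝ) + 1) / p)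
    gcongr
    linarith
  · obtain ⟨_, _, A, hA, L, hL, δ, hδ, h⟩ :=
      RoughFlow.exists_uniform_sewing (T := T) hp0 hF X.size
    obtain ⟨hflow, δ', hδ', c, hc, hψμ⟩ := hψ
    exact (h X le_rfl).2.unique (RoughFlow.one_lt_exponent hp0) hL hA hδ ha hc.le hδ' hflow hψμ
      hs hst ht
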